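/- Let $p$ be a positive even integer, $q=p/2$, and fix integers $k,\gamma\ge 0$. There are positive integer constants (the constants hidden in the $\Theta(\cdot)$ below) and $C,D$, depending only on $p,k,\gamma$, such that for all $n\ge 2$ and $0<\varepsilon<1$ the following holds for the streaming algorithm described below, whose input is an integer matrix $A=(a_{ij})\in\mathbb Z^{n\times n}$ given as a turnstile stream: a sequence of updates $(i,j,\delta)$, $\delta\in\mathbb Z$, each meaning $a_{ij}\leftarrow a_{ij}+\delta$, starting from $A=0$. (1) The algorithm uses at most $C\,n^{1-2/p}\,(1/\varepsilon)^{D}(\log n)^{D}$ bits of space, for its random seeds and its memory together. (2) For every stream whose final matrix $A$ has at most $k$ non-zero entries in each row and in each column and satisfies $|a_{ij}|\le n^{\gamma}$, the returned value $Y$ satisfies, with probability at least $2/3$ over the seeds, $$\bigl|Y-\|A\|_p^p\bigr|\le\varepsilon\,\|A\|_p^p ,\qquad \|A\|_p^p=\sum_{i=1}^n\sigma_i(A)^p ,$$ where $\sigma_1(A),\dots,\sigma_n(A)$ are the singular values of $A$. *The algorithm.* Put $\eta=\Theta(\varepsilon)$, $\Lambda=\log(n/\eta)$, $T=\Theta(n^{1-2/p}/\eta^2)$,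 $R=\Theta(\Lambda/\eta)$, $w=\Theta(\Lambda/\eta^2)$, $w_S=\Theta(T/\eta^2)$. Counters are $\Theta(\Lambda)$-bit words; hash functions are polynomials of degree less than $\Theta(\Lambda)$ with independent random coefficients in a field with $2^m$ elements, $m=\Theta(\Lambda)$. A Count-Sketch of width $W$ of a matrix $X$ has an odd number $\Theta(\Lambda)$ of rows of $W$ counters each; each row uses a bucket hash function $h$ and a random sign function $\varsigma$ on the $n^2$ positions, its counter $v$ is $\sum_{(i,j):h(i,j)=v}\varsigma(i,j)x_{ij}$, and the estimate of $x_{ij}$ is the median over the rows of $\varsigma(i,j)$ times the counter $h(i,j)$. An AMS sketch of $X$ estimates $\|X\|_F^2$ by the median of $\Theta(\Lambda)$ means of $\Theta(1/\eta^2)$ values $(\sum_{i,j}\varsigma(i,j)x_{ij})^2$. While reading the stream, with independent seeds, maintain: (a) for each $s\le q$ a Count-Sketch $\mathcal S_s$ of $A$ of width $\Theta(w_S)$; (b) an AMS sketch of $A$, with estimate $L$; (c) for each $s\le q$, $t\le T$, $r\le R$ random numbers $u_1,\dots,u_n\in(0,1]$ (uniform multiples of $2^{-m}$), a Count-Sketch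 of width $\Theta(w)$ of $B=DA$, $D=\mathrm{diag}(1/\sqrt{u_1},\dots,1/\sqrt{u_n})$ (its entries are rounded down to $m$ binary places), and an AMS sketch of $B$, with estimate $L'$. At the end: for each $(s,t)$ and $r=1,\dots,R$, form rows $\tilde b_i$ from the Count-Sketch estimates of $B$, retaining only entries of absolute value at least $2\sqrt{L'/w}$; at the first $r$ for which there is exactly one $i$ with $\|\tilde b_i\|_2^2\ge\Theta(1)L/\eta$, the row $i$ is sampled, with $\tilde a_i=\sqrt{u_i}\,\tilde b_i$ and weight $\tilde\tau=L/\|\tilde a_i\|_2^2$. For each $s$, form rows $\tilde a'_i$ from $\mathcal S_s$, retaining only entries of absolute value at least $2\sqrt{L/w_S}$; let $K_s$ consist of the at most $\Theta(T)$ rows of largest $\|\tilde a'_i\|_2^2$ among those with $\|\tilde a'_i\|_2^2\ge L/(10T)$, each with $\tilde a_i=\tilde a'_i$ and weight $\tilde\tau=1$. Let the multiset $I_s$ consist of the rows of $K_s$, each once, and of the rows sampled for $(s,1),\dots,(s,T)$ that are not in $K_s$, with multiplicity. Return $$Y=\sum_{(i_1,\dots,i_q)\in I_1\times\cdots\times I_q}\frac{1}{T^{|\{s:\,i_s\notin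 K_s\}|}}\prod_{s=1}^q\langle\tilde a_{i_s},\tilde a_{i_{s+1}}\rangle\prod_{s=1}^q\tilde\tau(i_s),\qquad i_{q+1}=i_1,$$ where the row $\tilde a_{i_s}$ and the weight $\tilde\tau(i_s)$ are those belonging to the element of $I_s$. -/

import Mathlib

open scoped BigOperators

namespace SchattenStream

/-! ## Turnstile streams, streaming algorithms and Schatten norms -/

/-- An update `(i, j, δ)`, which adds the integer `δ` (of either sign) to the entry `(i, j)`. -/
abbrev Update (n : ℕ) : Type := Fin n × Fin n × ℤ

/-- The integer matrix that a stream of updates defines, starting from the zero matrix. -/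
def streamMatrix {n : ℕ} (σ : List (Update n)) : Matrix (Fin n) (Fin n) ℤ :=
  fun i j => (σ.map fun u => if u.1 = i ∧ u.2.1 = j then u.2.2 else 0).sum

/-- At most `k` non-zero entries in every row and in every column. -/
def IsSparse {n : ℕ} (k : ℕ) (A : Matrix (Fin n) (Fin n) ℤ) : Prop :=
  (∀ i, (Finset.univ.filter fun j => A i j ≠ 0).card ≤ k) ∧
    ∀ j, (Finset.univ.filter fun i => A i j ≠ 0).card ≤ k

/-- `‖A‖_p ^ p`, the sum of the `p`-th powers of the singular values of `A`. -/
noncomputable def schattenPow {n : ℕ} (p : ℕ) (A : Matrix (Fin n) (Fin n) ℝ) : ℝ :=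
  ∑ i ∈ Finset.range n, (Matrix.toEuclideanLin A).singularValues i ^ p

/-- A one-pass randomized streaming algorithm on `n × n` matrices.  A uniformly random seed is drawn
before the stream starts and is the only source of randomness.  Between two updates the algorithm
remembers nothing except its seed and its memory. -/
structure StreamingAlgorithm (n : ℕ) where
  Seed : Type
  Mem : Type
  seedFinite : Finite Seed
  seedNonempty : Nonempty Seed
  memFinite : Finite Mem
  init : Seed → Mem
  update : Seed → Update n → Mem → Mem
  output : Seed → Mem → ℝ

namespace StreamingAlgorithm

variable {n : ℕ} (𝒜 : StreamingAlgorithm n)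

/-- The value returned on the stream `σ` when the seed is `s`. -/
def result (σ : List (Update n)) (s : 𝒜.Seed) : ℝ :=
  𝒜.output s (σ.foldl (fun M u => 𝒜.update s u M) (𝒜.init s))

/-- The probability, over the random seed, that the value returned on `σ` satisfies `P`. -/
noncomputable def prob (σ : List (Update n)) (P : ℝ → Prop) : ℝ :=
  (Nat.card {s : 𝒜.Seed // P (𝒜.result σ s)} : ℝ) / (Nat.card 𝒜.Seed : ℝ)

/-- The number of bits needed to store the random seed together with the memory. -/
noncomputable def spaceBits : ℕ := Nat.clog 2 (Nat.card (𝒜.Seed × 𝒜.Mem))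

end StreamingAlgorithm

/-! ## Hash functions with limited independence -/

/-- The seed of a hash function: the `κ` coefficients of a polynomial of degree less than `κ` over
the field with `2 ^ m` elements.  A uniformly random seed gives a `κ`-wise independent function. -/
abbrev HashSeed (κ m : ℕ) : Type := Fin κ → GaloisField 2 m

/-- The field element with number `N` (numbers are taken modulo the size of the field). -/
noncomputable def fieldPoint (m N : ℕ) : GaloisField 2 m :=
  (Finite.equivFin (GaloisField 2 m)).symm
    ⟨N % Nat.card (GaloisField 2 m), Nat.mod_lt _ Nat.card_pos⟩

/-- The hash value of `N`, a number in `{0, …, 2 ^ m - 1}` (for `m ≠ 0`). -/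
noncomputable def hashVal {κ m : ℕ} (h : HashSeed κ m) (N : ℕ) : ℕ :=
  (Finite.equivFin (GaloisField 2 m) (∑ j, h j * fieldPoint m N ^ (j : ℕ))).val

/-- A random sign, read off the last bit of the hash value. -/
noncomputable def hashSign {κ m : ℕ} (h : HashSeed κ m) (N : ℕ) : ℤ :=
  if hashVal h N % 2 = 0 then 1 else -1

/-- A random bucket among `2 ^ a`, read off the last `a` bits of the hash value. -/
noncomputable def hashBucket {κ m : ℕ} (a : ℕ) (h : HashSeed κ m) (N : ℕ) : Fin (2 ^ a) :=
  ⟨hashVal h N % 2 ^ a, Nat.mod_lt _ (by positivity)⟩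

/-- A random number in `(0, 1]` with `m` binary digits. -/
noncomputable def hashUnif {κ m : ℕ} (h : HashSeed κ m) (N : ℕ) : ℝ :=
  ((hashVal h N : ℝ) + 1) / 2 ^ m

/-- The number of a matrix position. -/
def posCode {n : ℕ} (i j : Fin n) : ℕ := i.val * n + j.val

/-! ## Count-Sketch and the AMS sketch

All counters are machine words of `b` bits, that is, signed integers with arithmetic
modulo `2 ^ b`. -/

/-- The median of an odd number of reals. -/
noncomputable def median {d : ℕ} (f : Fin (2 * d + 1) → ℝ) : ℝ :=
  f (Tuple.sort f ⟨d, by omega⟩)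

abbrev Word (b : ℕ) : Type := ZMod (2 ^ b)

/-- One bucket hash function and one sign hash function for each of the `2 * d + 1` rows. -/
abbrev CSSeed (κ m d : ℕ) : Type := Fin (2 * d + 1) → HashSeed κ m × HashSeed κ m

abbrev CSTable (d a b : ℕ) : Type := Fin (2 * d + 1) → Fin (2 ^ a) → Word b

/-- Count-Sketch: add `x` to the entry `(i, j)` of the sketched matrix. -/
noncomputable def csAdd {n κ m d a b : ℕ} (s : CSSeed κ m d) (i j : Fin n) (x : ℤ)
    (C : CSTable d a b) : CSTable d a b :=
  fun r v => C r v +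
    if hashBucket a (s r).1 (posCode i j) = v
      then ((hashSign (s r).2 (posCode i j) * x : ℤ) : Word b) else 0

/-- Count-Sketch: the estimate of the entry `(i, j)` of the sketched matrix. -/
noncomputable def csEst {n κ m d a b : ℕ} (s : CSSeed κ m d) (C : CSTable d a b)
    (i j : Fin n) : ℝ :=
  median fun r => ((hashSign (s r).2 (posCode i j) *
    (C r (hashBucket a (s r).1 (posCode i j))).valMinAbs : ℤ) : ℝ)

abbrev AMSSeed (κ m d V : ℕ) : Type := Fin (2 * d + 1) → Fin V → HashSeed κ m

abbrev AMSTable (d V b : ℕ) : Type := Fin (2 * d + 1) → Fin V → Word b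

/-- AMS sketch: add `x` to the entry `(i, j)` of the sketched matrix. -/
noncomputable def amsAdd {n κ m d V b : ℕ} (s : AMSSeed κ m d V) (i j : Fin n) (x : ℤ)
    (Z : AMSTable d V b) : AMSTable d V b :=
  fun r v => Z r v + ((hashSign (s r v) (posCode i j) * x : ℤ) : Word b)

/-- AMS sketch: the estimate (median of means) of the squared Frobenius norm. -/
noncomputable def amsEst {κ m d V b : ℕ} (_s : AMSSeed κ m d V) (Z : AMSTable d V b) : ℝ :=
  median fun r => (∑ v, ((Z r v).valMinAbs : ℝ) ^ 2) / V

/-! ## Rows -/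

/-- Keep `x` if its absolute value is at least `t`, and replace it by `0` otherwise. -/
noncomputable def retain (t x : ℝ) : ℝ := if t ≤ |x| then x else 0

/-- The squared Euclidean norm of a row. -/
def normSq {n : ℕ} (v : Fin n → ℝ) : ℝ := v ⬝ᵥ v

/-! ## Precision sampling of rows -/

/-- The sizes of all structures. -/
structure Sizes where
  /-- number of precision samples for each of the `q` factors -/
  T : ℕ
  /-- number of repetitions for each precision sample -/
  R : ℕ
  /-- accuracy of the Count-Sketches of the precision samplers: squared error `‖B‖_F² / w` -/
  w : ℕ
  /-- each of their rows has `2 ^ a` counters -/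
  a : ℕ
  /-- accuracy of the Count-Sketches that find the heavy rows: squared error `‖A‖_F² / wS` -/
  wS : ℕ
  /-- each of their rows has `2 ^ aS` counters -/
  aS : ℕ
  /-- all medians are over `2 * d + 1` values -/
  d : ℕ
  /-- number of columns of the AMS sketches -/
  V : ℕ
  /-- number of bits of a hash value -/
  m : ℕ
  /-- degree of independence of the hash functions -/
  κ : ℕ
  /-- number of bits of a counter -/
  b : ℕ
  /-- maximal number of heavy rows that are retained -/
  cap : ℕ
  /-- a row of `B` is sampled if its squared norm exceeds `thr` times (the estimate of) `‖A‖_F²` -/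
  thr : ℝ

section PrecisionSampling

variable (z : Sizes)

/-- The seed of one precision sampling structure: the seeds of the numbers `u_1, …, u_n`, of the
Count-Sketch of `B = D A` and of the AMS sketch of `B`. -/
abbrev PSeed : Type := HashSeed z.κ z.m × CSSeed z.κ z.m z.d × AMSSeed z.κ z.m z.d z.V

abbrev PMem : Type := CSTable z.d z.a z.b × AMSTable z.d z.V z.b

variable {n : ℕ} {z}

/-- The number `u_i`. -/
noncomputable def pU (s : PSeed z) (i : Fin n) : ℝ := hashUnif s.1 i.val

/-- The `i`-th diagonal entry `1 / √u_i` of `D`, in units of `2 ^ (-m)` and rounded down. -/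
noncomputable def pScale (s : PSeed z) (i : Fin n) : ℤ := ⌊(2 : ℝ) ^ z.m / √(pU s i)⌋

noncomputable def pUpdate (s : PSeed z) (u : Update n) (M : PMem z) : PMem z :=
  (csAdd s.2.1 u.1 u.2.1 (pScale s u.1 * u.2.2) M.1,
    amsAdd s.2.2 u.1 u.2.1 (pScale s u.1 * u.2.2) M.2)

/-- `L'`, the estimate of `‖B‖_F²`. -/
noncomputable def pNorm (s : PSeed z) (M : PMem z) : ℝ := amsEst s.2.2 M.2 / ((2 : ℝ) ^ z.m) ^ 2

/-- The estimate of the `i`-th row of `B`; only entries above the noise level are retained. -/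
noncomputable def pRow (s : PSeed z) (M : PMem z) (i : Fin n) : Fin n → ℝ :=
  fun j => retain (2 * √(pNorm s M / z.w)) (csEst s.2.1 M.1 i j / (2 : ℝ) ^ z.m)

open Classical in
/-- If there is a unique row `i` of (the estimate of) `B` whose squared norm is at least `θ`, then
return `i` together with the estimate of the `i`-th row of `A`. -/
noncomputable def pSample (θ : ℝ) (s : PSeed z) (M : PMem z) : Option (Fin n × (Fin n → ℝ)) :=
  if h : ∃! i : Fin n, θ ≤ normSq (pRow s M i) then
    some (h.exists.choose, fun j => √(pU s h.exists.choose) * pRow s M h.exists.choose j)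
  else none

end PrecisionSampling

/-! ## The algorithm -/

section Algorithm

variable (q : ℕ) (z : Sizes)

/-- The seeds of the `q` Count-Sketches of `A` that find heavy rows, of the AMS sketch of `A` and
of the `q * T` precision samplers with `R` repetitions each; all of them are independent. -/
abbrev AlgSeed : Type :=
  (Fin q → CSSeed z.κ z.m z.d) × AMSSeed z.κ z.m z.d z.V × (Fin q → Fin z.T → Fin z.R → PSeed z)

abbrev AlgMem : Type :=
  (Fin q → CSTable z.d z.aS z.b) × AMSTable z.d z.V z.b × (Fin q → Fin z.T → Fin z.R → PMem z)

variable {q z}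

instance : Finite (PSeed z) := by
  have h1 : Finite (CSSeed z.κ z.m z.d) := inferInstance
  have h2 : Finite (AMSSeed z.κ z.m z.d z.V) := inferInstance
  infer_instance

instance : Finite (PMem z) := by
  have h1 : Finite (CSTable z.d z.a z.b) := inferInstance
  have h2 : Finite (AMSTable z.d z.V z.b) := inferInstance
  infer_instance

instance : Finite (AlgSeed q z) := by
  have h1 : Finite (Fin q → CSSeed z.κ z.m z.d) := inferInstance
  have h2 : Finite (AMSSeed z.κ z.m z.d z.V) := inferInstance
  have h3 : Finite (Fin z.T → Fin z.R → PSeed z) := inferInstance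
  infer_instance

instance : Finite (AlgMem q z) := by
  have h1 : Finite (Fin q → CSTable z.d z.aS z.b) := inferInstance
  have h2 : Finite (AMSTable z.d z.V z.b) := inferInstance
  have h3 : Finite (Fin z.T → Fin z.R → PMem z) := inferInstance
  infer_instance

variable {n : ℕ}

noncomputable def algUpdate (s : AlgSeed q z) (u : Update n) (M : AlgMem q z) : AlgMem q z :=
  (fun f => csAdd (s.1 f) u.1 u.2.1 u.2.2 (M.1 f),
    amsAdd s.2.1 u.1 u.2.1 u.2.2 M.2.1,
    fun f t r => pUpdate (s.2.2 f t r) u (M.2.2 f t r))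

/-- `L`, the estimate of `‖A‖_F²`. -/
noncomputable def algL (s : AlgSeed q z) (M : AlgMem q z) : ℝ := amsEst s.2.1 M.2.1

/-- The estimate of row `i` from the `f`-th Count-Sketch of `A`; only entries above the noise level
are retained. -/
noncomputable def heavyEst (s : AlgSeed q z) (M : AlgMem q z) (f : Fin q) (i : Fin n) :
    Fin n → ℝ :=
  fun j => retain (2 * √(algL s M / z.wS)) (csEst (s.1 f) (M.1 f) i j)

open Classical in
/-- The rows whose estimated squared norm is at least `L / (10 T)`. -/
noncomputable def heavyCandidates (s : AlgSeed q z) (M : AlgMem q z) (f : Fin q) :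
    Finset (Fin n) :=
  Finset.univ.filter fun i => algL s M / (10 * z.T) ≤ normSq (heavyEst s M f i)

open Classical in
/-- `K_f`: the `cap` candidates of largest estimated norm (ties are broken by the index). -/
noncomputable def heavySet (s : AlgSeed q z) (M : AlgMem q z) (f : Fin q) : Finset (Fin n) :=
  (heavyCandidates s M f).filter fun i =>
    ((heavyCandidates s M f).filter fun i' =>
      normSq (heavyEst s M f i) < normSq (heavyEst s M f i') ∨
        (normSq (heavyEst s M f i) = normSq (heavyEst s M f i') ∧ i' < i)).card < z.cap

/-- The `t`-th precision sample for the factor `f`: the outcome of the first repetition that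
returns a row. -/
noncomputable def sample (n : ℕ) (s : AlgSeed q z) (M : AlgMem q z) (f : Fin q) (t : Fin z.T) :
    Option (Fin n × (Fin n → ℝ)) :=
  (List.finRange z.R).findSome? fun r =>
    pSample (z.thr * algL s M) (s.2.2 f t r) (M.2.2 f t r)

open Classical in
/-- The multiset `I_f`, as a set of labels: `inl i` is the row `i` of `K_f`, and `inr t` is the
`t`-th sampled row, provided that there is one and that it is not in `K_f` (a row of `K_f` is
counted once). -/
noncomputable def labels (n : ℕ) (s : AlgSeed q z) (M : AlgMem q z) (f : Fin q) :
    Finset (Fin n ⊕ Fin z.T) :=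
  Finset.univ.filter fun l =>
    match l with
    | Sum.inl i => i ∈ heavySet s M f
    | Sum.inr t => ∃ x, sample n s M f t = some x ∧ x.1 ∉ heavySet s M f

/-- The estimated row that belongs to a label. -/
noncomputable def labelRow (s : AlgSeed q z) (M : AlgMem q z) (f : Fin q) :
    Fin n ⊕ Fin z.T → Fin n → ℝ
  | Sum.inl i => heavyEst s M f i
  | Sum.inr t => ((sample n s M f t).map Prod.snd).getD 0

/-- The weight: `1` for the rows of `K_f`, and `L` over the estimated squared norm otherwise. -/
noncomputable def labelWeight (s : AlgSeed q z) (M : AlgMem q z) (f : Fin q) :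
    Fin n ⊕ Fin z.T → ℝ
  | Sum.inl _ => 1
  | Sum.inr t => algL s M / normSq (labelRow (n := n) s M f (Sum.inr t))

/-- The estimator: the sum over `(l_1, …, l_q) ∈ I_1 × ⋯ × I_q` of the cyclic product of the inner
products of consecutive rows, times the weights, over `T` to the number of labels not in a `K_f`. -/
noncomputable def estimator (n : ℕ) (s : AlgSeed q z) (M : AlgMem q z) : ℝ :=
  ∑ l ∈ Fintype.piFinset fun f => labels n s M f,
    1 / (z.T : ℝ) ^ (Finset.univ.filter fun f => (l f).isRight).card *
      ((∏ f, labelRow s M f (l f) ⬝ᵥ labelRow s M (finRotate q f) (l (finRotate q f))) *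
        ∏ f, labelWeight s M f (l f))

end Algorithm

/-- The algorithm for `‖A‖_{2q}^{2q}` with given sizes of the structures. -/
noncomputable def sizedAlgorithm (n q : ℕ) (z : Sizes) : StreamingAlgorithm n where
  Seed := AlgSeed q z
  Mem := AlgMem q z
  seedFinite := inferInstance
  seedNonempty := inferInstance
  memFinite := inferInstance
  init := fun _ => 0
  update := algUpdate
  output := estimator n

/-- The positive constants hidden in the asymptotic notation for the sizes. -/
structure Constants where
  acc : ℕ+
  T : ℕ+
  R : ℕ+
  w : ℕ+
  wS : ℕ+
  width : ℕ+
  d : ℕ+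
  V : ℕ+
  m : ℕ+
  κ : ℕ+
  b : ℕ+
  cap : ℕ+
  thr : ℕ+

/-- The sizes for dimension `n`, exponent `p` and accuracy `ε`.  The algorithm works with internal
accuracy `η = Θ(ε)`; the logarithmic factors are `Λ = log (n / η)`. -/
noncomputable def sizes (c : Constants) (n p : ℕ) (ε : ℝ) : Sizes :=
  let η : ℝ := ε / c.acc
  let Λ : ℝ := Real.log (n / η)
  let T : ℕ := ⌈c.T * (n : ℝ) ^ (1 - 2 / (p : ℝ)) / η ^ 2⌉₊
  let w : ℕ := ⌈c.w * Λ / η ^ 2⌉₊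
  let wS : ℕ := ⌈c.wS * T / η ^ 2⌉₊
  { T := T
    R := ⌈c.R * Λ / η⌉₊
    w := w
    a := Nat.clog 2 (c.width * w)
    wS := wS
    aS := Nat.clog 2 (c.width * wS)
    d := ⌈c.d * Λ⌉₊
    V := ⌈c.V / η ^ 2⌉₊
    m := ⌈c.m * Λ⌉₊
    κ := ⌈c.κ * Λ⌉₊
    b := ⌈c.b * Λ⌉₊
    cap := c.cap * T
    thr := c.thr / η }

/-- The streaming algorithm for `‖A‖_p^p`, `p` even, on sparse `n × n` matrices. -/
noncomputable def evenAlgorithm (c : Constants) (n p : ℕ) (ε : ℝ) : StreamingAlgorithm n :=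
  sizedAlgorithm n (p / 2) (sizes c n p ε)

end SchattenStream

open SchattenStream

namespace SchattenStream

/-! ## Averages over finite probability spaces -/

/-! Let `a_i` be the rows of `A`, `F = ‖A‖_F²` and `N = AᵀA = ∑ a_iᵀ a_i`. Then `‖A‖_{2q}^{2q} = tr
N ^ q` is the sum over closed walks `c` on the columns of `∏ N (c_{f-1}) (c_f)`
(`schattenPow_eq_cyclicSum`). Expanding all inner products writes the estimator as the same sum with
the `f`-th factor `N` replaced by a random matrix: the Gram matrix of the estimated rows of `K_f`
plus the average of `T` reweighted samples outside `K_f` (`estimator_eq_of_good`). It suffices that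
these matrices are independent, have mean `N` up to an entrywise error `O(η)`, and have small
entrywise covariances.

One sample. Row `i` passes the threshold `θ = 8 L / η` roughly when `u_i ≤ ‖a_i‖² / θ`, an event of
probability `‖a_i‖² / θ`. Rounding, noise from the other rows, a second row above the threshold and
sketch failures change this only by a relative `O(η)` (`abs_avg_observable_sub_le`). In one
repetition some row passes with probability about `F / θ`, of order `η`. So after `R` repetitions
the first success is row `i` with probability about `‖a_i‖² / F`, and the weight `L / ‖ã_i‖²` makes
its expected contribution `a_iᵀ a_i`, up to `O(η) ‖a_i‖²` in each entry (`abs_avg_sample_sub_le`).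
The cut-off at the noise level keeps every estimated row within the support of the true row, so
errors occur only at pairs of columns that share a row.

Mean square error. By independence the second moment is a sum over pairs of closed walks `(c, d)` of
products over `f` (`avg_cyclicSum_sub_sq_le`). The covariance in factor `f` is at most `η²` times a
product of column masses, plus `η² ρ` times one column mass if `c_f` and `d_f` share a row. By
sparsity the column graph has degree at most `k² + 1`, so boundedly many closed walks pass through a
given column, and all sums reduce to `∑ y_c ^ q`, where `y_c` is the mass of the rows meeting column
`c`. This is at most `ρ ^ q ≤ k ^ (2q) ‖A‖_p^p`, and the power mean inequality gives `F ≤ n ^ (1 -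
1/q) ρ ≤ η² T ρ` (`exists_scale`), which is the reason for the exponent `1 - 2/p`. The resulting
mean square error `O(η²) ‖A‖_p^(2p)` (`avg_factorMatrix_error_le`) holds for any sets `K_f` whose
rows are estimated accurately. One therefore fixes the seeds of the sketches of `A`, which determine
`K_f` and `L`, and applies Chebyshev's inequality to the samplers.

Sketch failures are handled without conditioning: in the idealized process a repetition with
inaccurate sketches returns nothing (`pOut`), and the true estimator agrees with the idealized one
unless some sketch fails (`le_prob_sizedAlgorithm`). The remaining arithmetic is in
`sizeConditions_sizes` and `spaceBits_le`. -/

/-- The average of a real function over a finite type. -/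
noncomputable def avg {Ω : Type*} [Finite Ω] (f : Ω → ℝ) : ℝ :=
  letI := Fintype.ofFinite Ω
  (∑ x, f x) / Fintype.card Ω

/-- The indicator of a proposition. -/
noncomputable def ind (P : Prop) : ℝ :=
  letI := Classical.dec P
  if P then 1 else 0

section Ind

lemma ind_true {P : Prop} (h : P) : ind P = 1 := by simp [ind, h]

lemma ind_false {P : Prop} (h : ¬ P) : ind P = 0 := by simp [ind, h]

lemma ind_nonneg (P : Prop) : 0 ≤ ind P := by
  by_cases h : P <;> simp [ind, h]

lemma ind_le_one (P : Prop) : ind P ≤ 1 := by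
  by_cases h : P <;> simp [ind, h]

lemma ind_mono {P Q : Prop} (h : P → Q) : ind P ≤ ind Q := by
  by_cases hP : P
  · rw [ind_true hP, ind_true (h hP)]
  · rw [ind_false hP]; exact ind_nonneg Q

lemma ind_not (P : Prop) : ind (¬ P) = 1 - ind P := by
  by_cases h : P <;> simp [ind, h]

lemma ind_and (P Q : Prop) : ind (P ∧ Q) = ind P * ind Q := by
  by_cases h : P <;> by_cases h' : Q <;> simp [ind, h, h']

lemma ind_mul_self (P : Prop) : ind P * ind P = ind P := by
  by_cases h : P <;> simp [ind, h]

lemma ind_or_le (P Q : Prop) : ind (P ∨ Q) ≤ ind P + ind Q := by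
  by_cases h : P <;> by_cases h' : Q <;> simp [ind, h, h']

lemma ind_exists_le {ι : Type*} [Fintype ι] (P : ι → Prop) :
    ind (∃ i, P i) ≤ ∑ i, ind (P i) := by
  by_cases h : ∃ i, P i
  · obtain ⟨i, hi⟩ := h
    calc ind (∃ i, P i) ≤ 1 := ind_le_one _
      _ = ind (P i) := (ind_true hi).symm
      _ ≤ _ := Finset.single_le_sum (f := fun i => ind (P i)) (fun j _ => ind_nonneg _)
          (Finset.mem_univ i)
  · rw [ind_false h]
    exact Finset.sum_nonneg fun i _ => ind_nonneg _

lemma ind_forall {ι : Type*} [Fintype ι] (P : ι → Prop) :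
    ind (∀ i, P i) = ∏ i, ind (P i) := by
  by_cases h : ∀ i, P i
  · rw [ind_true h, Finset.prod_congr rfl fun i _ => ind_true (h i)]; simp
  · rw [ind_false h]
    push Not at h
    obtain ⟨i, hi⟩ := h
    exact (Finset.prod_eq_zero (Finset.mem_univ i) (ind_false hi)).symm

lemma ite_eq_ind_mul (P : Prop) [Decidable P] (x : ℝ) : (if P then x else 0) = ind P * x := by
  by_cases h : P <;> simp [ind, h]

end Ind

section Avg

variable {Ω Ω' : Type*} [Finite Ω] [Finite Ω']

lemma avg_eq {Ω : Type*} [Fintype Ω] (f : Ω → ℝ) : avg f = (∑ x, f x) / Fintype.card Ω := by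
  unfold avg
  congr!

lemma avg_congr {f g : Ω → ℝ} (h : ∀ x, f x = g x) : avg f = avg g := by
  rw [funext h]

lemma avg_const [Nonempty Ω] (a : ℝ) : avg (fun _ : Ω => a) = a := by
  have := Fintype.ofFinite Ω
  rw [avg_eq]
  simp

lemma avg_zero : avg (fun _ : Ω => (0 : ℝ)) = 0 := by
  have := Fintype.ofFinite Ω
  rw [avg_eq]; simp

lemma avg_add (f g : Ω → ℝ) : avg (fun x => f x + g x) = avg f + avg g := by
  have := Fintype.ofFinite Ω
  simp only [avg_eq, Finset.sum_add_distrib, add_div]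

lemma avg_sub (f g : Ω → ℝ) : avg (fun x => f x - g x) = avg f - avg g := by
  have := Fintype.ofFinite Ω
  simp only [avg_eq, Finset.sum_sub_distrib, sub_div]

lemma avg_const_mul (a : ℝ) (f : Ω → ℝ) : avg (fun x => a * f x) = a * avg f := by
  have := Fintype.ofFinite Ω
  simp only [avg_eq, ← Finset.mul_sum, mul_div_assoc]

lemma avg_mul_const (a : ℝ) (f : Ω → ℝ) : avg (fun x => f x * a) = avg f * a := by
  simp only [mul_comm _ a, avg_const_mul]

lemma avg_div_const (a : ℝ) (f : Ω → ℝ) : avg (fun x => f x / a) = avg f / a := by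
  simp only [div_eq_mul_inv, avg_mul_const]

lemma avg_sum {ι : Type*} (s : Finset ι) (f : ι → Ω → ℝ) :
    avg (fun x => ∑ i ∈ s, f i x) = ∑ i ∈ s, avg (f i) := by
  have := Fintype.ofFinite Ω
  simp only [avg_eq, ← Finset.sum_div]
  rw [Finset.sum_comm]

lemma avg_mono {f g : Ω → ℝ} (h : ∀ x, f x ≤ g x) : avg f ≤ avg g := by
  have := Fintype.ofFinite Ω
  simp only [avg_eq]
  gcongr with x
  exact h x

lemma avg_nonneg {f : Ω → ℝ} (h : ∀ x, 0 ≤ f x) : 0 ≤ avg f := by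
  rw [← avg_zero (Ω := Ω)]; exact avg_mono h

lemma avg_le_of_forall_le [Nonempty Ω] {f : Ω → ℝ} {a : ℝ} (h : ∀ x, f x ≤ a) : avg f ≤ a :=
  (avg_mono h).trans (avg_const a).le

lemma abs_avg_le (f : Ω → ℝ) : |avg f| ≤ avg (fun x => |f x|) := by
  have := Fintype.ofFinite Ω
  simp only [avg_eq, abs_div, Nat.abs_cast]
  gcongr
  exact Finset.abs_sum_le_sum_abs _ _

lemma avg_equiv (e : Ω ≃ Ω') (f : Ω' → ℝ) : avg (fun x => f (e x)) = avg f := by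
  have := Fintype.ofFinite Ω
  have := Fintype.ofFinite Ω'
  simp only [avg_eq]
  rw [Equiv.sum_comp e f, Fintype.card_congr e]

lemma avg_prod (f : Ω × Ω' → ℝ) : avg f = avg fun x => avg fun y => f (x, y) := by
  have := Fintype.ofFinite Ω
  have := Fintype.ofFinite Ω'
  simp only [avg_eq, Fintype.sum_prod_type, ← Finset.sum_div, Fintype.card_prod]
  push_cast
  rw [div_div, mul_comm]

lemma avg_comm (f : Ω → Ω' → ℝ) :
    (avg fun x => avg fun y => f x y) = avg fun y => avg fun x => f x y := by
  rw [← avg_prod (fun z : Ω × Ω' => f z.1 z.2),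
    ← avg_prod (fun z : Ω' × Ω => f z.2 z.1)]
  exact (avg_equiv (Equiv.prodComm Ω' Ω) (fun z : Ω × Ω' => f z.1 z.2)).symm

lemma avg_fst [Nonempty Ω'] (f : Ω → ℝ) : avg (fun z : Ω × Ω' => f z.1) = avg f := by
  rw [avg_prod]; simp only [avg_const]

lemma avg_snd [Nonempty Ω] (f : Ω' → ℝ) : avg (fun z : Ω × Ω' => f z.2) = avg f := by
  rw [avg_prod]; simp only [avg_const]

/-- Independence of the coordinates of a product space. Together with `avg_prod` it is the source of
all uses of independent seeds. -/
lemma avg_pi_prod {ι : Type*} [Fintype ι] (φ : ι → Ω → ℝ) :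
    avg (fun ω : ι → Ω => ∏ i, φ i (ω i)) = ∏ i, avg (φ i) := by
  classical
  have := Fintype.ofFinite Ω
  simp only [avg_eq, Finset.prod_div_distrib]
  rw [Finset.prod_univ_sum, Fintype.piFinset_univ]
  simp

lemma avg_pi_eval {ι : Type*} [Fintype ι] [Nonempty Ω] (i : ι) (φ : Ω → ℝ) :
    avg (fun ω : ι → Ω => φ (ω i)) = avg φ := by
  classical
  have h := avg_pi_prod (fun j : ι => if j = i then φ else fun _ => 1)
  rw [Finset.prod_eq_single i] at h
  · simp only [if_true] at h
    rw [← h]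
    apply avg_congr
    intro ω
    rw [Finset.prod_eq_single i]
    · simp
    · intro j _ hj; simp [hj]
    · simp
  · intro j _ hj; simp [hj, avg_const]
  · simp

lemma avg_pi_mul {ι : Type*} [Fintype ι] [Nonempty Ω] {i j : ι} (hij : i ≠ j) (φ ψ : Ω → ℝ) :
    avg (fun ω : ι → Ω => φ (ω i) * ψ (ω j)) = avg φ * avg ψ := by
  classical
  have h := avg_pi_prod (fun l : ι => if l = i then φ else if l = j then ψ else fun _ => 1)
  have key : ∀ g : ι → ℝ, (∀ l, l ≠ i → l ≠ j → g l = 1) → ∏ l, g l = g i * g j := by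
    intro g hg
    rw [← Finset.prod_pair hij]
    symm
    apply Finset.prod_subset (Finset.subset_univ _)
    intro l _ hl
    simp only [Finset.mem_insert, Finset.mem_singleton, not_or] at hl
    exact hg l hl.1 hl.2
  rw [key] at h
  · simp only [if_true, if_neg hij.symm] at h
    rw [← h]
    apply avg_congr
    intro ω
    rw [key]
    · simp [hij.symm]
    · intro l h1 h2; simp [h1, h2]
  · intro l h1 h2; simp [h1, h2, avg_const]

/-- The second moments of the mean of independent identically distributed variables. -/
lemma avg_mean_mul_mean {T : ℕ} (hT : 0 < T) [Nonempty Ω] (X X' : Ω → ℝ) :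
    avg (fun ω : Fin T → Ω => ((∑ t, X (ω t)) / T) * ((∑ t, X' (ω t)) / T)) =
      avg X * avg X' + (avg (fun x => X x * X' x) - avg X * avg X') / T := by
  have hT' : (T : ℝ) ≠ 0 := by positivity
  have h1 : ∀ ω : Fin T → Ω, ((∑ t, X (ω t)) / T) * ((∑ t, X' (ω t)) / T) =
      (∑ t, ∑ t', X (ω t) * X' (ω t')) / T ^ 2 := by
    intro ω
    rw [div_mul_div_comm, Finset.sum_mul_sum, sq]
  rw [avg_congr h1, avg_div_const, avg_sum]
  simp only [avg_sum]
  -- Distinct coordinates are independent, so only the `T` diagonal pairs among `T ^ 2` carry the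
  -- covariance.
  have h2 : ∀ t t' : Fin T, avg (fun ω : Fin T → Ω => X (ω t) * X' (ω t')) =
      avg X * avg X' + if t = t' then avg (fun x => X x * X' x) - avg X * avg X' else 0 := by
    intro t t'
    by_cases h : t = t'
    · subst h
      rw [avg_pi_eval t (fun x => X x * X' x)]; simp
    · rw [avg_pi_mul h]; simp [h]
  simp only [h2, Finset.sum_add_distrib]
  simp
  field_simp

lemma avg_mean {T : ℕ} (hT : 0 < T) [Nonempty Ω] (X : Ω → ℝ) :
    avg (fun ω : Fin T → Ω => (∑ t, X (ω t)) / T) = avg X := by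
  have hT' : (T : ℝ) ≠ 0 := by positivity
  rw [avg_div_const, avg_sum]
  simp only [avg_pi_eval]
  simp
  field_simp

/-- Markov's inequality; with `g` a square it serves as Chebyshev's. -/
lemma avg_ind_le_div {P : Ω → Prop} {g : Ω → ℝ} {a : ℝ} (ha : 0 < a) (hg : ∀ x, 0 ≤ g x)
    (h : ∀ x, P x → a ≤ g x) : avg (fun x => ind (P x)) ≤ avg g / a := by
  rw [← avg_div_const]
  apply avg_mono
  intro x
  by_cases hx : P x
  · rw [ind_true hx, le_div_iff₀ ha]; simpa using h x hx
  · rw [ind_false hx]; exact div_nonneg (hg x) ha.le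

lemma avg_ind_le_one [Nonempty Ω] (P : Ω → Prop) : avg (fun x => ind (P x)) ≤ 1 :=
  avg_le_of_forall_le fun _ => ind_le_one _

lemma card_div_card_eq_avg (P : Ω → Prop) :
    (Nat.card {x // P x} : ℝ) / Nat.card Ω = avg fun x => ind (P x) := by
  classical
  have := Fintype.ofFinite Ω
  rw [avg_eq, Nat.card_eq_fintype_card, Nat.card_eq_fintype_card, Fintype.card_subtype]
  simp [ind]

/-- The probability that at least `d + 1` among `2 * d + 1` independent events occur. -/
lemma avg_ind_majority_le [Nonempty Ω] (d : ℕ) (B : Ω → Prop) {β : ℝ}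
    (hβ : avg (fun x => ind (B x)) ≤ β) :
    avg (fun ω : Fin (2 * d + 1) → Ω =>
      ind (∃ S : Finset (Fin (2 * d + 1)), S.card = d + 1 ∧ ∀ r ∈ S, B (ω r))) ≤
      (4 * β) ^ (d + 1) := by
  classical
  set 𝒮 := (Finset.univ : Finset (Fin (2 * d + 1))).powersetCard (d + 1) with h𝒮
  have hβ0 : 0 ≤ β := le_trans (avg_nonneg fun _ => ind_nonneg _) hβ
  -- Union bound over the sets of `d + 1` trials that are all bad.
  have h1 : ∀ ω : Fin (2 * d + 1) → Ω,
      ind (∃ S : Finset (Fin (2 * d + 1)), S.card = d + 1 ∧ ∀ r ∈ S, B (ω r)) ≤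
      ∑ S ∈ 𝒮, ∏ r, if r ∈ S then ind (B (ω r)) else 1 := by
    intro ω
    by_cases h : ∃ S : Finset (Fin (2 * d + 1)), S.card = d + 1 ∧ ∀ r ∈ S, B (ω r)
    · rw [ind_true h]
      obtain ⟨S, hS, hB⟩ := h
      refine le_trans ?_ (Finset.single_le_sum (a := S) ?_ ?_)
      · apply le_of_eq
        symm
        apply Finset.prod_eq_one
        intro r _
        by_cases hr : r ∈ S
        · simp [hr, ind_true (hB r hr)]
        · simp [hr]
      · intro S' _
        apply Finset.prod_nonneg
        intro r _
        split_ifs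
        · exact ind_nonneg _
        · exact zero_le_one
      · simp [h𝒮, hS]
    · rw [ind_false h]
      apply Finset.sum_nonneg
      intro S' _
      apply Finset.prod_nonneg
      intro r _
      split_ifs
      · exact ind_nonneg _
      · exact zero_le_one
  refine (avg_mono h1).trans ?_
  rw [avg_sum]
  have h2 : ∀ S ∈ 𝒮, avg (fun ω : Fin (2 * d + 1) → Ω =>
      ∏ r, if r ∈ S then ind (B (ω r)) else 1) ≤ β ^ (d + 1) := by
    intro S hS
    have hS' : S.card = d + 1 := by simpa [h𝒮] using hS
    rw [avg_pi_prod (fun (r : Fin (2 * d + 1)) (x : Ω) => if r ∈ S then ind (B x) else 1)]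
    calc ∏ r, avg (fun x : Ω => if r ∈ S then ind (B x) else 1)
        ≤ ∏ r, (if r ∈ S then β else 1) := by
          apply Finset.prod_le_prod
          · intro r _
            apply avg_nonneg
            intro x
            split_ifs
            · exact ind_nonneg _
            · exact zero_le_one
          · intro r _
            split_ifs
            · exact hβ
            · rw [avg_const]
      _ = β ^ (d + 1) := by
          rw [Finset.prod_ite]; simp [hS']
  refine (Finset.sum_le_sum h2).trans ?_
  rw [Finset.sum_const, nsmul_eq_mul, mul_pow]
  gcongr
  rw [h𝒮, Finset.card_powersetCard]
  simp only [Finset.card_univ, Fintype.card_fin]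
  -- At most `2 ^ (2d + 1) ≤ 4 ^ (d + 1)` sets occur in the union bound; this is the factor `4` of
  -- `4 * β`.
  calc ((Nat.choose (2 * d + 1) (d + 1) : ℕ) : ℝ) ≤ ((2 ^ (2 * d + 1) : ℕ) : ℝ) := by
        exact_mod_cast Nat.choose_le_two_pow _ _
    _ ≤ 4 ^ (d + 1) := by
        push_cast
        rw [show (4 : ℝ) = 2 ^ 2 by norm_num, ← pow_mul]
        exact pow_le_pow_right₀ (by norm_num) (by omega)

/-- The average of a function of the first success among `R` independent trials. -/
lemma avg_findSome {α : Type*} [Nonempty Ω] (R : ℕ) (out : Ω → Option α) (ψ : Option α → ℝ)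
    (hψ : ψ none = 0) :
    avg (fun ω : Fin R → Ω => ψ ((List.finRange R).findSome? fun r => out (ω r))) =
      avg (fun x => ψ (out x)) *
        ∑ r ∈ Finset.range R, (1 - avg fun x => ind (out x ≠ none)) ^ r := by
  induction R with
  | zero => simp [hψ, avg_zero]
  | succ R ih =>
    rw [← avg_equiv (Fin.consEquiv fun _ => Ω), avg_prod]
    -- Either the first trial succeeds and decides, or it contributes `ψ none = 0` and the other `R`
    -- trials decide.
    have h1 : ∀ (x : Ω) (ω : Fin R → Ω),
        ψ ((List.finRange (R + 1)).findSome? fun r =>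
          out ((Fin.consEquiv fun _ => Ω) (x, ω) r)) =
        ψ (out x) + (1 - ind (out x ≠ none)) *
          ψ ((List.finRange R).findSome? fun r => out (ω r)) := by
      intro x ω
      rw [List.finRange_succ, List.findSome?_cons, List.findSome?_map]
      rcases h : out x with _ | y
      · simp [Fin.consEquiv, h, hψ, ind_false, Function.comp_def]
      · simp [Fin.consEquiv, h, ind_true]
    simp only [h1, avg_add, avg_const_mul, avg_const, avg_mul_const, avg_sub]
    rw [ih, Finset.sum_range_succ']
    simp only [pow_succ, ← Finset.sum_mul]
    simp
    ring

end Avg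

/-! ### Medians of an odd number of values -/

section Median

/-- In sorted order the median has position `d`. If it lay below `lo`, so would the `d + 1` values
at positions `0, …, d`; if it lay above `hi`, so would the `d + 1` values at positions `d, …, 2d`.
The corresponding indices would all satisfy `P`. -/
lemma median_mem {d : ℕ} (f : Fin (2 * d + 1) → ℝ) (P : Fin (2 * d + 1) → Prop) {lo hi : ℝ}
    (hP : ∀ r, ¬ P r → f r ∈ Set.Icc lo hi)
    (hS : ¬ ∃ S : Finset (Fin (2 * d + 1)), S.card = d + 1 ∧ ∀ r ∈ S, P r) :
    median f ∈ Set.Icc lo hi := by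
  classical
  have hmono : Monotone (f ∘ Tuple.sort f) := Tuple.monotone_sort f
  set e := Tuple.sort f
  set D : Fin (2 * d + 1) := ⟨d, by omega⟩
  have hmed : median f = f (e D) := rfl
  constructor
  · by_contra hlt
    push Not at hlt
    apply hS
    refine ⟨(Finset.Iic D).map e.toEmbedding, by simp [D], ?_⟩
    intro r hr
    simp only [Finset.mem_map, Finset.mem_Iic] at hr
    obtain ⟨j, hj, rfl⟩ := hr
    by_contra hPj
    have h1 := (hP _ hPj).1
    have h2 : f (e j) ≤ f (e D) := hmono hj
    rw [hmed] at hlt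
    simp at h1
    linarith
  · by_contra hlt
    push Not at hlt
    apply hS
    refine ⟨(Finset.Ici D).map e.toEmbedding, by simp [D]; omega, ?_⟩
    intro r hr
    simp only [Finset.mem_map, Finset.mem_Ici] at hr
    obtain ⟨j, hj, rfl⟩ := hr
    by_contra hPj
    have h1 := (hP _ hPj).2
    have h2 : f (e D) ≤ f (e j) := hmono hj
    rw [hmed] at hlt
    simp at h1
    linarith

end Median


/-! ## Limited independence of the hash functions -/

section Hash

variable {κ m : ℕ}

instance : Finite (HashSeed κ m) := inferInstanceAs (Finite (Fin κ → GaloisField 2 m))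

/-- The value of the polynomial with coefficients `h` at a field element. -/
noncomputable def evalHash (h : HashSeed κ m) (x : GaloisField 2 m) : GaloisField 2 m :=
  ∑ j, h j * x ^ (j : ℕ)

lemma hashVal_eq (h : HashSeed κ m) (N : ℕ) :
    hashVal h N = (Finite.equivFin (GaloisField 2 m) (evalHash h (fieldPoint m N))).val := rfl

lemma evalHash_add_smul (h g : HashSeed κ m) (δ x : GaloisField 2 m) :
    evalHash (h + δ • g) x = evalHash h x + δ * evalHash g x := by
  simp only [evalHash, Pi.add_apply, Pi.smul_apply, smul_eq_mul, add_mul, Finset.sum_add_distrib,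
    Finset.mul_sum, mul_assoc]

/-- The witness consists of the coefficients of `∏ y ∈ s, (X - y)`, of degree `|s| < κ`. -/
lemma exists_evalHash_separating (x : GaloisField 2 m) (s : Finset (GaloisField 2 m))
    (hx : x ∉ s) (hs : s.card < κ) :
    ∃ g : HashSeed κ m, evalHash g x ≠ 0 ∧ ∀ y ∈ s, evalHash g y = 0 := by
  classical
  set P : Polynomial (GaloisField 2 m) := ∏ y ∈ s, (Polynomial.X - Polynomial.C y)
  have hdeg : P.natDegree < κ := by
    rw [Polynomial.natDegree_prod_of_monic _ _ fun y _ => Polynomial.monic_X_sub_C y]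
    simpa using hs
  have hev : ∀ z, evalHash (fun j : Fin κ => P.coeff j) z = P.eval z := by
    intro z
    rw [Polynomial.eval_eq_sum_range' hdeg, ← Fin.sum_univ_eq_sum_range
      (fun i => P.coeff i * z ^ i)]
    rfl
  refine ⟨fun j => P.coeff j, ?_, ?_⟩
  · rw [hev, Polynomial.eval_prod, Finset.prod_ne_zero_iff]
    intro y hy
    simp only [Polynomial.eval_sub, Polynomial.eval_X, Polynomial.eval_C]
    rw [sub_ne_zero]
    rintro rfl
    exact hx hy
  · intro y hy
    rw [hev, Polynomial.eval_prod]
    exact Finset.prod_eq_zero hy (by simp)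

/-- Adding `δ` times a polynomial that vanishes on `s` but not at `x` preserves the uniform measure
on seeds and the value of `Φ`. For uniform `δ` the value at `x` becomes uniform whatever the seed
is, so averaging over `δ` as well splits the expectation. -/
lemma avg_evalHash_mul (x : GaloisField 2 m) (s : Finset (GaloisField 2 m)) (hx : x ∉ s)
    (hs : s.card < κ) (φ : GaloisField 2 m → ℝ) (Φ : HashSeed κ m → ℝ)
    (hΦ : ∀ h h', (∀ y ∈ s, evalHash h y = evalHash h' y) → Φ h = Φ h') :
    avg (fun h : HashSeed κ m => φ (evalHash h x) * Φ h) = avg φ * avg Φ := by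
  obtain ⟨g, hgx, hgs⟩ := exists_evalHash_separating x s hx hs
  have h1 : ∀ δ : GaloisField 2 m,
      avg (fun h : HashSeed κ m => φ (evalHash h x + δ * evalHash g x) * Φ h) =
      avg (fun h : HashSeed κ m => φ (evalHash h x) * Φ h) := by
    intro δ
    rw [← avg_equiv (Equiv.addRight (δ • g)) (fun h => φ (evalHash h x) * Φ h)]
    apply avg_congr
    intro h
    simp only [Equiv.coe_addRight, evalHash_add_smul]
    congr 1
    apply hΦ
    intro y hy
    rw [evalHash_add_smul, hgs y hy]; simp
  have h2 : avg (fun h : HashSeed κ m => φ (evalHash h x) * Φ h) =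
      avg fun δ : GaloisField 2 m =>
        avg (fun h : HashSeed κ m => φ (evalHash h x + δ * evalHash g x) * Φ h) := by
    simp only [h1, avg_const]
  rw [h2, avg_comm]
  have h3 : ∀ h : HashSeed κ m,
      avg (fun δ : GaloisField 2 m => φ (evalHash h x + δ * evalHash g x) * Φ h) =
      avg φ * Φ h := by
    intro h
    rw [avg_mul_const]
    congr 1
    exact avg_equiv ((Equiv.mulRight₀ _ hgx).trans (Equiv.addLeft (evalHash h x))) φ
  simp only [h3, avg_const_mul]

lemma natCard_field (hm : m ≠ 0) : Nat.card (GaloisField 2 m) = 2 ^ m := GaloisField.card 2 m hm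

lemma hashVal_lt (hm : m ≠ 0) (h : HashSeed κ m) (N : ℕ) : hashVal h N < 2 ^ m := by
  rw [hashVal_eq, ← natCard_field hm]
  exact Fin.is_lt _

lemma fieldPoint_inj (hm : m ≠ 0) {N N' : ℕ} (hN : N < 2 ^ m) (hN' : N' < 2 ^ m)
    (h : fieldPoint m N = fieldPoint m N') : N = N' := by
  unfold fieldPoint at h
  have h' := (Finite.equivFin (GaloisField 2 m)).symm.injective h
  simp only [Fin.mk.injEq, natCard_field hm] at h'
  rwa [Nat.mod_eq_of_lt hN, Nat.mod_eq_of_lt hN'] at h'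

/-- The average over `{0, …, 2 ^ m - 1}`. -/
noncomputable def valAvg (m : ℕ) (φ : ℕ → ℝ) : ℝ := (∑ v ∈ Finset.range (2 ^ m), φ v) / 2 ^ m

lemma avg_equivFin (hm : m ≠ 0) (φ : ℕ → ℝ) :
    avg (fun y : GaloisField 2 m => φ (Finite.equivFin (GaloisField 2 m) y).val) = valAvg m φ := by
  rw [avg_equiv (Finite.equivFin (GaloisField 2 m)) (fun v => φ v.val), avg_eq,
    Fin.sum_univ_eq_sum_range, Fintype.card_fin, natCard_field hm]
  simp [valAvg]

lemma avg_hashVal_mul (hm : m ≠ 0) {N : ℕ} (hN : N < 2 ^ m) (s : Finset ℕ)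
    (hsm : ∀ N' ∈ s, N' < 2 ^ m) (hNs : N ∉ s) (hs : s.card < κ) (φ : ℕ → ℝ)
    (Φ : HashSeed κ m → ℝ)
    (hΦ : ∀ h h', (∀ N' ∈ s, hashVal h N' = hashVal h' N') → Φ h = Φ h') :
    avg (fun h : HashSeed κ m => φ (hashVal h N) * Φ h) = valAvg m φ * avg Φ := by
  classical
  rw [← avg_equivFin hm φ]
  refine avg_evalHash_mul (fieldPoint m N) (s.image (fieldPoint m)) ?_ ?_
    (fun y => φ (Finite.equivFin (GaloisField 2 m) y).val) Φ ?_
  · intro hmem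
    obtain ⟨N', hN', he⟩ := Finset.mem_image.1 hmem
    exact hNs (fieldPoint_inj hm (hsm N' hN') hN he ▸ hN')
  · exact Finset.card_image_le.trans_lt hs
  · intro h h' hh
    apply hΦ
    intro N' hN'
    rw [hashVal_eq, hashVal_eq, hh _ (Finset.mem_image_of_mem _ hN')]

lemma avg_hashVal (hm : m ≠ 0) (hκ : 0 < κ) {N : ℕ} (hN : N < 2 ^ m) (φ : ℕ → ℝ) :
    avg (fun h : HashSeed κ m => φ (hashVal h N)) = valAvg m φ := by
  have := avg_hashVal_mul (κ := κ) hm hN ∅ (by simp) (by simp) (by simpa using hκ) φ (fun _ => 1)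
    (fun _ _ _ => rfl)
  simpa [avg_const] using this

lemma avg_hashVal_mul_hashVal (hm : m ≠ 0) (hκ : 2 ≤ κ) {N N' : ℕ} (hN : N < 2 ^ m)
    (hN' : N' < 2 ^ m) (hne : N ≠ N') (φ ψ : ℕ → ℝ) :
    avg (fun h : HashSeed κ m => φ (hashVal h N) * ψ (hashVal h N')) =
      valAvg m φ * valAvg m ψ := by
  rw [← avg_hashVal hm (by omega : 0 < κ) hN' ψ]
  refine avg_hashVal_mul hm hN {N'} (by simpa using hN') (by simpa using hne) (by simp; omega)
    φ _ ?_
  intro h h' hh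
  rw [hh N' (by simp)]

/-! ### Signs -/

lemma hashSign_eq_or (h : HashSeed κ m) (N : ℕ) : hashSign h N = 1 ∨ hashSign h N = -1 := by
  unfold hashSign; split_ifs <;> simp

lemma hashSign_mul_self (h : HashSeed κ m) (N : ℕ) : hashSign h N * hashSign h N = 1 := by
  rcases hashSign_eq_or h N with e | e <;> rw [e] <;> norm_num

lemma abs_hashSign (h : HashSeed κ m) (N : ℕ) : |hashSign h N| = 1 := by
  rcases hashSign_eq_or h N with e | e <;> rw [e] <;> norm_num

/-- The real value of a random sign. -/
noncomputable def rsign (h : HashSeed κ m) (N : ℕ) : ℝ := (hashSign h N : ℤ)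

lemma rsign_mul_self (h : HashSeed κ m) (N : ℕ) : rsign h N * rsign h N = 1 := by
  unfold rsign; exact_mod_cast hashSign_mul_self h N

/-- Since `m ≠ 0`, the number `2 ^ m` is even, and the even and odd values balance. -/
lemma valAvg_sign (hm : m ≠ 0) : valAvg m (fun v => if v % 2 = 0 then 1 else -1) = 0 := by
  have key : ∀ k : ℕ, ∑ v ∈ Finset.range (2 * k), (if v % 2 = 0 then (1 : ℝ) else -1) = 0 := by
    intro k
    induction k with
    | zero => simp
    | succ k ih =>
      rw [show 2 * (k + 1) = 2 * k + 1 + 1 by ring, Finset.sum_range_succ, Finset.sum_range_succ,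
        ih]
      simp [Nat.add_mod]
  obtain ⟨l, rfl⟩ := Nat.exists_eq_succ_of_ne_zero hm
  unfold valAvg
  rw [pow_succ, mul_comm, key]
  simp

lemma rsign_eq (h : HashSeed κ m) (N : ℕ) :
    rsign h N = (fun v : ℕ => if v % 2 = 0 then (1 : ℝ) else -1) (hashVal h N) := by
  unfold rsign hashSign
  push_cast
  rfl

lemma avg_rsign_mul (hm : m ≠ 0) {N : ℕ} (hN : N < 2 ^ m) (s : Finset ℕ)
    (hsm : ∀ N' ∈ s, N' < 2 ^ m) (hNs : N ∉ s) (hs : s.card < κ) (Φ : HashSeed κ m → ℝ)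
    (hΦ : ∀ h h', (∀ N' ∈ s, hashVal h N' = hashVal h' N') → Φ h = Φ h') :
    avg (fun h : HashSeed κ m => rsign h N * Φ h) = 0 := by
  have := avg_hashVal_mul hm hN s hsm hNs hs (fun v => if v % 2 = 0 then 1 else -1) Φ hΦ
  rw [valAvg_sign hm, zero_mul] at this
  rw [← this]
  exact avg_congr fun h => by rw [rsign_eq]

lemma avg_rsign_mul_rsign (hm : m ≠ 0) (hκ : 2 ≤ κ) {N N' : ℕ} (hN : N < 2 ^ m)
    (hN' : N' < 2 ^ m) (hne : N ≠ N') :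
    avg (fun h : HashSeed κ m => rsign h N * rsign h N') = 0 := by
  refine avg_rsign_mul hm hN {N'} (by simpa using hN') (by simpa using hne) (by simp; omega)
    _ ?_
  intro h h' hh
  rw [rsign_eq, rsign_eq, hh N' (by simp)]

section Moments

variable {ι : Type*}

lemma avg_sum_rsign_sq (code : ι → ℕ) (hcode : Function.Injective code) (X : ι → ℝ)
    (hm : m ≠ 0) (hκ : 2 ≤ κ) (s : Finset ι) (hlt : ∀ p ∈ s, code p < 2 ^ m) :
    avg (fun h : HashSeed κ m => (∑ p ∈ s, rsign h (code p) * X p) ^ 2) = ∑ p ∈ s, X p ^ 2 := by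
  classical
  have h1 : ∀ h : HashSeed κ m, (∑ p ∈ s, rsign h (code p) * X p) ^ 2 =
      ∑ p ∈ s, ∑ p' ∈ s, (rsign h (code p) * rsign h (code p')) * (X p * X p') := by
    intro h
    rw [sq, Finset.sum_mul_sum]
    refine Finset.sum_congr rfl fun p _ => Finset.sum_congr rfl fun p' _ => by ring
  rw [avg_congr h1, avg_sum]
  refine Finset.sum_congr rfl fun p hp => ?_
  rw [avg_sum, Finset.sum_eq_single p]
  · simp only [rsign_mul_self, avg_const, one_mul, sq]
  · intro p' hp' hne
    rw [avg_mul_const, avg_rsign_mul_rsign hm hκ (hlt p hp) (hlt p' hp')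
      (fun e => hne (hcode e).symm), zero_mul]
  · intro h; exact absurd hp h

lemma avg_rsign_mul_sum (code : ι → ℕ) (hcode : Function.Injective code) (X : ι → ℝ)
    (hm : m ≠ 0) (hκ : 2 ≤ κ) (s : Finset ι) (hlt : ∀ p ∈ s, code p < 2 ^ m)
    {q : ι} (hq : q ∉ s) (hqlt : code q < 2 ^ m) :
    avg (fun h : HashSeed κ m => rsign h (code q) * ∑ p ∈ s, rsign h (code p) * X p) = 0 := by
  simp only [Finset.mul_sum, ← mul_assoc]
  rw [avg_sum]
  refine Finset.sum_eq_zero fun p hp => ?_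
  rw [avg_mul_const, avg_rsign_mul_rsign hm hκ hqlt (hlt p hp), zero_mul]
  intro e
  exact hq (hcode e ▸ hp)

/-- The sign of `q` is independent of any product of three other signs, whether or not these
coincide. This is where four-wise independence is needed. -/
lemma avg_rsign_mul_sum_cube (code : ι → ℕ) (hcode : Function.Injective code) (X : ι → ℝ)
    (hm : m ≠ 0) (hκ : 4 ≤ κ) (s : Finset ι)
    (hlt : ∀ p ∈ s, code p < 2 ^ m) {q : ι} (hq : q ∉ s) (hqlt : code q < 2 ^ m) :
    avg (fun h : HashSeed κ m => rsign h (code q) * (∑ p ∈ s, rsign h (code p) * X p) ^ 3) = 0 := by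
  classical
  have h1 : ∀ h : HashSeed κ m, rsign h (code q) * (∑ p ∈ s, rsign h (code p) * X p) ^ 3 =
      ∑ p ∈ s, ∑ p' ∈ s, ∑ p'' ∈ s,
        (rsign h (code q) * (rsign h (code p) * rsign h (code p') * rsign h (code p''))) *
          (X p * X p' * X p'') := by
    intro h
    rw [show ∀ x : ℝ, x ^ 3 = x * (x * x) by intro x; ring, Finset.sum_mul_sum, Finset.sum_mul,
      Finset.mul_sum]
    refine Finset.sum_congr rfl fun p _ => ?_
    rw [Finset.mul_sum, Finset.mul_sum]
    refine Finset.sum_congr rfl fun p' _ => ?_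
    rw [Finset.mul_sum, Finset.mul_sum]
    refine Finset.sum_congr rfl fun p'' _ => ?_
    ring
  rw [avg_congr h1, avg_sum]
  refine Finset.sum_eq_zero fun p hp => ?_
  rw [avg_sum]
  refine Finset.sum_eq_zero fun p' hp' => ?_
  rw [avg_sum]
  refine Finset.sum_eq_zero fun p'' hp'' => ?_
  have hne : ∀ r ∈ s, code q ≠ code r := fun r hr e => hq (hcode e ▸ hr)
  rw [avg_mul_const, avg_rsign_mul hm hqlt {code p, code p', code p''}, zero_mul]
  · simp [hlt p hp, hlt p' hp', hlt p'' hp'']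
  · simp [hne p hp, hne p' hp', hne p'' hp'']
  · exact Finset.card_le_three.trans_lt (by omega)
  · intro h h' hh
    simp only [rsign_eq]
    rw [hh (code p) (by simp), hh (code p') (by simp), hh (code p'') (by simp)]

/-- Induction on the index set. In the expansion of `(a X_q + S) ^ 4` the odd powers of the new sign
`a` average to zero. What remains is `E S⁴ + 6 X_q² E S² + X_q⁴`, which by induction is at most `3
(E S² + X_q²)²`. -/
lemma avg_sum_rsign_pow_four_le (code : ι → ℕ) (hcode : Function.Injective code) (X : ι → ℝ)
    (hm : m ≠ 0) (hκ : 4 ≤ κ) (s : Finset ι)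
    (hlt : ∀ p ∈ s, code p < 2 ^ m) :
    avg (fun h : HashSeed κ m => (∑ p ∈ s, rsign h (code p) * X p) ^ 4) ≤
      3 * (∑ p ∈ s, X p ^ 2) ^ 2 := by
  classical
  induction s using Finset.induction_on with
  | empty => simp [avg_zero]
  | insert q s hq ih =>
    have hlt' : ∀ p ∈ s, code p < 2 ^ m := fun p hp => hlt p (Finset.mem_insert_of_mem hp)
    have hqlt : code q < 2 ^ m := hlt q (Finset.mem_insert_self _ _)
    have h1 : ∀ h : HashSeed κ m, (∑ p ∈ insert q s, rsign h (code p) * X p) ^ 4 =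
        (∑ p ∈ s, rsign h (code p) * X p) ^ 4 +
        (4 * X q) * (rsign h (code q) * (∑ p ∈ s, rsign h (code p) * X p) ^ 3) +
        (6 * X q ^ 2) * (∑ p ∈ s, rsign h (code p) * X p) ^ 2 +
        (4 * X q ^ 3) * (rsign h (code q) * ∑ p ∈ s, rsign h (code p) * X p) + X q ^ 4 := by
      intro h
      rw [Finset.sum_insert hq]
      have e := rsign_mul_self h (code q)
      generalize rsign h (code q) = a at *
      generalize ∑ p ∈ s, rsign h (code p) * X p = S
      have e2 : a ^ 2 = 1 := by rw [sq, e]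
      have e3 : a ^ 3 = a := by rw [pow_succ, e2, one_mul]
      have e4 : a ^ 4 = 1 := by rw [pow_succ, e3, e]
      linear_combination (X q ^ 4) * e4 + 4 * X q ^ 3 * S * e3 + 6 * X q ^ 2 * S ^ 2 * e2
    rw [avg_congr h1]
    simp only [avg_add, avg_const_mul, avg_const]
    rw [avg_rsign_mul_sum code hcode X hm (by omega) s hlt' hq hqlt,
      avg_rsign_mul_sum_cube code hcode X hm hκ s hlt' hq hqlt,
      avg_sum_rsign_sq code hcode X hm (by omega) s hlt', Finset.sum_insert hq]
    have := ih hlt'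
    have h4 : 0 ≤ X q ^ 4 := by positivity
    nlinarith

end Moments

/-! ### Buckets -/

lemma valAvg_bucket {a : ℕ} (ha : a ≤ m) (v : Fin (2 ^ a)) :
    valAvg m (fun x => ind (x % 2 ^ a = v)) = 1 / 2 ^ a := by
  have hcard : ∑ x ∈ Finset.range (2 ^ m), ind (x % 2 ^ a = v) = 2 ^ (m - a) := by
    have key : ∀ k : ℕ, ∑ x ∈ Finset.range (2 ^ a * k), ind (x % 2 ^ a = v) = k := by
      intro k
      induction k with
      | zero => simp
      | succ k ih =>
        rw [Nat.mul_succ, Finset.sum_range_add, ih, Finset.sum_eq_single v.val]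
        · rw [ind_true]
          · push_cast; ring
          · rw [Nat.mul_add_mod, Nat.mod_eq_of_lt v.isLt]
        · intro x hx hne
          apply ind_false
          rw [Nat.mul_add_mod, Nat.mod_eq_of_lt (Finset.mem_range.1 hx)]
          exact hne
        · intro h
          exact absurd (Finset.mem_range.2 v.isLt) h
    have := key (2 ^ (m - a))
    rw [← pow_add, Nat.add_sub_cancel' ha] at this
    rw [this]; push_cast; rfl
  unfold valAvg
  rw [hcard, div_eq_div_iff (by positivity) (by positivity), one_mul, ← pow_add,
    Nat.sub_add_cancel ha]

lemma avg_bucket_collision (hm : m ≠ 0) (hκ : 2 ≤ κ) {a : ℕ} (ha : a ≤ m) {N N' : ℕ}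
    (hN : N < 2 ^ m) (hN' : N' < 2 ^ m) (hne : N ≠ N') :
    avg (fun h : HashSeed κ m => ind (hashBucket a h N = hashBucket a h N')) = 1 / 2 ^ a := by
  have h1 : ∀ h : HashSeed κ m, ind (hashBucket a h N = hashBucket a h N') =
      ∑ v : Fin (2 ^ a), ind (hashVal h N % 2 ^ a = v) * ind (hashVal h N' % 2 ^ a = v) := by
    intro h
    rw [Finset.sum_eq_single (hashBucket a h N')]
    · rw [ind_true (P := hashVal h N' % 2 ^ a = (hashBucket a h N').val) rfl, mul_one]
      congr 1
      simp [hashBucket, Fin.ext_iff]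
    · intro v _ hv
      rw [ind_false (P := hashVal h N' % 2 ^ a = v), mul_zero]
      intro e
      exact hv (Fin.ext e.symm)
    · simp
  rw [avg_congr h1, avg_sum]
  have h2 : ∀ v : Fin (2 ^ a), avg (fun h : HashSeed κ m =>
      ind (hashVal h N % 2 ^ a = v) * ind (hashVal h N' % 2 ^ a = v)) = 1 / 2 ^ a * (1 / 2 ^ a) := by
    intro v
    rw [avg_hashVal_mul_hashVal hm hκ hN hN' hne (fun x => ind (x % 2 ^ a = v))
      (fun x => ind (x % 2 ^ a = v)), valAvg_bucket ha]
  simp only [h2]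
  simp

/-! ### Uniform numbers -/

lemma hashUnif_pos (h : HashSeed κ m) (N : ℕ) : 0 < hashUnif h N := by
  unfold hashUnif; positivity

lemma hashUnif_le_one (hm : m ≠ 0) (h : HashSeed κ m) (N : ℕ) : hashUnif h N ≤ 1 := by
  unfold hashUnif
  rw [div_le_one (by positivity)]
  exact_mod_cast hashVal_lt hm h N

lemma le_hashUnif (h : HashSeed κ m) (N : ℕ) : 1 / 2 ^ m ≤ hashUnif h N := by
  unfold hashUnif
  gcongr
  simp

/-- The probability that a uniform multiple of `2 ^ (-m)` in `(0, 1]` is at most `x`. -/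
noncomputable def unifCdf (m : ℕ) (x : ℝ) : ℝ := valAvg m fun v => ind (((v : ℝ) + 1) / 2 ^ m ≤ x)

lemma sum_ind_eq_card (x : ℝ) : ∑ v ∈ Finset.range (2 ^ m), ind (((v : ℝ) + 1) / 2 ^ m ≤ x) =
    ((Finset.range (2 ^ m)).filter fun v => v < ⌊x * 2 ^ m⌋₊).card := by
  rw [Finset.card_filter]
  push_cast
  refine Finset.sum_congr rfl fun v _ => ?_
  have : ((v : ℝ) + 1) / 2 ^ m ≤ x ↔ v < ⌊x * 2 ^ m⌋₊ := by
    rw [div_le_iff₀ (by positivity), ← Nat.succ_le_iff, Nat.le_floor_iff' (by omega)]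
    push_cast
    rfl
  by_cases h : v < ⌊x * 2 ^ m⌋₊
  · rw [ind_true (this.2 h), if_pos h]
  · rw [ind_false (fun h' => h (this.1 h')), if_neg h]

lemma unifCdf_le {x : ℝ} (hx : 0 ≤ x) : unifCdf m x ≤ x := by
  unfold unifCdf valAvg
  rw [sum_ind_eq_card, div_le_iff₀ (by positivity)]
  refine le_trans ?_ (Nat.floor_le (by positivity))
  have : ((Finset.range (2 ^ m)).filter fun v => v < ⌊x * 2 ^ m⌋₊).card ≤ ⌊x * 2 ^ m⌋₊ := by
    calc _ ≤ (Finset.range ⌊x * 2 ^ m⌋₊).card := by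
          apply Finset.card_le_card
          intro v; simp
      _ = _ := Finset.card_range _
  exact_mod_cast this

lemma le_unifCdf {x : ℝ} (hx1 : x ≤ 1) : x - 1 / 2 ^ m ≤ unifCdf m x := by
  unfold unifCdf valAvg
  have hpos : (0 : ℝ) < 2 ^ m := by positivity
  rw [sum_ind_eq_card, le_div_iff₀ hpos, sub_mul, one_div_mul_cancel hpos.ne']
  have h1 : ⌊x * 2 ^ m⌋₊ ≤ 2 ^ m := by
    apply Nat.floor_le_of_le
    push_cast
    nlinarith
  have h2 : ((Finset.range (2 ^ m)).filter fun v => v < ⌊x * 2 ^ m⌋₊) =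
      Finset.range ⌊x * 2 ^ m⌋₊ := by
    ext v; simp; omega
  rw [h2, Finset.card_range]
  linarith [Nat.lt_floor_add_one (x * 2 ^ m)]

lemma unifCdf_nonneg (x : ℝ) : 0 ≤ unifCdf m x := by
  unfold unifCdf valAvg
  exact div_nonneg (Finset.sum_nonneg fun _ _ => ind_nonneg _) (by positivity)

lemma avg_ind_hashUnif_le (hm : m ≠ 0) (hκ : 0 < κ) {N : ℕ} (hN : N < 2 ^ m) (x : ℝ) :
    avg (fun h : HashSeed κ m => ind (hashUnif h N ≤ x)) = unifCdf m x :=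
  avg_hashVal hm hκ hN fun v => ind (((v : ℝ) + 1) / 2 ^ m ≤ x)

lemma avg_ind_hashUnif_mul_ind (hm : m ≠ 0) (hκ : 2 ≤ κ) {N N' : ℕ} (hN : N < 2 ^ m)
    (hN' : N' < 2 ^ m) (hne : N ≠ N') (x y : ℝ) :
    avg (fun h : HashSeed κ m => ind (hashUnif h N ≤ x) * ind (hashUnif h N' ≤ y)) =
      unifCdf m x * unifCdf m y :=
  avg_hashVal_mul_hashVal hm hκ hN hN' hne (fun v => ind (((v : ℝ) + 1) / 2 ^ m ≤ x))
    fun v => ind (((v : ℝ) + 1) / 2 ^ m ≤ y)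

/-- The mean of `1 / u` is the harmonic number of `2 ^ m`. Finite precision keeps it logarithmic,
and the factor `Λ` in `w` pays for that logarithm. -/
lemma valAvg_inv_le : valAvg m (fun v => 1 / (((v : ℝ) + 1) / 2 ^ m)) ≤ 1 + m := by
  unfold valAvg
  have h1 : (∑ v ∈ Finset.range (2 ^ m), 1 / (((v : ℝ) + 1) / 2 ^ m)) / 2 ^ m =
      (harmonic (2 ^ m) : ℝ) := by
    rw [Finset.sum_div]
    unfold harmonic
    push_cast
    refine Finset.sum_congr rfl fun v _ => ?_
    have : (0 : ℝ) < 2 ^ m := by positivity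
    field_simp
  rw [h1]
  refine (harmonic_le_one_add_log _).trans ?_
  push_cast
  rw [Real.log_pow]
  have := Real.log_two_lt_d9
  have hm : (0 : ℝ) ≤ m := by positivity
  nlinarith

lemma avg_ind_hashUnif_mul_inv_le (hm : m ≠ 0) (hκ : 2 ≤ κ) {N N' : ℕ} (hN : N < 2 ^ m)
    (hN' : N' < 2 ^ m) (hne : N ≠ N') (x : ℝ) :
    avg (fun h : HashSeed κ m => ind (hashUnif h N ≤ x) * (1 / hashUnif h N')) ≤
      unifCdf m x * (1 + m) := by
  have := avg_hashVal_mul_hashVal hm hκ hN hN' hne (fun v => ind (((v : ℝ) + 1) / 2 ^ m ≤ x))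
    fun v => 1 / (((v : ℝ) + 1) / 2 ^ m)
  calc _ = _ := this
    _ ≤ _ := mul_le_mul_of_nonneg_left valAvg_inv_le (unifCdf_nonneg x)

end Hash


/-! ## Sketches of a fixed matrix -/

section Sketch

variable {n κ m d a b V : ℕ}

/-- The number of a position, as a function on pairs. -/
def pcode (p : Fin n × Fin n) : ℕ := posCode p.1 p.2

lemma pcode_lt (p : Fin n × Fin n) : pcode p < n ^ 2 := by
  unfold pcode posCode
  have h1 := p.1.isLt
  have h2 := p.2.isLt
  nlinarith

lemma pcode_injective : Function.Injective (pcode (n := n)) := by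
  rintro ⟨i, j⟩ ⟨i', j'⟩ h
  simp only [pcode, posCode] at h
  have hj := j.isLt
  have hj' := j'.isLt
  have hn : 0 < n := by omega
  have e1 : j.val = j'.val := by
    have := congrArg (· % n) h
    simpa [Nat.mul_add_mod_of_lt, Nat.mod_eq_of_lt hj, Nat.mod_eq_of_lt hj', Nat.add_mod] using this
  have e2 : i.val = i'.val := by
    rw [e1] at h
    exact Nat.eq_of_mul_eq_mul_right hn (by omega)
  exact Prod.ext (Fin.ext e2) (Fin.ext e1)

/-- The content of one counter of the Count-Sketch of `X`. -/
noncomputable def csCounter (X : Matrix (Fin n) (Fin n) ℤ) (g : HashSeed κ m × HashSeed κ m)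
    (v : Fin (2 ^ a)) : ℤ :=
  ∑ p : Fin n × Fin n, if hashBucket a g.1 (pcode p) = v then hashSign g.2 (pcode p) * X p.1 p.2
    else 0

/-- The Count-Sketch of `X`. -/
noncomputable def csTable (s : CSSeed κ m d) (X : Matrix (Fin n) (Fin n) ℤ) : CSTable d a b :=
  fun r v => (csCounter X (s r) v : Word b)

/-- The content of one counter of the AMS sketch of `X`. -/
noncomputable def amsCounter (X : Matrix (Fin n) (Fin n) ℤ) (g : HashSeed κ m) : ℤ :=
  ∑ p : Fin n × Fin n, hashSign g (pcode p) * X p.1 p.2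

/-- The AMS sketch of `X`. -/
noncomputable def amsTable (s : AMSSeed κ m d V) (X : Matrix (Fin n) (Fin n) ℤ) :
    AMSTable d V b :=
  fun r v => (amsCounter X (s r v) : Word b)

/-- The matrix `X` after adding `x` to the entry `(i, j)`. -/
def addEntry (X : Matrix (Fin n) (Fin n) ℤ) (i j : Fin n) (x : ℤ) : Matrix (Fin n) (Fin n) ℤ :=
  fun i' j' => X i' j' + if i = i' ∧ j = j' then x else 0

lemma csCounter_addEntry (X : Matrix (Fin n) (Fin n) ℤ) (i j : Fin n) (x : ℤ)
    (g : HashSeed κ m × HashSeed κ m) (v : Fin (2 ^ a)) :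
    csCounter (addEntry X i j x) g v = csCounter X g v +
      if hashBucket a g.1 (posCode i j) = v then hashSign g.2 (posCode i j) * x else 0 := by
  have h : (if hashBucket a g.1 (posCode i j) = v then hashSign g.2 (posCode i j) * x else 0) =
      ∑ p : Fin n × Fin n, if hashBucket a g.1 (pcode p) = v then
        hashSign g.2 (pcode p) * (if i = p.1 ∧ j = p.2 then x else 0) else 0 := by
    rw [Finset.sum_eq_single (i, j)]
    · simp [pcode]
    · rintro ⟨i', j'⟩ _ hne
      have : ¬ (i = i' ∧ j = j') := fun h => hne (by rw [h.1, h.2])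
      simp [this]
    · simp
  rw [h]
  unfold csCounter
  rw [← Finset.sum_add_distrib]
  refine Finset.sum_congr rfl fun p _ => ?_
  simp only [addEntry, mul_add]
  split_ifs <;> simp

lemma csAdd_csTable (s : CSSeed κ m d) (X : Matrix (Fin n) (Fin n) ℤ) (i j : Fin n) (x : ℤ) :
    csAdd s i j x (csTable s X : CSTable d a b) = csTable s (addEntry X i j x) := by
  funext r v
  simp only [csAdd, csTable, csCounter_addEntry]
  split_ifs <;> push_cast <;> rfl

lemma amsAdd_amsTable (s : AMSSeed κ m d V) (X : Matrix (Fin n) (Fin n) ℤ) (i j : Fin n)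
    (x : ℤ) :
    amsAdd s i j x (amsTable s X : AMSTable d V b) = amsTable s (addEntry X i j x) := by
  have h : ∀ g : HashSeed κ m, amsCounter (addEntry X i j x) g =
      amsCounter X g + hashSign g (posCode i j) * x := by
    intro g
    have h' : hashSign g (posCode i j) * x =
        ∑ p : Fin n × Fin n, hashSign g (pcode p) * (if i = p.1 ∧ j = p.2 then x else 0) := by
      rw [Finset.sum_eq_single (i, j)]
      · simp [pcode]
      · rintro ⟨i', j'⟩ _ hne
        have : ¬ (i = i' ∧ j = j') := fun h => hne (by rw [h.1, h.2])
        simp [this]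
      · simp
    rw [h']
    unfold amsCounter
    rw [← Finset.sum_add_distrib]
    refine Finset.sum_congr rfl fun p _ => ?_
    simp only [addEntry, mul_add]
  funext r v
  simp only [amsAdd, amsTable, h]
  push_cast
  rfl

lemma csTable_zero (s : CSSeed κ m d) :
    (csTable s (0 : Matrix (Fin n) (Fin n) ℤ) : CSTable d a b) = 0 := by
  funext r v
  simp [csTable, csCounter]

lemma amsTable_zero (s : AMSSeed κ m d V) :
    (amsTable s (0 : Matrix (Fin n) (Fin n) ℤ) : AMSTable d V b) = 0 := by
  funext r v
  simp [amsTable, amsCounter]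

/-- The integer matrix `2 ^ m • B` of a precision sampler. -/
noncomputable def scaled {z : Sizes} (s : PSeed z) (A : Matrix (Fin n) (Fin n) ℤ) :
    Matrix (Fin n) (Fin n) ℤ :=
  fun i j => pScale s i * A i j

lemma scaled_addEntry {z : Sizes} (s : PSeed z) (A : Matrix (Fin n) (Fin n) ℤ) (i j : Fin n)
    (x : ℤ) : scaled s (addEntry A i j x) = addEntry (scaled s A) i j (pScale s i * x) := by
  funext i' j'
  simp only [scaled, addEntry, mul_add]
  congr 1
  split_ifs with h
  · rw [h.1]
  · simp

lemma streamMatrix_append_singleton (σ : List (Update n)) (u : Update n) :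
    streamMatrix (σ ++ [u]) = addEntry (streamMatrix σ) u.1 u.2.1 u.2.2 := by
  funext i j
  simp [streamMatrix, addEntry]

/-- The memory of a precision sampler after a stream with final matrix `A`. -/
noncomputable def pTable {z : Sizes} (s : PSeed z) (A : Matrix (Fin n) (Fin n) ℤ) : PMem z :=
  (csTable s.2.1 (scaled s A), amsTable s.2.2 (scaled s A))

/-- The memory of the algorithm after a stream with final matrix `A`. -/
noncomputable def algTable {q : ℕ} {z : Sizes} (s : AlgSeed q z) (A : Matrix (Fin n) (Fin n) ℤ) :
    AlgMem q z :=
  (fun f => csTable (s.1 f) A, amsTable s.2.1 A, fun f t r => pTable (s.2.2 f t r) A)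

/-- All sketches are linear in the sketched matrix, and so is the scaling of rows by `D`. Hence the
memory is a function of the seed and the final matrix alone; the order of the updates disappears
from the analysis. -/
lemma foldl_algUpdate {q : ℕ} {z : Sizes} (s : AlgSeed q z) (σ : List (Update n)) :
    σ.foldl (fun M u => algUpdate s u M) 0 = algTable s (streamMatrix σ) := by
  induction σ using List.reverseRecOn with
  | nil =>
    have h0 : streamMatrix ([] : List (Update n)) = 0 := by
      funext i j; simp [streamMatrix]
    have hs : ∀ s : PSeed z, scaled s (0 : Matrix (Fin n) (Fin n) ℤ) = 0 := by
      intro s; funext i j; simp [scaled]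
    rw [h0]
    simp only [List.foldl_nil, algTable, pTable, hs, csTable_zero, amsTable_zero]
    rfl
  | append_singleton σ u ih =>
    rw [List.foldl_append, ih, streamMatrix_append_singleton]
    simp only [List.foldl_cons, List.foldl_nil, algUpdate, algTable, pTable, pUpdate,
      csAdd_csTable, amsAdd_amsTable, scaled_addEntry]

/-! ### No overflow -/

/-- Residues modulo `2 ^ b` determine integers in the symmetric range. Only final counters have to
lie in it; an overflow during the stream is harmless. -/
lemma valMinAbs_intCast_of_abs_lt {x : ℤ} (h : 2 * |x| < 2 ^ b) :
    ((x : Word b)).valMinAbs = x := by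
  rw [ZMod.valMinAbs_spec]
  refine ⟨rfl, ?_, ?_⟩
  · push_cast
    have := neg_abs_le x
    linarith
  · push_cast
    have := le_abs_self x
    linarith

lemma abs_csCounter_le (X : Matrix (Fin n) (Fin n) ℤ) (g : HashSeed κ m × HashSeed κ m)
    (v : Fin (2 ^ a)) : |csCounter X g v| ≤ ∑ p : Fin n × Fin n, |X p.1 p.2| := by
  unfold csCounter
  refine (Finset.abs_sum_le_sum_abs _ _).trans (Finset.sum_le_sum fun p _ => ?_)
  split_ifs
  · rw [abs_mul, abs_hashSign, one_mul]
  · simp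

lemma abs_amsCounter_le (X : Matrix (Fin n) (Fin n) ℤ) (g : HashSeed κ m) :
    |amsCounter X g| ≤ ∑ p : Fin n × Fin n, |X p.1 p.2| := by
  unfold amsCounter
  refine (Finset.abs_sum_le_sum_abs _ _).trans (Finset.sum_le_sum fun p _ => ?_)
  rw [abs_mul, abs_hashSign, one_mul]

/-- The squared Frobenius norm of an integer matrix. -/
noncomputable def frobSq (X : Matrix (Fin n) (Fin n) ℤ) : ℝ :=
  ∑ p : Fin n × Fin n, (X p.1 p.2 : ℝ) ^ 2

/-! ### The error of Count-Sketch -/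

/-- The error of one row of a Count-Sketch at the position `p₀`. -/
noncomputable def csErr (X : Matrix (Fin n) (Fin n) ℤ) (a : ℕ)
    (g : HashSeed κ m × HashSeed κ m) (p₀ : Fin n × Fin n) : ℝ :=
  ∑ p ∈ Finset.univ.erase p₀, rsign g.2 (pcode p) *
    (ind (hashBucket a g.1 (pcode p) = hashBucket a g.1 (pcode p₀)) * X p.1 p.2)

lemma sign_mul_csCounter (X : Matrix (Fin n) (Fin n) ℤ) (g : HashSeed κ m × HashSeed κ m)
    (p₀ : Fin n × Fin n) :
    ((hashSign g.2 (pcode p₀) * csCounter X g (hashBucket a g.1 (pcode p₀)) : ℤ) : ℝ) =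
      X p₀.1 p₀.2 + rsign g.2 (pcode p₀) * csErr X a g p₀ := by
  unfold csCounter csErr
  rw [← Finset.add_sum_erase _ _ (Finset.mem_univ p₀), if_pos rfl]
  push_cast
  rw [mul_add, ← mul_assoc]
  congr 1
  · have := rsign_mul_self g.2 (pcode p₀)
    unfold rsign at this
    rw [this, one_mul]
  · congr 1
    refine Finset.sum_congr rfl fun p _ => ?_
    rw [← mul_assoc, mul_comm (rsign _ _), mul_assoc, ← ite_eq_ind_mul]
    rfl

/-- For fixed buckets the average over the signs removes the cross terms. It leaves the mass that
shares the bucket of `p₀`, and by pairwise independence each position does so with probability `2 ^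
(-a)`. -/
lemma avg_csErr_sq_le (X : Matrix (Fin n) (Fin n) ℤ) (hm : m ≠ 0) (hκ : 2 ≤ κ) (ha : a ≤ m)
    (hn : n ^ 2 ≤ 2 ^ m) (p₀ : Fin n × Fin n) :
    avg (fun g : HashSeed κ m × HashSeed κ m => csErr X a g p₀ ^ 2) ≤ frobSq X / 2 ^ a := by
  have hlt : ∀ p : Fin n × Fin n, pcode p < 2 ^ m := fun p => (pcode_lt p).trans_le hn
  rw [avg_prod]
  have h1 : ∀ h : HashSeed κ m, avg (fun g : HashSeed κ m => csErr X a (h, g) p₀ ^ 2) =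
      ∑ p ∈ Finset.univ.erase p₀,
        ind (hashBucket a h (pcode p) = hashBucket a h (pcode p₀)) * (X p.1 p.2 : ℝ) ^ 2 := by
    intro h
    unfold csErr
    simp only
    rw [avg_sum_rsign_sq pcode pcode_injective _ hm hκ _ fun p _ => hlt p]
    refine Finset.sum_congr rfl fun p _ => ?_
    rw [mul_pow, sq (ind _), ind_mul_self]
  simp only [h1]
  rw [avg_sum]
  unfold frobSq
  rw [Finset.sum_div]
  refine (Finset.sum_le_sum (g := fun p => (X p.1 p.2 : ℝ) ^ 2 / 2 ^ a) ?_).trans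
    (Finset.sum_le_sum_of_subset_of_nonneg (Finset.erase_subset _ _) fun p _ _ => by positivity)
  intro p hp
  rw [avg_mul_const, avg_bucket_collision hm hκ ha (hlt p) (hlt p₀)
    (fun e => (Finset.mem_erase.1 hp).1 (pcode_injective e))]
  rw [one_div_mul_eq_div]

lemma csEst_csTable (X : Matrix (Fin n) (Fin n) ℤ)
    (hb : 2 * ∑ p : Fin n × Fin n, |X p.1 p.2| < 2 ^ b) (s : CSSeed κ m d) (i j : Fin n) :
    csEst s (csTable s X : CSTable d a b) i j =
      median fun r => X i j + rsign (s r).2 (pcode (i, j)) * csErr X a (s r) (i, j) := by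
  unfold csEst
  congr 1
  funext r
  rw [← sign_mul_csCounter X (s r) (i, j)]
  unfold csTable
  rw [valMinAbs_intCast_of_abs_lt]
  · rfl
  · have := abs_csCounter_le X (s r) (hashBucket a (s r).1 (posCode i j))
    linarith

/-- All entries of `X` are estimated with squared error at most `τ`, with high probability. -/
lemma avg_ind_csEst_error_le (X : Matrix (Fin n) (Fin n) ℤ) (hm : m ≠ 0) (hκ : 2 ≤ κ)
    (ha : a ≤ m) (hn : n ^ 2 ≤ 2 ^ m)
    (hb : 2 * ∑ p : Fin n × Fin n, |X p.1 p.2| < 2 ^ b) {τ : ℝ} (hτ : 0 < τ) :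
    avg (fun s : CSSeed κ m d => ind (¬ ∀ i j,
      |csEst s (csTable s X : CSTable d a b) i j - X i j| ≤ √τ)) ≤
      (n : ℝ) ^ 2 * (4 * (frobSq X / 2 ^ a / τ)) ^ (d + 1) := by
  have h1 : ∀ s : CSSeed κ m d, ind (¬ ∀ i j,
      |csEst s (csTable s X : CSTable d a b) i j - X i j| ≤ √τ) ≤
      ∑ p : Fin n × Fin n, ind (∃ S : Finset (Fin (2 * d + 1)), S.card = d + 1 ∧
        ∀ r ∈ S, τ < csErr X a (s r) p ^ 2) := by
    intro s
    refine le_trans (ind_mono ?_) (ind_exists_le _)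
    intro h
    push Not at h
    obtain ⟨i, j, hij⟩ := h
    refine ⟨(i, j), ?_⟩
    by_contra hS
    apply absurd hij
    rw [not_lt, csEst_csTable X hb, abs_le]
    have := median_mem (fun r => (X i j : ℝ) + rsign (s r).2 (pcode (i, j)) *
      csErr X a (s r) (i, j)) (fun r => τ < csErr X a (s r) (i, j) ^ 2)
      (lo := X i j - √τ) (hi := X i j + √τ) ?_ hS
    · constructor <;> linarith [this.1, this.2]
    · intro r hr
      have h3 : |rsign (s r).2 (pcode (i, j)) * csErr X a (s r) (i, j)| ≤ √τ := by
        apply Real.abs_le_sqrt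
        rw [mul_pow, sq (rsign _ _), rsign_mul_self, one_mul]
        exact not_lt.1 hr
      have := abs_le.1 h3
      constructor <;> linarith [this.1, this.2]
  refine (avg_mono h1).trans ?_
  rw [avg_sum]
  refine (Finset.sum_le_sum (g := fun _ => (4 * (frobSq X / 2 ^ a / τ)) ^ (d + 1))
    fun p _ => ?_).trans ?_
  · apply avg_ind_majority_le d fun g : HashSeed κ m × HashSeed κ m => τ < csErr X a g p ^ 2
    refine (avg_ind_le_div hτ (fun g => sq_nonneg _) fun g hg => hg.le).trans ?_
    gcongr
    exact avg_csErr_sq_le X hm hκ ha hn p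
  · simp [sq]

/-! ### The error of the AMS sketch -/

/-- By the fourth moment bound one squared counter has variance at most `3 F² - F² = 2 F²`, where `F
= frobSq X`; the mean of `V` independent ones divides this by `V`. -/
lemma avg_ams_mean_error_sq_le (X : Matrix (Fin n) (Fin n) ℤ) (hm : m ≠ 0) (hκ : 4 ≤ κ)
    (hn : n ^ 2 ≤ 2 ^ m) (hV : 0 < V) :
    avg (fun g : Fin V → HashSeed κ m =>
      ((∑ v, (amsCounter X (g v) : ℝ) ^ 2) / V - frobSq X) ^ 2) ≤ 2 * frobSq X ^ 2 / V := by
  have hlt : ∀ p : Fin n × Fin n, pcode p < 2 ^ m := fun p => (pcode_lt p).trans_le hn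
  have hc : ∀ g : HashSeed κ m, (amsCounter X g : ℝ) =
      ∑ p : Fin n × Fin n, rsign g (pcode p) * (X p.1 p.2 : ℝ) := by
    intro g; unfold amsCounter rsign; push_cast; rfl
  have h2 : avg (fun g : HashSeed κ m => (amsCounter X g : ℝ) ^ 2) = frobSq X := by
    simp only [hc]
    rw [avg_sum_rsign_sq pcode pcode_injective _ hm (by omega) _ fun p _ => hlt p]
    rfl
  have h4 : avg (fun g : HashSeed κ m => (amsCounter X g : ℝ) ^ 2 * (amsCounter X g : ℝ) ^ 2) ≤
      3 * frobSq X ^ 2 := by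
    have := avg_sum_rsign_pow_four_le pcode pcode_injective
      (fun p : Fin n × Fin n => (X p.1 p.2 : ℝ)) hm hκ Finset.univ fun p _ => hlt p
    simp only [hc]
    refine le_trans (le_of_eq (avg_congr fun g => ?_)) this
    ring
  have h5 : ∀ g : Fin V → HashSeed κ m,
      ((∑ v, (amsCounter X (g v) : ℝ) ^ 2) / V - frobSq X) ^ 2 =
      ((∑ v, (amsCounter X (g v) : ℝ) ^ 2) / V) * ((∑ v, (amsCounter X (g v) : ℝ) ^ 2) / V) -
      (2 * frobSq X) * ((∑ v, (amsCounter X (g v) : ℝ) ^ 2) / V) + frobSq X ^ 2 := by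
    intro g; ring
  rw [avg_congr h5]
  simp only [avg_add, avg_sub, avg_const_mul, avg_const]
  rw [avg_mean_mul_mean hV (fun g : HashSeed κ m => (amsCounter X g : ℝ) ^ 2)
    (fun g : HashSeed κ m => (amsCounter X g : ℝ) ^ 2),
    avg_mean hV (fun g : HashSeed κ m => (amsCounter X g : ℝ) ^ 2), h2]
  have : (avg (fun g : HashSeed κ m => (amsCounter X g : ℝ) ^ 2 * (amsCounter X g : ℝ) ^ 2) -
      frobSq X * frobSq X) / V ≤ 2 * frobSq X ^ 2 / V := by
    gcongr
    linarith
  linarith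

lemma amsEst_amsTable (X : Matrix (Fin n) (Fin n) ℤ)
    (hb : 2 * ∑ p : Fin n × Fin n, |X p.1 p.2| < 2 ^ b) (s : AMSSeed κ m d V) :
    amsEst s (amsTable s X : AMSTable d V b) =
      median fun r => (∑ v, (amsCounter X (s r v) : ℝ) ^ 2) / V := by
  unfold amsEst
  congr 1
  funext r
  congr 1
  refine Finset.sum_congr rfl fun v _ => ?_
  unfold amsTable
  rw [valMinAbs_intCast_of_abs_lt]
  have := abs_amsCounter_le X (s r v)
  linarith

/-- The AMS estimate has relative error at most `η`, with high probability. -/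
lemma avg_ind_amsEst_error_le (X : Matrix (Fin n) (Fin n) ℤ) (hm : m ≠ 0) (hκ : 4 ≤ κ)
    (hn : n ^ 2 ≤ 2 ^ m) (hV : 0 < V) (hX : 0 < frobSq X)
    (hb : 2 * ∑ p : Fin n × Fin n, |X p.1 p.2| < 2 ^ b) {η : ℝ} (hη : 0 < η) :
    avg (fun s : AMSSeed κ m d V => ind (¬
      |amsEst s (amsTable s X : AMSTable d V b) - frobSq X| ≤ η * frobSq X)) ≤
      (4 * (2 / (V * η ^ 2))) ^ (d + 1) := by
  have hV' : (0 : ℝ) < V := by exact_mod_cast hV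
  have h1 : ∀ s : AMSSeed κ m d V, ind (¬
      |amsEst s (amsTable s X : AMSTable d V b) - frobSq X| ≤ η * frobSq X) ≤
      ind (∃ S : Finset (Fin (2 * d + 1)), S.card = d + 1 ∧ ∀ r ∈ S,
        (η * frobSq X) ^ 2 < ((∑ v, (amsCounter X (s r v) : ℝ) ^ 2) / V - frobSq X) ^ 2) := by
    intro s
    refine ind_mono fun h => ?_
    by_contra hS
    apply h
    rw [amsEst_amsTable X hb, abs_le]
    have := median_mem (fun r => (∑ v, (amsCounter X (s r v) : ℝ) ^ 2) / V)
      (fun r => (η * frobSq X) ^ 2 < ((∑ v, (amsCounter X (s r v) : ℝ) ^ 2) / V - frobSq X) ^ 2)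
      (lo := frobSq X - η * frobSq X) (hi := frobSq X + η * frobSq X) ?_ hS
    · constructor <;> linarith [this.1, this.2]
    · intro r hr
      have := abs_le.1 (abs_le_of_sq_le_sq (not_lt.1 hr) (by positivity))
      constructor <;> linarith [this.1, this.2]
  refine (avg_mono h1).trans ?_
  refine avg_ind_majority_le d (fun g : Fin V → HashSeed κ m =>
    (η * frobSq X) ^ 2 < ((∑ v, (amsCounter X (g v) : ℝ) ^ 2) / V - frobSq X) ^ 2) ?_
  refine (avg_ind_le_div (by positivity) (fun g => sq_nonneg _) fun g hg => hg.le).trans ?_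
  refine (div_le_div_of_nonneg_right (avg_ams_mean_error_sq_le X hm hκ hn hV)
    (by positivity)).trans (le_of_eq ?_)
  field_simp

end Sketch


/-! ## One repetition of a precision sampler -/

/-- The relations between the sizes of the structures that the analysis needs. -/
structure SizeConditions (n q k γ : ℕ) (η : ℝ) (z : Sizes) : Prop where
  eta_pos : 0 < η
  eta_le : η ≤ 1 / 1000
  m_ne : z.m ≠ 0
  kappa_ge : 4 ≤ z.κ
  sq_le : n ^ 2 ≤ 2 ^ z.m
  a_le : z.a ≤ z.m
  aS_le : z.aS ≤ z.m
  b_large : 2 * (n ^ 2 * (n ^ γ * 2 ^ (2 * z.m))) < 2 ^ z.b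
  V_pos : 0 < z.V
  V_large : 32 ≤ z.V * η ^ 2
  T_pos : 0 < z.T
  w_pos : 0 < z.w
  wS_pos : 0 < z.wS
  width : 32 * z.w ≤ 2 ^ z.a
  widthS : 32 * z.wS ≤ 2 ^ z.aS
  w_large : 14 * k * (1 + z.m) ≤ η ^ 2 * z.w
  wS_large : 200 * k * z.T ≤ η ^ 2 * z.wS
  thr_eq : z.thr = 8 / η
  R_large : Real.exp (-(η * z.R / 32)) ≤ η
  -- A non-zero integer row has squared norm at least `1`, so its sampling probability `rowSq / θ`
  -- is at least `η / (9 n ^ (2γ + 2))`. This condition and the next make the rounding of `u` and a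
  -- sketch failure negligible even against `η` times that.
  precision : 1 / 2 ^ z.m * (9 * (n : ℝ) ^ (2 * γ + 2)) ≤ η ^ 2
  fail : ((n : ℝ) ^ 2 + 1) * (1 / 4) ^ (z.d + 1) * (9 * (n : ℝ) ^ (2 * γ + 2)) ≤ η ^ 2
  failAll : ((n : ℝ) ^ 2 + 1) * (1 / 4) ^ (z.d + 1) * (q * z.T * z.R + q + 1) ≤ 1 / 20
  T_large : (n : ℝ) ^ (1 - 1 / (q : ℝ)) ≤ η ^ 2 * z.T
  T_large_one : 1 ≤ η ^ 2 * z.T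

/-! ### Perturbation of norms and of normalized products of entries -/

section Vectors

variable {n : ℕ}

/-- The squared norm of a row of an integer matrix. -/
noncomputable def rowSq (A : Matrix (Fin n) (Fin n) ℤ) (i : Fin n) : ℝ := ∑ j, (A i j : ℝ) ^ 2

lemma rowSq_nonneg (A : Matrix (Fin n) (Fin n) ℤ) (i : Fin n) : 0 ≤ rowSq A i :=
  Finset.sum_nonneg fun _ _ => sq_nonneg _

lemma frobSq_eq_sum_rowSq (A : Matrix (Fin n) (Fin n) ℤ) : frobSq A = ∑ i, rowSq A i := by
  unfold frobSq rowSq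
  rw [Fintype.sum_prod_type]

lemma normSq_eq_sum (v : Fin n → ℝ) : normSq v = ∑ j, v j ^ 2 := by
  simp [normSq, dotProduct, sq]

lemma normSq_nonneg (v : Fin n → ℝ) : 0 ≤ normSq v := by
  rw [normSq_eq_sum]; exact Finset.sum_nonneg fun _ _ => sq_nonneg _

lemma sq_le_normSq (v : Fin n → ℝ) (c : Fin n) : v c ^ 2 ≤ normSq v := by
  rw [normSq_eq_sum]
  exact Finset.single_le_sum (f := fun j => v j ^ 2) (fun _ _ => sq_nonneg _) (Finset.mem_univ c)

lemma abs_mul_le_normSq (v : Fin n → ℝ) (c c' : Fin n) : |v c * v c'| ≤ normSq v := by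
  apply abs_le_of_sq_le_sq _ (normSq_nonneg v)
  rw [mul_pow, sq (normSq v)]
  exact mul_le_mul (sq_le_normSq v c) (sq_le_normSq v c') (sq_nonneg _) (normSq_nonneg v)

lemma abs_mul_div_normSq_le_one (v : Fin n → ℝ) (c c' : Fin n) :
    |v c * v c' / normSq v| ≤ 1 := by
  rw [abs_div, abs_of_nonneg (normSq_nonneg v)]
  exact div_le_one_of_le₀ (abs_mul_le_normSq v c c') (normSq_nonneg v)

/-- Consequences of a small relative error of a vector. -/
lemma normSq_and_products_close {η : ℝ} (hη : 0 < η) (hη' : η ≤ 1 / 1000) (r b : Fin n → ℝ)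
    (h : normSq (r - b) ≤ 4 * η ^ 2 * normSq b) :
    |normSq r - normSq b| ≤ 5 * η * normSq b ∧
      ∀ c c', |r c * r c' - b c * b c'| ≤ 7 * η * normSq b := by
  set e : Fin n → ℝ := r - b with he
  have hr : ∀ c, r c = b c + e c := fun c => by simp [he]
  have hB := normSq_nonneg b
  have hE := normSq_nonneg e
  have e4 : 4 * η ^ 2 * normSq b ≤ η * normSq b := by nlinarith
  constructor
  · have h1 : normSq r - normSq b = 2 * ∑ j, b j * e j + normSq e := by
      simp only [normSq_eq_sum, hr, Finset.mul_sum, ← Finset.sum_add_distrib,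
        ← Finset.sum_sub_distrib]
      refine Finset.sum_congr rfl fun j _ => by ring
    have hcs : |∑ j, b j * e j| ≤ 2 * η * normSq b := by
      apply abs_le_of_sq_le_sq _ (by positivity)
      calc (∑ j, b j * e j) ^ 2 ≤ (∑ j, b j ^ 2) * ∑ j, e j ^ 2 :=
            Finset.sum_mul_sq_le_sq_mul_sq _ _ _
        _ = normSq b * normSq e := by rw [normSq_eq_sum, normSq_eq_sum]
        _ ≤ normSq b * (4 * η ^ 2 * normSq b) := by gcongr
        _ = _ := by ring
    rw [h1]
    have := abs_le.1 hcs
    rw [abs_le]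
    constructor <;> nlinarith [this.1, this.2]
  · intro c c'
    have habs : ∀ c, |e c| ≤ 2 * η * √(normSq b) := by
      intro c
      apply abs_le_of_sq_le_sq _ (by positivity)
      rw [mul_pow, Real.sq_sqrt hB]
      refine (sq_le_normSq e c).trans (h.trans (le_of_eq (by ring)))
    have habsb : ∀ c, |b c| ≤ √(normSq b) := fun c => Real.abs_le_sqrt (sq_le_normSq b c)
    have h1 : r c * r c' - b c * b c' = b c * e c' + e c * b c' + e c * e c' := by
      rw [hr, hr]; ring
    have hs := Real.sq_sqrt hB
    set S := √(normSq b)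
    have hS : 0 ≤ S := Real.sqrt_nonneg _
    calc |r c * r c' - b c * b c'| ≤ |b c| * |e c'| + |e c| * |b c'| + |e c| * |e c'| := by
          rw [h1, ← abs_mul, ← abs_mul, ← abs_mul]; exact abs_add_three _ _ _
      _ ≤ S * (2 * η * S) + (2 * η * S) * S + (2 * η * S) * (2 * η * S) := by
          gcongr
          all_goals first | exact habs _ | exact habsb _
      _ = 4 * η * S ^ 2 + 4 * η ^ 2 * S ^ 2 := by ring
      _ ≤ _ := by rw [hs]; nlinarith

/-- Consequences of a small relative error of a vector for the normalized vector. -/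
lemma normalized_products_close {η : ℝ} (hη : 0 < η) (hη' : η ≤ 1 / 1000) (r b : Fin n → ℝ)
    (hb : 0 < normSq b) (h : normSq (r - b) ≤ 4 * η ^ 2 * normSq b) (c c' : Fin n) :
    |r c * r c' / normSq r - b c * b c' / normSq b| ≤ 24 * η := by
  obtain ⟨h1, h2⟩ := normSq_and_products_close hη hη' r b h
  have h3 := h2 c c'
  have h4 := abs_mul_le_normSq b c c'
  have h5 := abs_le.1 h1
  set B := normSq b
  set R := normSq r
  have hR : B / 2 ≤ R := by nlinarith [h5.1]
  have hR0 : 0 < R := by linarith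
  have e1 : r c * r c' / R - b c * b c' / B =
      ((r c * r c' - b c * b c') * B + (b c * b c') * (B - R)) / (R * B) := by
    field_simp
    ring
  rw [e1, abs_div, abs_of_pos (mul_pos hR0 hb), div_le_iff₀ (mul_pos hR0 hb)]
  calc |(r c * r c' - b c * b c') * B + (b c * b c') * (B - R)|
      ≤ |r c * r c' - b c * b c'| * B + |b c * b c'| * |B - R| := by
        refine (abs_add_le _ _).trans ?_
        rw [abs_mul, abs_mul, abs_of_pos hb]
    _ ≤ (7 * η * B) * B + B * (5 * η * B) := by
        gcongr
        rw [abs_sub_comm]; exact h1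
    _ = 24 * η * (B / 2 * B) := by ring
    _ ≤ 24 * η * (R * B) := by gcongr

/-- The cut-off is twice the error bound `g`. If `x` is retained then `g ≤ |x| / 2`, hence `|x| ≤ 2
|y|`; if it is dropped then `|y| ≤ 3 g`. The second conclusion preserves zeros, so an estimated row
inherits the sparsity of the true one. -/
lemma retain_spec {g x y : ℝ} (h : |x - y| ≤ g) :
    |retain (2 * g) x - y| ≤ 3 * g ∧ |retain (2 * g) x| ≤ 2 * |y| := by
  have hg : 0 ≤ g := (abs_nonneg _).trans h
  have h1 : |x| ≤ |y| + g := by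
    have := abs_sub_abs_le_abs_sub x y
    linarith
  have h2 : |y| ≤ |x| + g := by
    have := abs_sub_abs_le_abs_sub y x
    rw [abs_sub_comm] at this
    linarith
  unfold retain
  split_ifs with hx
  · constructor <;> linarith
  · push Not at hx
    rw [zero_sub, abs_neg, abs_zero]
    constructor
    · linarith
    · positivity

/-- A sparse vector with entrywise small error has a small error. -/
lemma normSq_sub_le_of_sparse {k : ℕ} {g : ℝ} (r b : Fin n → ℝ) (S : Finset (Fin n))
    (hS : S.card ≤ k) (hr : ∀ j ∉ S, r j = 0 ∧ b j = 0) (h : ∀ j, |r j - b j| ≤ 3 * g) :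
    normSq (r - b) ≤ k * (9 * g ^ 2) := by
  rw [normSq_eq_sum]
  have h1 : ∑ j, (r - b) j ^ 2 = ∑ j ∈ S, (r - b) j ^ 2 := by
    symm
    apply Finset.sum_subset (Finset.subset_univ _)
    intro j _ hj
    simp [hr j hj]
  rw [h1]
  calc ∑ j ∈ S, (r - b) j ^ 2 ≤ ∑ j ∈ S, 9 * g ^ 2 := by
        refine Finset.sum_le_sum fun j _ => ?_
        have := sq_le_sq' (abs_le.1 (h j)).1 (abs_le.1 (h j)).2
        simp only [Pi.sub_apply]
        linarith
    _ = S.card * (9 * g ^ 2) := by simp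
    _ ≤ _ := by gcongr

end Vectors

/-! ### The scaled matrix `B` and the estimates of its rows -/

section Repetition

variable {n q k γ : ℕ} {η : ℝ} {z : Sizes}

/-- The scaling factor of row `i` in a precision sampler. -/
noncomputable def pFactor (s : PSeed z) (i : Fin n) : ℝ := (pScale s i : ℝ) / 2 ^ z.m

lemma pU_pos (s : PSeed z) (i : Fin n) : 0 < pU s i := hashUnif_pos _ _

lemma pU_le_one (hm : z.m ≠ 0) (s : PSeed z) (i : Fin n) : pU s i ≤ 1 := hashUnif_le_one hm _ _

lemma pScale_le (s : PSeed z) (i : Fin n) : (pScale s i : ℝ) ≤ 2 ^ z.m / √(pU s i) :=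
  Int.floor_le _

lemma two_pow_le_div_sqrt (hm : z.m ≠ 0) (s : PSeed z) (i : Fin n) :
    (2 : ℝ) ^ z.m ≤ 2 ^ z.m / √(pU s i) := by
  have h1 : √(pU s i) ≤ 1 := Real.sqrt_le_one.2 (pU_le_one hm s i)
  rw [le_div_iff₀ (Real.sqrt_pos.2 (pU_pos s i))]
  have : (0 : ℝ) < 2 ^ z.m := by positivity
  nlinarith

lemma two_pow_le_pScale (hm : z.m ≠ 0) (s : PSeed z) (i : Fin n) : (2 : ℤ) ^ z.m ≤ pScale s i := by
  apply Int.le_floor.2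
  push_cast
  exact two_pow_le_div_sqrt hm s i

lemma pScale_pos (hm : z.m ≠ 0) (s : PSeed z) (i : Fin n) : 0 < pScale s i :=
  lt_of_lt_of_le (by positivity) (two_pow_le_pScale hm s i)

lemma pScale_le_two_pow (hm : z.m ≠ 0) (s : PSeed z) (i : Fin n) :
    pScale s i ≤ 2 ^ (2 * z.m) := by
  have hu := pU_pos s i
  have h1 : 1 / 2 ^ z.m ≤ √(pU s i) := by
    have h2 : pU s i ≤ √(pU s i) := by
      apply Real.le_sqrt_of_sq_le
      have := pU_le_one hm s i
      nlinarith
    exact (le_hashUnif s.1 i.val).trans h2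
  have h2 : (pScale s i : ℝ) ≤ 2 ^ (2 * z.m) := by
    refine (pScale_le s i).trans ?_
    rw [div_le_iff₀ (Real.sqrt_pos.2 hu)]
    have hp : (0 : ℝ) < 2 ^ z.m := by positivity
    have h3 : 1 ≤ 2 ^ z.m * √(pU s i) := by
      have := mul_le_mul_of_nonneg_left h1 hp.le
      rwa [mul_one_div_cancel hp.ne'] at this
    calc (2 : ℝ) ^ z.m = 2 ^ z.m * 1 := by ring
      _ ≤ 2 ^ z.m * (2 ^ z.m * √(pU s i)) := by gcongr
      _ = _ := by ring
  exact_mod_cast h2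

lemma pFactor_pos (hm : z.m ≠ 0) (s : PSeed z) (i : Fin n) : 0 < pFactor s i := by
  unfold pFactor
  have : (0 : ℝ) < pScale s i := by exact_mod_cast pScale_pos hm s i
  positivity

lemma pFactor_sq_le (hm : z.m ≠ 0) (s : PSeed z) (i : Fin n) : pFactor s i ^ 2 ≤ 1 / pU s i := by
  have h1 : pFactor s i ≤ 1 / √(pU s i) := by
    unfold pFactor
    rw [div_le_iff₀ (by positivity)]
    exact (pScale_le s i).trans (le_of_eq (by ring))
  calc pFactor s i ^ 2 ≤ (1 / √(pU s i)) ^ 2 := by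
        gcongr
        exact (pFactor_pos hm s i).le
    _ = 1 / pU s i := by rw [div_pow, Real.sq_sqrt (pU_pos s i).le, one_pow]

/-- Rounding down loses at most one unit of `2 ^ (-m)`, a relative loss of at most `2 ^ (-m)`
because `1 / √u ≥ 1`; squaring at most doubles it. -/
lemma le_pFactor_sq (hm : z.m ≠ 0) (s : PSeed z) (i : Fin n) :
    (1 - 2 * (1 / 2 ^ z.m)) / pU s i ≤ pFactor s i ^ 2 := by
  have hp : (0 : ℝ) < 2 ^ z.m := by positivity
  have h2 : (1 - 1 / 2 ^ z.m) / √(pU s i) ≤ pFactor s i := by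
    have h3 : 2 ^ z.m / √(pU s i) - 1 ≤ pScale s i := (Int.sub_one_lt_floor _).le
    have h4 := two_pow_le_div_sqrt hm s i
    unfold pFactor
    rw [le_div_iff₀ hp]
    have hs : 0 < √(pU s i) := Real.sqrt_pos.2 (pU_pos s i)
    have h5 : 1 ≤ 1 / √(pU s i) := by
      rw [le_div_iff₀ hs, one_mul]
      exact Real.sqrt_le_one.2 (pU_le_one hm s i)
    calc (1 - 1 / 2 ^ z.m) / √(pU s i) * 2 ^ z.m = 2 ^ z.m / √(pU s i) - 1 / √(pU s i) := by
          field_simp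
      _ ≤ 2 ^ z.m / √(pU s i) - 1 := by linarith
      _ ≤ _ := h3
  have h6 : (0 : ℝ) ≤ 1 - 1 / 2 ^ z.m := by
    rw [sub_nonneg, div_le_one hp]
    exact one_le_pow₀ (by norm_num)
  calc (1 - 2 * (1 / 2 ^ z.m)) / pU s i ≤ (1 - 1 / 2 ^ z.m) ^ 2 / pU s i := by
        have := pU_pos s i
        gcongr
        nlinarith [sq_nonneg ((1 : ℝ) / 2 ^ z.m)]
    _ = ((1 - 1 / 2 ^ z.m) / √(pU s i)) ^ 2 := by rw [div_pow, Real.sq_sqrt (pU_pos s i).le]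
    _ ≤ _ := by
        have : 0 ≤ (1 - 1 / 2 ^ z.m) / √(pU s i) := div_nonneg h6 (Real.sqrt_nonneg _)
        gcongr

variable (A : Matrix (Fin n) (Fin n) ℤ)

/-- The squared Frobenius norm of `B`. -/
noncomputable def pFrob (s : PSeed z) : ℝ := ∑ i, pFactor s i ^ 2 * rowSq A i

lemma frobSq_scaled (s : PSeed z) : frobSq (scaled s A) = pFrob A s * (2 ^ z.m) ^ 2 := by
  rw [frobSq_eq_sum_rowSq]
  unfold pFrob rowSq scaled pFactor
  rw [Finset.sum_mul]
  refine Finset.sum_congr rfl fun i _ => ?_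
  rw [Finset.mul_sum, Finset.sum_mul]
  refine Finset.sum_congr rfl fun j _ => ?_
  push_cast
  field_simp

/-- The sketches of a precision sampler are accurate. -/
def pGood (s : PSeed z) : Prop :=
  (∀ i j, |csEst s.2.1 (pTable s A).1 i j - scaled s A i j| ≤
    √(frobSq (scaled s A) / (2 * z.w))) ∧
  |amsEst s.2.2 (pTable s A).2 - frobSq (scaled s A)| ≤ 1 / 2 * frobSq (scaled s A)

lemma frobSq_pos_of_ne {A : Matrix (Fin n) (Fin n) ℤ} {i j : Fin n} (h : A i j ≠ 0) :
    0 < frobSq A := by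
  unfold frobSq
  refine lt_of_lt_of_le ?_ (Finset.single_le_sum (f := fun p : Fin n × Fin n =>
    (A p.1 p.2 : ℝ) ^ 2) (fun _ _ => sq_nonneg _) (Finset.mem_univ (i, j)))
  have : (A i j : ℝ) ≠ 0 := by exact_mod_cast h
  positivity

lemma exists_ne_of_frobSq_pos {A : Matrix (Fin n) (Fin n) ℤ} (h : 0 < frobSq A) :
    ∃ i j, A i j ≠ 0 := by
  by_contra hne
  push Not at hne
  unfold frobSq at h
  simp [hne] at h

variable {A}

lemma sum_abs_scaled_lt (hz : SizeConditions n q k γ η z) (hA : ∀ i j, |A i j| ≤ (n : ℤ) ^ γ)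
    (s : PSeed z) : 2 * ∑ p : Fin n × Fin n, |scaled s A p.1 p.2| < 2 ^ z.b := by
  have h1 : ∑ p : Fin n × Fin n, |scaled s A p.1 p.2| ≤
      ∑ _p : Fin n × Fin n, (n : ℤ) ^ γ * 2 ^ (2 * z.m) := by
    refine Finset.sum_le_sum fun p _ => ?_
    unfold scaled
    rw [abs_mul, abs_of_pos (pScale_pos hz.m_ne s p.1), mul_comm]
    exact mul_le_mul (hA _ _) (pScale_le_two_pow hz.m_ne s _) (pScale_pos hz.m_ne s _).le
      (by positivity)
  have h2 := hz.b_large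
  zify at h2
  simp at h1
  nlinarith

lemma sum_abs_lt (hz : SizeConditions n q k γ η z) (hA : ∀ i j, |A i j| ≤ (n : ℤ) ^ γ) :
    2 * ∑ p : Fin n × Fin n, |A p.1 p.2| < 2 ^ z.b := by
  have h1 : ∑ p : Fin n × Fin n, |A p.1 p.2| ≤
      ∑ _p : Fin n × Fin n, (n : ℤ) ^ γ * 2 ^ (2 * z.m) := by
    refine Finset.sum_le_sum fun p _ => (hA _ _).trans ?_
    exact le_mul_of_one_le_right (by positivity) (one_le_pow₀ (by norm_num))
  have h2 := hz.b_large
  zify at h2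
  simp at h1
  nlinarith

lemma frobSq_scaled_pos (hz : SizeConditions n q k γ η z) (hF : 0 < frobSq A) (s : PSeed z) :
    0 < frobSq (scaled s A) := by
  obtain ⟨i, j, h⟩ := exists_ne_of_frobSq_pos hF
  exact frobSq_pos_of_ne (i := i) (j := j) (mul_ne_zero (pScale_pos hz.m_ne s i).ne' h)

lemma avg_not_pGood_le (hz : SizeConditions n q k γ η z) (hA : ∀ i j, |A i j| ≤ (n : ℤ) ^ γ)
    (hF : 0 < frobSq A) :
    avg (fun s : PSeed z => ind (¬ pGood A s)) ≤ ((n : ℝ) ^ 2 + 1) * (1 / 4) ^ (z.d + 1) := by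
  rw [avg_prod]
  apply avg_le_of_forall_le
  intro h
  -- the sketched matrix depends only on the first part of the seed
  set s₀ : PSeed z := (h, Classical.arbitrary _) with hs₀
  have hsc : ∀ y, scaled (z := z) (h, y) A = scaled s₀ A := fun y => rfl
  set X := scaled s₀ A with hX
  have hXpos : 0 < frobSq X := frobSq_scaled_pos hz hF s₀
  have hXb := sum_abs_scaled_lt hz hA s₀
  have hw : (0 : ℝ) < z.w := by exact_mod_cast hz.w_pos
  have h1 : ∀ y : CSSeed z.κ z.m z.d × AMSSeed z.κ z.m z.d z.V,
      ind (¬ pGood A ((h, y) : PSeed z)) ≤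
      ind (¬ ∀ i j, |csEst y.1 (csTable y.1 X : CSTable z.d z.a z.b) i j - X i j| ≤
        √(frobSq X / (2 * z.w))) +
      ind (¬ |amsEst y.2 (amsTable y.2 X : AMSTable z.d z.V z.b) - frobSq X| ≤
        1 / 2 * frobSq X) := by
    intro y
    refine le_trans (ind_mono ?_) (ind_or_le _ _)
    intro hng
    unfold pGood at hng
    rw [not_and_or] at hng
    exact hng
  refine (avg_mono h1).trans ?_
  rw [avg_add, avg_fst (fun y : CSSeed z.κ z.m z.d => ind (¬ ∀ i j,
    |csEst y (csTable y X : CSTable z.d z.a z.b) i j - X i j| ≤ √(frobSq X / (2 * z.w)))),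
    avg_snd (fun y : AMSSeed z.κ z.m z.d z.V => ind (¬
    |amsEst y (amsTable y X : AMSTable z.d z.V z.b) - frobSq X| ≤ 1 / 2 * frobSq X)), add_mul]
  have hκ := hz.kappa_ge
  apply add_le_add
  · refine (avg_ind_csEst_error_le X hz.m_ne (by omega) hz.a_le hz.sq_le hXb
      (by positivity)).trans ?_
    gcongr
    have hwd : (32 : ℝ) * z.w ≤ 2 ^ z.a := by exact_mod_cast hz.width
    rw [div_div, mul_div_assoc', div_le_iff₀ (by positivity)]
    -- One row of the table has mean square error at most `frobSq X / 2 ^ a`. As `2 ^ a ≥ 32 w`,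
    -- this is at most a sixteenth of the tolerance `frobSq X / (2 w)`, and the factor `4` of the
    -- majority bound leaves `1 / 4`.
    calc 4 * frobSq X = 1 / 4 * (32 * z.w * (frobSq X / (2 * z.w))) := by field_simp; ring
      _ ≤ _ := by gcongr
  · refine (avg_ind_amsEst_error_le X hz.m_ne hz.kappa_ge hz.sq_le hz.V_pos hXpos hXb
      (by norm_num)).trans ?_
    rw [one_mul]
    gcongr
    have hV : (0 : ℝ) < z.V := by exact_mod_cast hz.V_pos
    have h1 := hz.V_large
    have h2 := hz.eta_le
    have h3 := hz.eta_pos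
    have h4 : η ^ 2 ≤ 1 / 1000 := by nlinarith
    have h5 : (1000 : ℝ) ≤ z.V := by nlinarith
    rw [mul_div_assoc', div_le_iff₀ (by positivity)]
    linarith

/-! ### Deterministic consequences -/

/-- The estimated rows of `B` when the sketches are accurate. -/
lemma pRow_spec (hz : SizeConditions n q k γ η z) {s : PSeed z} (hs : pGood A s) :
    ∃ g : ℝ, 0 ≤ g ∧ g ^ 2 ≤ 3 / 2 * pFrob A s / z.w ∧ ∀ i j,
      |pRow s (pTable s A) i j - pFactor s i * A i j| ≤ 3 * g ∧
      |pRow s (pTable s A) i j| ≤ 2 * |pFactor s i * A i j| := by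
  have hp : (0 : ℝ) < 2 ^ z.m := by positivity
  have hw : (0 : ℝ) < z.w := by exact_mod_cast hz.w_pos
  have hβ : 0 ≤ pFrob A s := Finset.sum_nonneg fun i _ => mul_nonneg (sq_nonneg _) (rowSq_nonneg A i)
  obtain ⟨h1, h2⟩ := hs
  rw [frobSq_scaled] at h1 h2
  have h2' := abs_le.1 h2
  have hN : pNorm s (pTable s A) * (2 ^ z.m) ^ 2 = amsEst s.2.2 (pTable s A).2 := by
    unfold pNorm
    field_simp
  rw [← hN] at h2'
  have hlo : pFrob A s / 2 ≤ pNorm s (pTable s A) := by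
    have : pFrob A s / 2 * (2 ^ z.m) ^ 2 ≤ pNorm s (pTable s A) * (2 ^ z.m) ^ 2 := by linarith [h2'.1]
    exact le_of_mul_le_mul_right this (by positivity)
  have hhi : pNorm s (pTable s A) ≤ 3 / 2 * pFrob A s := by
    have : pNorm s (pTable s A) * (2 ^ z.m) ^ 2 ≤ 3 / 2 * pFrob A s * (2 ^ z.m) ^ 2 := by
      linarith [h2'.2]
    exact le_of_mul_le_mul_right this (by positivity)
  have hN0 : 0 ≤ pNorm s (pTable s A) := by linarith
  refine ⟨√(pNorm s (pTable s A) / z.w), Real.sqrt_nonneg _, ?_, fun i j => ?_⟩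
  · rw [Real.sq_sqrt (by positivity)]
    gcongr
  -- The sketch error `√(‖B‖_F² / (2 w))` is at most half the cut-off, `√(L' / w)`, since `L' ≥
  -- ‖B‖_F² / 2`.
  · apply retain_spec
    have h3 : csEst s.2.1 (pTable s A).1 i j / 2 ^ z.m - pFactor s i * A i j =
        (csEst s.2.1 (pTable s A).1 i j - scaled s A i j) / 2 ^ z.m := by
      unfold scaled pFactor
      push_cast
      field_simp
    rw [h3, abs_div, abs_of_pos hp, div_le_iff₀ hp]
    refine (h1 i j).trans ?_
    rw [← Real.sqrt_sq hp.le, ← Real.sqrt_mul (by positivity), Real.sqrt_sq hp.le]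
    apply Real.sqrt_le_sqrt
    rw [div_mul_eq_mul_div, div_le_div_iff₀ (by positivity) hw]
    have : pFrob A s ≤ 2 * pNorm s (pTable s A) := by linarith
    calc pFrob A s * (2 ^ z.m) ^ 2 * z.w ≤ (2 * pNorm s (pTable s A)) * (2 ^ z.m) ^ 2 * z.w := by
          gcongr
      _ = _ := by ring

lemma pRow_eq_zero (hz : SizeConditions n q k γ η z) {s : PSeed z} (hs : pGood A s) {i j : Fin n}
    (h : A i j = 0) : pRow s (pTable s A) i j = 0 := by
  obtain ⟨g, _, _, hg⟩ := pRow_spec hz hs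
  have := (hg i j).2
  rw [h] at this
  simpa using this

lemma normSq_pRow_le (hz : SizeConditions n q k γ η z) {s : PSeed z} (hs : pGood A s) (i : Fin n) :
    normSq (pRow s (pTable s A) i) ≤ 4 * (pFactor s i ^ 2 * rowSq A i) := by
  obtain ⟨g, _, _, hg⟩ := pRow_spec hz hs
  rw [normSq_eq_sum, rowSq, Finset.mul_sum, Finset.mul_sum]
  refine Finset.sum_le_sum fun j _ => ?_
  have h1 := (hg i j).2
  have : pRow s (pTable s A) i j ^ 2 ≤ (2 * |pFactor s i * A i j|) ^ 2 := by
    rw [← sq_abs]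
    gcongr
  refine this.trans (le_of_eq ?_)
  rw [mul_pow, sq_abs]; ring

/-- The rows other than `i` do not contribute much to `‖B‖_F²`. -/
def lowNoise (A : Matrix (Fin n) (Fin n) ℤ) (η : ℝ) (s : PSeed z) (i : Fin n) : Prop :=
  ∑ j ∈ Finset.univ.erase i, rowSq A j / pU s j ≤ frobSq A * (1 + z.m) / η

/-- Let `x` be the squared norm of row `i` of the scaled matrix. Low noise and `F ≤ η x` bound the
squared norm of the whole scaled matrix by `2 x (1 + m)`. The estimated row differs from the true
one in at most `k` entries, by at most `3 g` each, and `w ≥ 14 k (1 + m) / η²` makes `9 k g²` at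
most `2 η² x`. -/
lemma pRow_close (hz : SizeConditions n q k γ η z) (hk : IsSparse k A) {s : PSeed z}
    (hs : pGood A s) {i : Fin n} (hlow : lowNoise A η s i)
    (hbig : frobSq A ≤ η * (pFactor s i ^ 2 * rowSq A i)) :
    normSq (pRow s (pTable s A) i - fun j => pFactor s i * A i j) ≤
      4 * η ^ 2 * normSq (fun j => pFactor s i * (A i j : ℝ)) := by
  obtain ⟨g, hg0, hg2, hg⟩ := pRow_spec hz hs
  have hη := hz.eta_pos
  have hw : (0 : ℝ) < z.w := by exact_mod_cast hz.w_pos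
  have hB : normSq (fun j => pFactor s i * (A i j : ℝ)) = pFactor s i ^ 2 * rowSq A i := by
    rw [normSq_eq_sum, rowSq, Finset.mul_sum]
    exact Finset.sum_congr rfl fun j _ => by ring
  rw [hB]
  refine (normSq_sub_le_of_sparse (k := k) (g := g) _ _
    (Finset.univ.filter fun j => A i j ≠ 0) (hk.1 i) ?_ fun j => (hg i j).1).trans ?_
  · intro j hj
    have h0 : A i j = 0 := by simpa using hj
    exact ⟨pRow_eq_zero hz hs h0, by simp [h0]⟩
  · set B := pFactor s i ^ 2 * rowSq A i with hBdef
    have hB0 : 0 ≤ B := mul_nonneg (sq_nonneg _) (rowSq_nonneg A i)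
    have h1 : pFrob A s ≤ B + frobSq A * (1 + z.m) / η := by
      unfold pFrob
      rw [← Finset.add_sum_erase _ _ (Finset.mem_univ i)]
      refine add_le_add le_rfl (le_trans (Finset.sum_le_sum fun j _ => ?_) hlow)
      calc pFactor s j ^ 2 * rowSq A j ≤ 1 / pU s j * rowSq A j :=
            mul_le_mul_of_nonneg_right (pFactor_sq_le hz.m_ne s j) (rowSq_nonneg A j)
        _ = _ := by ring
    have hm : (0 : ℝ) ≤ z.m := by positivity
    have h2 : frobSq A * (1 + z.m) / η ≤ B * (1 + z.m) := by
      rw [div_le_iff₀ hη]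
      calc frobSq A * (1 + z.m) ≤ (η * B) * (1 + z.m) := by gcongr
        _ = _ := by ring
    have h3 : pFrob A s ≤ 2 * B * (1 + z.m) := by nlinarith
    have h4 := hz.w_large
    calc (k : ℝ) * (9 * g ^ 2) ≤ k * (9 * (3 / 2 * pFrob A s / z.w)) := by gcongr
      _ ≤ k * (9 * (3 / 2 * (2 * B * (1 + z.m)) / z.w)) := by gcongr
      _ = (27 * k * (1 + z.m)) * B / z.w := by ring
      _ ≤ (2 * (14 * k * (1 + z.m))) * B / z.w := by
          have h5 : (0 : ℝ) ≤ k * (1 + z.m) := by positivity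
          have h6 : (27 : ℝ) * k * (1 + z.m) ≤ 2 * (14 * k * (1 + z.m)) := by linarith
          exact div_le_div_of_nonneg_right (mul_le_mul_of_nonneg_right h6 hB0) hw.le
      _ ≤ (2 * (η ^ 2 * z.w)) * B / z.w := by gcongr
      _ = 2 * η ^ 2 * B := by field_simp
      _ ≤ _ := by nlinarith [mul_nonneg (sq_nonneg η) hB0]

end Repetition


section Outcome

variable {n q k γ : ℕ} {η : ℝ} {z : Sizes} {A : Matrix (Fin n) (Fin n) ℤ}

/-! ### The outcome of one repetition -/

lemma pSample_eq_some {θ : ℝ} {s : PSeed z} {M : PMem z} {x : Fin n × (Fin n → ℝ)}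
    (h : pSample θ s M = some x) :
    θ ≤ normSq (pRow s M x.1) ∧ x.2 = fun j => √(pU s x.1) * pRow s M x.1 j := by
  unfold pSample at h
  split_ifs at h with hu
  simp only [Option.some.injEq] at h
  subst h
  exact ⟨hu.exists.choose_spec, rfl⟩

lemma pSample_eq_some_of_unique {θ : ℝ} {s : PSeed z} {M : PMem z} {i : Fin n}
    (h : θ ≤ normSq (pRow s M i)) (hu : ∀ j, j ≠ i → normSq (pRow s M j) < θ) :
    pSample θ s M = some (i, fun j => √(pU s i) * pRow s M i j) := by
  have hex : ∃! i : Fin n, θ ≤ normSq (pRow s M i) := by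
    refine ⟨i, h, fun j hj => ?_⟩
    by_contra hne
    exact absurd (hu j hne) (not_lt.2 hj)
  have hi : hex.exists.choose = i := hex.unique hex.exists.choose_spec h
  unfold pSample
  rw [dif_pos hex, hi]

open Classical in
/-- The outcome of a repetition, discarded if the sketches are not accurate. -/
noncomputable def pOut (A : Matrix (Fin n) (Fin n) ℤ) (θ : ℝ) (s : PSeed z) :
    Option (Fin n × (Fin n → ℝ)) :=
  if pGood A s then pSample θ s (pTable s A) else none

/-- The event that an outcome is row `i`. -/
def isRow (i : Fin n) (o : Option (Fin n × (Fin n → ℝ))) : Prop := ∃ v, o = some (i, v)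

/-- The product of two entries of the normalized row of an outcome. -/
noncomputable def dirProd (c c' : Fin n) : Option (Fin n × (Fin n → ℝ)) → ℝ
  | none => 0
  | some x => x.2 c * x.2 c' / normSq x.2

lemma abs_dirProd_le_one (c c' : Fin n) (o : Option (Fin n × (Fin n → ℝ))) :
    |dirProd c c' o| ≤ 1 := by
  rcases o with _ | x
  · simp [dirProd]
  · exact abs_mul_div_normSq_le_one x.2 c c'

lemma pOut_eq_some {θ : ℝ} {s : PSeed z} {x : Fin n × (Fin n → ℝ)} (h : pOut A θ s = some x) :
    pGood A s ∧ θ ≤ normSq (pRow s (pTable s A) x.1) ∧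
      x.2 = fun j => √(pU s x.1) * pRow s (pTable s A) x.1 j := by
  unfold pOut at h
  split_ifs at h with hg
  exact ⟨hg, pSample_eq_some h⟩

lemma pOut_support (hz : SizeConditions n q k γ η z) {θ : ℝ} {s : PSeed z}
    {x : Fin n × (Fin n → ℝ)} (h : pOut A θ s = some x) {j : Fin n} (hj : A x.1 j = 0) :
    x.2 j = 0 := by
  obtain ⟨hg, _, hx⟩ := pOut_eq_some h
  rw [hx]
  simp [pRow_eq_zero hz hg hj]

/-- A sampled row has a small number `u_i`. -/
lemma pU_le_of_pOut (hz : SizeConditions n q k γ η z) {θ : ℝ} (hθ : 0 < θ) {s : PSeed z}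
    {i : Fin n} (h : isRow i (pOut A θ s)) : pU s i ≤ 4 * rowSq A i / θ := by
  obtain ⟨v, hv⟩ := h
  obtain ⟨hg, h1, _⟩ := pOut_eq_some hv
  have h2 := normSq_pRow_le hz hg i
  have h3 : pFactor s i ^ 2 * rowSq A i ≤ 1 / pU s i * rowSq A i :=
    mul_le_mul_of_nonneg_right (pFactor_sq_le hz.m_ne s i) (rowSq_nonneg A i)
  have h4 : θ ≤ 4 * (1 / pU s i * rowSq A i) := by simp only at h1; linarith
  have hu := pU_pos s i
  rw [le_div_iff₀ hθ]
  calc pU s i * θ ≤ pU s i * (4 * (1 / pU s i * rowSq A i)) := by gcongr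
    _ = _ := by field_simp

variable {θ : ℝ}

/-- A row that is sampled although the noise is low has a slightly smaller `u_i`, and its direction
is accurate. -/
lemma pOut_accurate (hz : SizeConditions n q k γ η z) (hk : IsSparse k A) (hθ : 0 < θ)
    (hθF : 4 * frobSq A ≤ η * θ) {s : PSeed z} {i : Fin n} (h : isRow i (pOut A θ s))
    (hlow : lowNoise A η s i) :
    pU s i ≤ (1 + 5 * η) * rowSq A i / θ ∧ ∀ c c', 0 < rowSq A i →
      |dirProd c c' (pOut A θ s) - A i c * A i c' / rowSq A i| ≤ 24 * η := by
  obtain ⟨v, hv⟩ := h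
  obtain ⟨hg, h1, hx⟩ := pOut_eq_some hv
  simp only at h1 hx
  have hη := hz.eta_pos
  have h2 := normSq_pRow_le hz hg i
  set B := pFactor s i ^ 2 * rowSq A i with hB
  have hf := pFactor_pos hz.m_ne s i
  have hBn : normSq (fun j => pFactor s i * (A i j : ℝ)) = B := by
    rw [normSq_eq_sum, hB, rowSq, Finset.mul_sum]
    exact Finset.sum_congr rfl fun j _ => by ring
  have hFB : frobSq A ≤ η * B := by nlinarith
  have hclose := pRow_close hz hk hg hlow hFB
  obtain ⟨h3, _⟩ := normSq_and_products_close hη hz.eta_le _ _ hclose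
  rw [hBn] at h3
  have h3' := (abs_le.1 h3).2
  have hu := pU_pos s i
  constructor
  · have h4 : B ≤ 1 / pU s i * rowSq A i :=
      mul_le_mul_of_nonneg_right (pFactor_sq_le hz.m_ne s i) (rowSq_nonneg A i)
    have h5 : θ ≤ (1 + 5 * η) * (1 / pU s i * rowSq A i) := by
      have : (1 + 5 * η) * B ≤ (1 + 5 * η) * (1 / pU s i * rowSq A i) := by gcongr
      linarith
    rw [le_div_iff₀ hθ]
    calc pU s i * θ ≤ pU s i * ((1 + 5 * η) * (1 / pU s i * rowSq A i)) := by gcongr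
      _ = _ := by field_simp
  · intro c c' hpos
    have hBpos : 0 < B := by positivity
    have h6 := normalized_products_close hη hz.eta_le _ _ (by rw [hBn]; exact hBpos) hclose c c'
    -- The factor `√u` that undoes the scaling cancels in a normalized product, so the sampled row
    -- has the direction of the estimated row of `B`.
    have e1 : dirProd c c' (pOut A θ s) = pRow s (pTable s A) i c * pRow s (pTable s A) i c' /
        normSq (pRow s (pTable s A) i) := by
      have hs : √(pU s i) ^ 2 = pU s i := Real.sq_sqrt hu.le
      have e2 : normSq (fun j => √(pU s i) * pRow s (pTable s A) i j) =
          pU s i * normSq (pRow s (pTable s A) i) := by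
        rw [normSq_eq_sum, normSq_eq_sum, Finset.mul_sum]
        exact Finset.sum_congr rfl fun j _ => by rw [mul_pow, hs]
      rw [hv]
      simp only [dirProd, hx, e2]
      rw [show √(pU s i) * pRow s (pTable s A) i c * (√(pU s i) * pRow s (pTable s A) i c') =
        √(pU s i) ^ 2 * (pRow s (pTable s A) i c * pRow s (pTable s A) i c') by ring, hs]
      rw [mul_div_mul_left _ _ hu.ne']
    have e3 : pFactor s i * (A i c : ℝ) * (pFactor s i * (A i c' : ℝ)) /
        normSq (fun j => pFactor s i * (A i j : ℝ)) = A i c * A i c' / rowSq A i := by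
      rw [hBn, hB]
      field_simp
    rw [e1, ← e3]
    exact h6

/-- A sufficient condition for row `i` to be sampled. -/
lemma isRow_pOut (hz : SizeConditions n q k γ η z) (hk : IsSparse k A) (hθ : 0 < θ)
    (hθF : 4 * frobSq A ≤ η * θ) {s : PSeed z} (hg : pGood A s) {i : Fin n}
    (hu : pU s i ≤ (1 - 10 * η) * rowSq A i / θ) (hlow : lowNoise A η s i)
    (hother : ∀ j, j ≠ i → ¬ pU s j ≤ 4 * rowSq A j / θ) : isRow i (pOut A θ s) := by
  have hη := hz.eta_pos
  have hη' := hz.eta_le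
  have hupos := pU_pos s i
  set B := pFactor s i ^ 2 * rowSq A i with hB
  have hBn : normSq (fun j => pFactor s i * (A i j : ℝ)) = B := by
    rw [normSq_eq_sum, hB, rowSq, Finset.mul_sum]
    exact Finset.sum_congr rfl fun j _ => by ring
  have hprec : 1 / 2 ^ z.m ≤ η := by
    have hp := hz.precision
    have : (1 : ℝ) ≤ (n : ℝ) ^ (2 * γ + 2) := by
      apply one_le_pow₀
      have : 0 < n := i.pos
      exact_mod_cast this
    have h0 : (0 : ℝ) < 1 / 2 ^ z.m := by positivity
    nlinarith
  have h1 : (1 - 10 * η) * (rowSq A i / pU s i) ≥ θ := by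
    rw [le_div_iff₀ hθ] at hu
    rw [ge_iff_le, ← mul_div_assoc, le_div_iff₀ hupos]
    linarith
  have h2 : (1 - 2 * η) * (rowSq A i / pU s i) ≤ B := by
    have h3 := le_pFactor_sq hz.m_ne s i
    calc (1 - 2 * η) * (rowSq A i / pU s i) ≤ (1 - 2 * (1 / 2 ^ z.m)) * (rowSq A i / pU s i) := by
          have := rowSq_nonneg A i
          gcongr
      _ = (1 - 2 * (1 / 2 ^ z.m)) / pU s i * rowSq A i := by ring
      _ ≤ B := mul_le_mul_of_nonneg_right h3 (rowSq_nonneg A i)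
  set y := rowSq A i / pU s i with hy
  have hy0 : 0 ≤ y := div_nonneg (rowSq_nonneg A i) hupos.le
  -- Rounding costs a factor `1 - 2 η` and the error of the estimated norm a factor `1 - 5 η`; the
  -- slack `10 η` in the bound on `u_i` covers both.
  have hBθ : θ ≤ (1 - 5 * η) * B := by
    have h5 : (1 - 10 * η) * y ≤ (1 - 5 * η) * ((1 - 2 * η) * y) := by
      have : (1 - 10 * η) ≤ (1 - 5 * η) * (1 - 2 * η) := by nlinarith
      nlinarith
    have h6 : (1 - 5 * η) * ((1 - 2 * η) * y) ≤ (1 - 5 * η) * B :=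
      mul_le_mul_of_nonneg_left h2 (by linarith)
    linarith
  have hB0 : 0 ≤ B := mul_nonneg (sq_nonneg _) (rowSq_nonneg A i)
  have hFB : frobSq A ≤ η * B := by
    have h7 : θ ≤ B := by nlinarith
    have h8 : η * θ ≤ η * B := by gcongr
    have h9 : 0 ≤ frobSq A := Finset.sum_nonneg fun _ _ => sq_nonneg _
    linarith
  obtain ⟨h10, _⟩ := normSq_and_products_close hη hz.eta_le _ _ (pRow_close hz hk hg hlow hFB)
  rw [hBn] at h10
  have h11 := (abs_le.1 h10).1
  refine ⟨fun j => √(pU s i) * pRow s (pTable s A) i j, ?_⟩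
  unfold pOut
  rw [if_pos hg]
  refine pSample_eq_some_of_unique (by linarith) fun j hj => ?_
  refine (normSq_pRow_le hz hg j).trans_lt ?_
  have h12 := hother j hj
  have huj := pU_pos s j
  rw [not_le, div_lt_iff₀ hθ] at h12
  calc 4 * (pFactor s j ^ 2 * rowSq A j) ≤ 4 * (1 / pU s j * rowSq A j) := by
        have := pFactor_sq_le hz.m_ne s j
        have := rowSq_nonneg A j
        gcongr
    _ = 4 * rowSq A j / pU s j := by ring
    _ < θ := by rw [div_lt_iff₀ huj]; linarith

/-- Comparison of an observable of the outcome with the event that `u_i` is small. -/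
lemma abs_observable_sub_le (hz : SizeConditions n q k γ η z) (hk : IsSparse k A) (hθ : 0 < θ)
    (hθF : 4 * frobSq A ≤ η * θ) (s : PSeed z) (i : Fin n) {ω w₀ : ℝ} (hω : |ω| ≤ 1)
    (hw₀ : |w₀| ≤ 1)
    (hclose : isRow i (pOut A θ s) → lowNoise A η s i → |ω - w₀| ≤ 24 * η) :
    |ind (isRow i (pOut A θ s)) * ω - ind (pU s i ≤ (1 - 10 * η) * rowSq A i / θ) * w₀| ≤
      24 * η * ind (pU s i ≤ (1 + 5 * η) * rowSq A i / θ) +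
      (ind (pU s i ≤ (1 + 5 * η) * rowSq A i / θ) -
        ind (pU s i ≤ (1 - 10 * η) * rowSq A i / θ)) +
      2 * (ind (pU s i ≤ 4 * rowSq A i / θ) * ind (¬ lowNoise A η s i)) +
      ∑ j ∈ Finset.univ.erase i, ind (pU s i ≤ (1 - 10 * η) * rowSq A i / θ) *
        ind (pU s j ≤ 4 * rowSq A j / θ) + ind (¬ pGood A s) := by
  have hη := hz.eta_pos
  have hη' := hz.eta_le
  have hx := rowSq_nonneg A i
  have hmono : ∀ a b : ℝ, a ≤ b → ind (pU s i ≤ a * rowSq A i / θ) ≤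
      ind (pU s i ≤ b * rowSq A i / θ) := by
    intro a b hab
    apply ind_mono
    intro h
    refine h.trans ?_
    gcongr
  have hm1 := hmono (1 - 10 * η) (1 + 5 * η) (by linarith)
  have hm2 := hmono (1 - 10 * η) 4 (by linarith)
  have hm3 := hmono (1 + 5 * η) 4 (by linarith)
  set Im := ind (pU s i ≤ (1 - 10 * η) * rowSq A i / θ) with hIm
  set Ip := ind (pU s i ≤ (1 + 5 * η) * rowSq A i / θ) with hIp
  set I := ind (pU s i ≤ 4 * rowSq A i / θ) with hI
  have hIm0 : 0 ≤ Im := ind_nonneg _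
  have hIm1 : Im ≤ 1 := ind_le_one _
  have hIp0 : 0 ≤ Ip := ind_nonneg _
  have hIp1 : Ip ≤ 1 := ind_le_one _
  have hI0 : 0 ≤ I := ind_nonneg _
  have hN0 := ind_nonneg (¬ lowNoise A η s i)
  have hG0 := ind_nonneg (¬ pGood A s)
  have hJ0 : 0 ≤ ∑ j ∈ Finset.univ.erase i, Im * ind (pU s j ≤ 4 * rowSq A j / θ) :=
    Finset.sum_nonneg fun j _ => mul_nonneg hIm0 (ind_nonneg _)
  have hIN0 : 0 ≤ I * ind (¬ lowNoise A η s i) := mul_nonneg hI0 hN0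
  have hImw : |Im * w₀| ≤ Im := by
    rw [abs_mul, abs_of_nonneg hIm0]
    nlinarith
  have hηp : 0 ≤ 24 * η * Ip := by positivity
  -- The five terms on the right pay, in this order, for the direction error of a row sampled at low
  -- noise, for a `u_i` in the window between the two thresholds, for high noise, for a second row
  -- with small `u_j` (which may destroy uniqueness), and for inaccurate sketches.
  by_cases hrow : isRow i (pOut A θ s)
  · rw [ind_true hrow, one_mul]
    by_cases hlow : lowNoise A η s i
    · have h1 := hclose hrow hlow
      have h2 : Ip = 1 := ind_true (pOut_accurate hz hk hθ hθF hrow hlow).1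
      have h3 : |ω - Im * w₀| ≤ |ω - w₀| + (1 - Im) := by
        have e : ω - Im * w₀ = (ω - w₀) + (1 - Im) * w₀ := by ring
        rw [e]
        refine (abs_add_le _ _).trans ?_
        gcongr
        rw [abs_mul, abs_of_nonneg (by linarith : (0 : ℝ) ≤ 1 - Im)]
        nlinarith
      rw [h2]
      linarith
    · have h1 : I = 1 := ind_true (pU_le_of_pOut hz hθ hrow)
      have h2 := ind_true hlow
      have h3 : |ω - Im * w₀| ≤ 2 := by
        refine (abs_sub _ _).trans ?_
        linarith
      rw [h1, h2]
      linarith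
  · rw [ind_false hrow, zero_mul, zero_sub, abs_neg]
    by_cases hgood : pGood A s
    · by_cases hsmall : pU s i ≤ (1 - 10 * η) * rowSq A i / θ
      · have hIm' : Im = 1 := ind_true hsmall
        by_cases hlow : lowNoise A η s i
        · have : ∃ j, j ≠ i ∧ pU s j ≤ 4 * rowSq A j / θ := by
            by_contra hne
            push Not at hne
            exact hrow (isRow_pOut hz hk hθ hθF hgood hsmall hlow fun j hj => not_le.2 (hne j hj))
          obtain ⟨j, hj, hj'⟩ := this
          have h5 := Finset.single_le_sum (f := fun j => Im * ind (pU s j ≤ 4 * rowSq A j / θ))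
            (fun j _ => mul_nonneg hIm0 (ind_nonneg _))
            (Finset.mem_erase.2 ⟨hj, Finset.mem_univ j⟩)
          simp only [ind_true hj', mul_one] at h5
          linarith
        · have h1 : I = 1 := le_antisymm (ind_le_one _) (hIm' ▸ hm2)
          rw [ind_true hlow, h1]
          linarith
      · have : Im = 0 := ind_false hsmall
        linarith
    · rw [ind_true hgood]
      linarith

end Outcome


section OutcomeProbability

variable {n q k γ : ℕ} {η : ℝ} {z : Sizes} {A : Matrix (Fin n) (Fin n) ℤ}

/-! ### Probabilities of the outcomes -/

lemma val_lt_two_pow (hz : SizeConditions n q k γ η z) (i : Fin n) : i.val < 2 ^ z.m := by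
  have h1 := i.isLt
  have h2 := hz.sq_le
  nlinarith

lemma avg_ind_pU_le (hz : SizeConditions n q k γ η z) (i : Fin n) (x : ℝ) :
    avg (fun s : PSeed z => ind (pU s i ≤ x)) = unifCdf z.m x := by
  have hκ := hz.kappa_ge
  rw [← avg_ind_hashUnif_le hz.m_ne (by omega : 0 < z.κ) (val_lt_two_pow hz i) x]
  exact avg_fst fun h : HashSeed z.κ z.m => ind (hashUnif h i.val ≤ x)

lemma avg_ind_pU_mul_ind (hz : SizeConditions n q k γ η z) {i j : Fin n} (hij : j ≠ i) (x y : ℝ) :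
    avg (fun s : PSeed z => ind (pU s i ≤ x) * ind (pU s j ≤ y)) =
      unifCdf z.m x * unifCdf z.m y := by
  have hκ := hz.kappa_ge
  rw [← avg_ind_hashUnif_mul_ind hz.m_ne (by omega : 2 ≤ z.κ) (val_lt_two_pow hz i)
    (val_lt_two_pow hz j) (fun e => hij (Fin.ext e).symm) x y]
  exact avg_fst fun h : HashSeed z.κ z.m => ind (hashUnif h i.val ≤ x) * ind (hashUnif h j.val ≤ y)

lemma avg_ind_pU_mul_inv_le (hz : SizeConditions n q k γ η z) {i j : Fin n} (hij : j ≠ i) (x : ℝ) :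
    avg (fun s : PSeed z => ind (pU s i ≤ x) * (1 / pU s j)) ≤ unifCdf z.m x * (1 + z.m) := by
  have hκ := hz.kappa_ge
  refine le_trans (le_of_eq ?_) (avg_ind_hashUnif_mul_inv_le hz.m_ne (by omega : 2 ≤ z.κ)
    (val_lt_two_pow hz i) (val_lt_two_pow hz j) (fun e => hij (Fin.ext e).symm) x)
  exact avg_fst fun h : HashSeed z.κ z.m => ind (hashUnif h i.val ≤ x) * (1 / hashUnif h j.val)

lemma sum_erase_rowSq_le (A : Matrix (Fin n) (Fin n) ℤ) (i : Fin n) :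
    ∑ j ∈ Finset.univ.erase i, rowSq A j ≤ frobSq A := by
  rw [frobSq_eq_sum_rowSq]
  exact Finset.sum_le_sum_of_subset_of_nonneg (Finset.erase_subset _ _)
    fun j _ _ => rowSq_nonneg A j

lemma rowSq_le_frobSq (A : Matrix (Fin n) (Fin n) ℤ) (i : Fin n) : rowSq A i ≤ frobSq A := by
  rw [frobSq_eq_sum_rowSq]
  exact Finset.single_le_sum (fun j _ => rowSq_nonneg A j) (Finset.mem_univ i)

/-- Markov's inequality. By pairwise independence, restricting to `u_i ≤ x` multiplies the bound `F
(1 + m)` on the mean noise by at most `x`, and the threshold in `lowNoise` exceeds that bound by the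
factor `1 / η`. -/
lemma avg_noise_le (hz : SizeConditions n q k γ η z) (hF : 0 < frobSq A) (i : Fin n) {x : ℝ}
    (hx : 0 ≤ x) :
    avg (fun s : PSeed z => ind (pU s i ≤ x) * ind (¬ lowNoise A η s i)) ≤ η * x := by
  have hη := hz.eta_pos
  have hm : (0 : ℝ) < 1 + z.m := by positivity
  have h1 : ∀ s : PSeed z, ind (pU s i ≤ x) * ind (¬ lowNoise A η s i) ≤
      η / (frobSq A * (1 + z.m)) *
        ∑ j ∈ Finset.univ.erase i, rowSq A j * (ind (pU s i ≤ x) * (1 / pU s j)) := by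
    intro s
    have h2 : ∑ j ∈ Finset.univ.erase i, rowSq A j * (ind (pU s i ≤ x) * (1 / pU s j)) =
        ind (pU s i ≤ x) * ∑ j ∈ Finset.univ.erase i, rowSq A j / pU s j := by
      rw [Finset.mul_sum]
      exact Finset.sum_congr rfl fun j _ => by ring
    rw [h2]
    have hpos : 0 ≤ ∑ j ∈ Finset.univ.erase i, rowSq A j / pU s j :=
      Finset.sum_nonneg fun j _ => div_nonneg (rowSq_nonneg A j) (pU_pos s j).le
    have hI := ind_nonneg (pU s i ≤ x)
    by_cases hlow : lowNoise A η s i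
    · rw [ind_false (not_not.2 hlow), mul_zero]
      positivity
    · rw [ind_true hlow, mul_one]
      unfold lowNoise at hlow
      rw [not_le] at hlow
      calc ind (pU s i ≤ x) = η / (frobSq A * (1 + z.m)) *
            (ind (pU s i ≤ x) * (frobSq A * (1 + z.m) / η)) := by field_simp
        _ ≤ _ := by gcongr
  refine (avg_mono h1).trans ?_
  rw [avg_const_mul, avg_sum]
  have h3 : ∑ j ∈ Finset.univ.erase i, avg (fun s : PSeed z =>
      rowSq A j * (ind (pU s i ≤ x) * (1 / pU s j))) ≤
      ∑ j ∈ Finset.univ.erase i, rowSq A j * (x * (1 + z.m)) := by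
    refine Finset.sum_le_sum fun j hj => ?_
    rw [avg_const_mul]
    refine mul_le_mul_of_nonneg_left ?_ (rowSq_nonneg A j)
    refine (avg_ind_pU_mul_inv_le hz (Finset.mem_erase.1 hj).1 x).trans ?_
    gcongr
    exact unifCdf_le hx
  have h4 : ∑ j ∈ Finset.univ.erase i, rowSq A j * (x * (1 + z.m)) ≤
      frobSq A * (x * (1 + z.m)) := by
    rw [← Finset.sum_mul]
    gcongr
    exact sum_erase_rowSq_le A i
  calc η / (frobSq A * (1 + z.m)) * _ ≤ η / (frobSq A * (1 + z.m)) *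
        (frobSq A * (x * (1 + z.m))) := by
        gcongr
        exact h3.trans h4
    _ = η * x := by field_simp

/-- Integrality of the entries; it bounds the sampling probabilities of non-zero rows from below. -/
lemma one_le_rowSq {i : Fin n} (h : 0 < rowSq A i) : 1 ≤ rowSq A i := by
  have h1 : rowSq A i = ((∑ j, A i j ^ 2 : ℤ) : ℝ) := by unfold rowSq; push_cast; rfl
  rw [h1] at h ⊢
  exact_mod_cast h

lemma frobSq_le (hA : ∀ i j, |A i j| ≤ (n : ℤ) ^ γ) : frobSq A ≤ (n : ℝ) ^ (2 * γ + 2) := by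
  have h1 : frobSq A ≤ ∑ _p : Fin n × Fin n, (n : ℝ) ^ (2 * γ) := by
    refine Finset.sum_le_sum fun p _ => ?_
    have h2 : |(A p.1 p.2 : ℝ)| ≤ (n : ℝ) ^ γ := by exact_mod_cast hA p.1 p.2
    rw [← sq_abs, mul_comm 2 γ, pow_mul]
    gcongr
  refine h1.trans (le_of_eq ?_)
  simp
  ring

/-- Assumptions on the estimate `L` of `‖A‖_F²` and the threshold `θ`. -/
structure NormEstimate (A : Matrix (Fin n) (Fin n) ℤ) (η L θ : ℝ) : Prop where
  frob_pos : 0 < frobSq A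
  close : |L - frobSq A| ≤ η * frobSq A
  theta_eq : θ = 8 / η * L

variable {L θ : ℝ}

lemma NormEstimate.half_le (hL : NormEstimate A η L θ) (hz : SizeConditions n q k γ η z) :
    frobSq A / 2 ≤ L := by
  have h1 := (abs_le.1 hL.close).1
  have h2 := hz.eta_le
  have h3 := hL.frob_pos
  nlinarith

lemma NormEstimate.theta_lower (hL : NormEstimate A η L θ) (hz : SizeConditions n q k γ η z) :
    4 * frobSq A ≤ η * θ := by
  have h1 := hL.half_le hz
  have h2 := hz.eta_pos
  rw [hL.theta_eq]
  have : η * (8 / η * L) = 8 * L := by field_simp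
  linarith

lemma NormEstimate.theta_pos (hL : NormEstimate A η L θ) (hz : SizeConditions n q k γ η z) :
    0 < θ := by
  have h1 := hL.theta_lower hz
  have h2 := hz.eta_pos
  have h3 := hL.frob_pos
  by_contra h
  push Not at h
  nlinarith

lemma NormEstimate.theta_upper (hL : NormEstimate A η L θ) (hz : SizeConditions n q k γ η z) :
    η * θ ≤ 9 * frobSq A := by
  have h1 := (abs_le.1 hL.close).2
  have h2 := hz.eta_pos
  have h3 := hz.eta_le
  have h4 := hL.frob_pos
  rw [hL.theta_eq]
  have : η * (8 / η * L) = 8 * L := by field_simp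
  nlinarith

/-- The average of an observable of the outcome that is close to `w₀` when row `i` is sampled. -/
lemma abs_avg_observable_sub_le (hz : SizeConditions n q k γ η z) (hk : IsSparse k A)
    (hA : ∀ i j, |A i j| ≤ (n : ℤ) ^ γ) (hL : NormEstimate A η L θ) (i : Fin n)
    {ω : PSeed z → ℝ} {w₀ : ℝ} (hω : ∀ s, |ω s| ≤ 1) (hw₀ : |w₀| ≤ 1)
    (hclose : ∀ s, 0 < rowSq A i → isRow i (pOut A θ s) → lowNoise A η s i →
      |ω s - w₀| ≤ 24 * η) :
    |avg (fun s => ind (isRow i (pOut A θ s)) * ω s) - rowSq A i / θ * w₀| ≤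
      85 * η * (rowSq A i / θ) := by
  have hη := hz.eta_pos
  have hη' := hz.eta_le
  have hθ := hL.theta_pos hz
  have hθF := hL.theta_lower hz
  have hFpos := hL.frob_pos
  rcases (rowSq_nonneg A i).eq_or_lt with h0 | hpos
  -- A zero row is never sampled, as that would force `u_i ≤ 0`.
  · have h1 : ∀ s : PSeed z, ind (isRow i (pOut A θ s)) * ω s = 0 := by
      intro s
      rw [ind_false, zero_mul]
      intro hr
      have h2 := pU_le_of_pOut hz hθ hr
      rw [← h0] at h2
      have h3 := pU_pos s i
      simp at h2
      linarith
    rw [avg_congr h1, avg_zero, ← h0]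
    simp
  · set p := rowSq A i / θ with hp
    have hppos : 0 < p := div_pos hpos hθ
    have hFn := frobSq_le hA
    -- small quantities
    have hsmall : ∀ x : ℝ, 0 ≤ x → x * (9 * (n : ℝ) ^ (2 * γ + 2)) ≤ η ^ 2 → x ≤ η * p := by
      intro x hx hxn
      have h1 : η * θ ≤ 9 * (n : ℝ) ^ (2 * γ + 2) := by
        have := hL.theta_upper hz
        linarith
      have h2 : x * (η * θ) ≤ η ^ 2 := (mul_le_mul_of_nonneg_left h1 hx).trans hxn
      have h3 : x * θ ≤ η := by
        have : η * (x * θ) ≤ η * η := by linarith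
        exact le_of_mul_le_mul_left this hη
      rw [hp, mul_div_assoc', le_div_iff₀ hθ]
      have := one_le_rowSq hpos
      nlinarith
    have hδm := hsmall _ (by positivity) hz.precision
    have hδ := hsmall _ (by positivity) hz.fail
    have hp1 : p ≤ 1 := by
      rw [hp, div_le_one hθ]
      have := rowSq_le_frobSq A i
      nlinarith
    have hbad := avg_not_pGood_le hz hA hFpos
    have hpt := fun s => abs_observable_sub_le hz hk hθ hθF s i (hω s) hw₀ (hclose s hpos)
    have e : ∀ a : ℝ, a * rowSq A i / θ = a * p := fun a => by rw [hp, mul_div_assoc]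
    simp only [e] at hpt
    -- averages of the terms
    have hup := fun x (hx : (0 : ℝ) ≤ x) => unifCdf_le (m := z.m) hx
    have c1 := hup ((1 + 5 * η) * p) (by positivity)
    have c2 : (1 - 10 * η) * p - 1 / 2 ^ z.m ≤ unifCdf z.m ((1 - 10 * η) * p) := by
      apply le_unifCdf
      nlinarith
    have c3 := hup ((1 - 10 * η) * p) (mul_nonneg (by linarith) hppos.le)
    have hnoise := avg_noise_le hz hFpos i (x := 4 * p) (by positivity)
    -- The chance of a second row with small `u_j` is at most `4 F / θ ≤ η`, and pairwise
    -- independence multiplies it by the chance that `u_i` is small.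
    have hcoll : ∑ j ∈ Finset.univ.erase i,
        unifCdf z.m ((1 - 10 * η) * p) * unifCdf z.m (4 * rowSq A j / θ) ≤ η * p := by
      have h1 : ∑ j ∈ Finset.univ.erase i,
          unifCdf z.m ((1 - 10 * η) * p) * unifCdf z.m (4 * rowSq A j / θ) ≤
          ∑ j ∈ Finset.univ.erase i, p * (4 * rowSq A j / θ) := by
        refine Finset.sum_le_sum fun j _ => ?_
        refine mul_le_mul ?_ (hup _ ?_) (unifCdf_nonneg _) hppos.le
        · nlinarith
        · have := rowSq_nonneg A j
          positivity
      refine h1.trans ?_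
      have h2 : ∑ j ∈ Finset.univ.erase i, p * (4 * rowSq A j / θ) =
          p * (4 / θ) * ∑ j ∈ Finset.univ.erase i, rowSq A j := by
        rw [Finset.mul_sum]
        exact Finset.sum_congr rfl fun j _ => by ring
      rw [h2]
      calc p * (4 / θ) * ∑ j ∈ Finset.univ.erase i, rowSq A j ≤ p * (4 / θ) * frobSq A := by
            gcongr
            exact sum_erase_rowSq_le A i
        _ = p * (4 * frobSq A / θ) := by ring
        _ ≤ p * η := by
            gcongr
            rw [div_le_iff₀ hθ]
            exact hθF
        _ = η * p := mul_comm _ _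
    have havg := (abs_avg_le _).trans (avg_mono hpt)
    rw [avg_sub, avg_mul_const] at havg
    simp only [avg_add, avg_sub, avg_const_mul, avg_sum] at havg
    rw [Finset.sum_congr rfl fun j hj => avg_ind_pU_mul_ind hz (Finset.mem_erase.1 hj).1
      ((1 - 10 * η) * p) (4 * rowSq A j / θ)] at havg
    rw [avg_ind_pU_le hz, avg_ind_pU_le hz] at havg
    have hfin : |unifCdf z.m ((1 - 10 * η) * p) * w₀ - p * w₀| ≤ 11 * η * p := by
      rw [← sub_mul, abs_mul]
      have h1 : |unifCdf z.m ((1 - 10 * η) * p) - p| ≤ 11 * η * p := by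
        rw [abs_le]
        constructor <;> nlinarith
      calc _ ≤ (11 * η * p) * 1 := by gcongr
        _ = _ := mul_one _
    have htri := abs_sub_le (avg fun s : PSeed z => ind (isRow i (pOut A θ s)) * ω s)
      (unifCdf z.m ((1 - 10 * η) * p) * w₀) (p * w₀)
    -- In units of `η * p`: 48 for the direction, 16 for the window between the thresholds, 8 for
    -- noise, 1 for collisions, 1 for inaccurate sketches, and 11 for replacing the distribution
    -- function by `p`; in total 85.
    have c1' : unifCdf z.m ((1 + 5 * η) * p) ≤ 2 * p := by nlinarith
    have c4 : 24 * η * unifCdf z.m ((1 + 5 * η) * p) ≤ 24 * η * (2 * p) := by gcongr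
    nlinarith

/-! ### The first successful repetition -/

/-- The outcome of the first successful repetition. -/
noncomputable def sOut (A : Matrix (Fin n) (Fin n) ℤ) (θ : ℝ) (ω : Fin z.R → PSeed z) :
    Option (Fin n × (Fin n → ℝ)) :=
  (List.finRange z.R).findSome? fun r => pOut A θ (ω r)

lemma sOut_support (hz : SizeConditions n q k γ η z) {ω : Fin z.R → PSeed z}
    {x : Fin n × (Fin n → ℝ)} (h : sOut A θ ω = some x) {j : Fin n} (hj : A x.1 j = 0) :
    x.2 j = 0 := by
  obtain ⟨r, _, hr⟩ := List.exists_of_findSome?_eq_some h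
  exact pOut_support hz hr hj

lemma sum_ind_isRow (o : Option (Fin n × (Fin n → ℝ))) :
    ∑ i, ind (isRow i o) = ind (o ≠ none) := by
  rcases o with _ | x
  · rw [ind_false (by simp)]
    exact Finset.sum_eq_zero fun i _ => ind_false (by rintro ⟨v, hv⟩; simp at hv)
  · rw [ind_true (by simp), Finset.sum_eq_single x.1]
    · exact ind_true ⟨x.2, rfl⟩
    · intro i _ hi
      refine ind_false ?_
      rintro ⟨v, hv⟩
      simp only [Option.some.injEq] at hv
      exact hi (by rw [hv])
    · simp

/-- The factor by which repetition increases the probability of an outcome. -/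
lemma exists_repetition_factor (hz : SizeConditions n q k γ η z) (hk : IsSparse k A)
    (hA : ∀ i j, |A i j| ≤ (n : ℤ) ^ γ) (hL : NormEstimate A η L θ) :
    ∃ G : ℝ, |G * (frobSq A / θ) - 1| ≤ 170 * η ∧
      ∀ ψ : Option (Fin n × (Fin n → ℝ)) → ℝ, ψ none = 0 →
        avg (fun ω : Fin z.R → PSeed z => ψ (sOut A θ ω)) =
          avg (fun s : PSeed z => ψ (pOut A θ s)) * G := by
  have hη := hz.eta_pos
  have hη' := hz.eta_le
  have hθ := hL.theta_pos hz
  have hFpos := hL.frob_pos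
  set π := avg fun s : PSeed z => ind (pOut A θ s ≠ none) with hπ
  set P := frobSq A / θ with hP
  have hPpos : 0 < P := div_pos hFpos hθ
  refine ⟨∑ r ∈ Finset.range z.R, (1 - π) ^ r, ?_, fun ψ hψ => avg_findSome z.R _ ψ hψ⟩
  -- The success probability is the sum of the probabilities of the individual rows. Their errors
  -- are proportional to `rowSq`, so they add up to a relative error.
  have hπP : |π - P| ≤ 85 * η * P := by
    have h1 : π = ∑ i, avg (fun s : PSeed z => ind (isRow i (pOut A θ s)) * 1) := by
      rw [hπ, ← avg_sum]
      apply avg_congr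
      intro s
      rw [← sum_ind_isRow]
      simp
    have h2 : P = ∑ i, rowSq A i / θ * 1 := by
      rw [hP, frobSq_eq_sum_rowSq, Finset.sum_div]
      simp
    have h3 : 85 * η * P = ∑ i, 85 * η * (rowSq A i / θ) := by
      rw [← Finset.mul_sum, ← Finset.sum_div, ← frobSq_eq_sum_rowSq]
    rw [h3, h1, h2, ← Finset.sum_sub_distrib]
    refine (Finset.abs_sum_le_sum_abs _ _).trans (Finset.sum_le_sum fun i _ => ?_)
    exact abs_avg_observable_sub_le hz hk hA hL i (fun _ => by simp) (by simp)
      fun s _ _ _ => by simp; positivity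
  have hπP' := abs_le.1 hπP
  have hπ1 : π ≤ 1 := avg_ind_le_one _
  have hπlow : P / 2 ≤ π := by nlinarith
  have hπpos : 0 < π := by linarith
  -- `G * π` is the probability that some repetition succeeds, which is nearly `1`; hence `G` is
  -- nearly `1 / π`, that is, `θ / F`.
  have hgeom : (∑ r ∈ Finset.range z.R, (1 - π) ^ r) * π = 1 - (1 - π) ^ z.R := by
    have := geom_sum_mul (1 - π) z.R
    linarith
  have hfail : (1 - π) ^ z.R ≤ η := by
    have h1 : η / 32 ≤ π := by
      have h2 := hL.theta_upper hz
      have : η / 9 ≤ P := by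
        rw [hP, div_le_div_iff₀ (by norm_num) hθ]
        linarith
      linarith
    calc (1 - π) ^ z.R ≤ (Real.exp (-π)) ^ z.R := by
          have : 0 ≤ 1 - π := by linarith
          gcongr
          have := Real.add_one_le_exp (-π)
          linarith
      _ = Real.exp (-(π * z.R)) := by rw [← Real.exp_nat_mul]; ring_nf
      _ ≤ Real.exp (-(η * z.R / 32)) := by
          apply Real.exp_le_exp.2
          have hR : (0 : ℝ) ≤ z.R := by positivity
          nlinarith
      _ ≤ η := hz.R_large
  have hfail0 : 0 ≤ (1 - π) ^ z.R := pow_nonneg (by linarith) _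
  set G := ∑ r ∈ Finset.range z.R, (1 - π) ^ r with hG
  have hG0 : 0 ≤ G := Finset.sum_nonneg fun r _ => pow_nonneg (by linarith) _
  have hGP0 : 0 ≤ G * P := by positivity
  have hGπ : |G * π - G * P| ≤ 85 * η * (G * P) := by
    rw [← mul_sub, abs_mul, abs_of_nonneg hG0]
    calc G * |π - P| ≤ G * (85 * η * P) := by gcongr
      _ = _ := by ring
  have h5 := abs_le.1 hGπ
  rw [abs_le]
  constructor <;> nlinarith

/-- The expected contribution of row `i` to a sample. -/
lemma abs_avg_sample_sub_le (hz : SizeConditions n q k γ η z) (hk : IsSparse k A)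
    (hA : ∀ i j, |A i j| ≤ (n : ℤ) ^ γ) (hL : NormEstimate A η L θ) (i c c' : Fin n) :
    |avg (fun ω : Fin z.R → PSeed z => ind (isRow i (sOut A θ ω)) *
      (L * dirProd c c' (sOut A θ ω))) - A i c * A i c'| ≤ 350 * η * rowSq A i := by
  obtain ⟨G, hG, hGavg⟩ := exists_repetition_factor (z := z) hz hk hA hL
  have hη := hz.eta_pos
  have hη' := hz.eta_le
  have hθ := hL.theta_pos hz
  have hFpos := hL.frob_pos
  set w₀ : ℝ := A i c * A i c' / rowSq A i with hw₀
  have hrow : normSq (fun j => (A i j : ℝ)) = rowSq A i := normSq_eq_sum _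
  have hw₀1 : |w₀| ≤ 1 := by
    have := abs_mul_div_normSq_le_one (fun j => (A i j : ℝ)) c c'
    rwa [hrow] at this
  have hAw : (A i c : ℝ) * A i c' = rowSq A i * w₀ := by
    rcases (rowSq_nonneg A i).eq_or_lt with h0 | hpos
    · have := abs_mul_le_normSq (fun j => (A i j : ℝ)) c c'
      rw [hrow, ← h0] at this
      rw [← h0, zero_mul]
      exact abs_eq_zero.1 (le_antisymm this (abs_nonneg _))
    · rw [hw₀]; field_simp
  have h1 := abs_avg_observable_sub_le (z := z) hz hk hA hL i
    (ω := fun s => dirProd c c' (pOut A θ s)) (w₀ := w₀) (fun s => abs_dirProd_le_one _ _ _) hw₀1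
    fun s hpos hr hlow => (pOut_accurate hz hk hθ (hL.theta_lower hz) hr hlow).2 c c' hpos
  have h2 := hGavg (fun o => ind (isRow i o) * (L * dirProd c c' o)) (by simp [dirProd])
  rw [h2]
  have h3 : avg (fun s : PSeed z => ind (isRow i (pOut A θ s)) * (L * dirProd c c' (pOut A θ s))) =
      L * avg (fun s : PSeed z => ind (isRow i (pOut A θ s)) * dirProd c c' (pOut A θ s)) := by
    rw [← avg_const_mul]
    exact avg_congr fun s => by ring
  rw [h3, hAw]
  set E := avg (fun s : PSeed z => ind (isRow i (pOut A θ s)) * dirProd c c' (pOut A θ s))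
  set F := frobSq A with hF
  set x := rowSq A i
  have hx : 0 ≤ x := rowSq_nonneg A i
  -- write everything in terms of the dimensionless quantities
  set g := G * (F / θ) with hg
  set l := L / F with hl
  have hl1 : |l - 1| ≤ η := by
    rw [hl, div_sub_one hFpos.ne', abs_div, abs_of_pos hFpos, div_le_iff₀ hFpos]
    exact hL.close
  set e := E * θ with he
  have he1 : |e - x * w₀| ≤ 85 * η * x := by
    have : e - x * w₀ = (E - x / θ * w₀) * θ := by rw [he]; field_simp
    rw [this, abs_mul, abs_of_pos hθ]
    calc _ ≤ (85 * η * (x / θ)) * θ := by gcongr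
      _ = _ := by field_simp
  have hmain : L * E * G - x * w₀ = l * g * (e - x * w₀) + (l * g - 1) * (x * w₀) := by
    have : L * E * G = l * g * e := by
      rw [hl, hg, he]
      field_simp
    rw [this]; ring
  have hlg : |l * g - 1| ≤ 172 * η := by
    have : l * g - 1 = (l - 1) * (g - 1) + (l - 1) + (g - 1) := by ring
    rw [this]
    refine (abs_add_three _ _ _).trans ?_
    rw [abs_mul]
    have : |l - 1| * |g - 1| ≤ η * (170 * η) := by gcongr
    nlinarith
  have hlg2 : |l * g| ≤ 2 := by
    have := abs_le.1 hlg
    rw [abs_le]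
    constructor <;> linarith
  rw [hmain]
  refine (abs_add_le _ _).trans ?_
  rw [abs_mul, abs_mul (l * g - 1), abs_mul x, abs_of_nonneg hx]
  -- The two parts contribute `2 · 85 = 170` and `172`, together below `350`.
  have h6 : |l * g| * |e - x * w₀| ≤ 2 * (85 * η * x) := by gcongr
  have h7 : |l * g - 1| * (x * |w₀|) ≤ 172 * η * (x * 1) := by gcongr
  have h8 : 0 ≤ η * x := by positivity
  linarith

/-- The probability that row `i` is sampled. -/
lemma avg_ind_isRow_sOut_le (hz : SizeConditions n q k γ η z) (hk : IsSparse k A)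
    (hA : ∀ i j, |A i j| ≤ (n : ℤ) ^ γ) (hL : NormEstimate A η L θ) (i : Fin n) :
    avg (fun ω : Fin z.R → PSeed z => ind (isRow i (sOut A θ ω))) ≤
      2 * (rowSq A i / frobSq A) := by
  obtain ⟨G, hG, hGavg⟩ := exists_repetition_factor (z := z) hz hk hA hL
  have hη := hz.eta_pos
  have hη' := hz.eta_le
  have hθ := hL.theta_pos hz
  have hFpos := hL.frob_pos
  have h1 := abs_avg_observable_sub_le (z := z) hz hk hA hL i (ω := fun _ => 1) (w₀ := 1)
    (fun s => by simp) (by simp) fun s _ _ _ => by simp; positivity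
  simp only [mul_one] at h1
  rw [hGavg (fun o => ind (isRow i o)) (ind_false (by rintro ⟨v, hv⟩; simp at hv))]
  set E := avg (fun s : PSeed z => ind (isRow i (pOut A θ s)))
  set F := frobSq A with hF
  have hx := rowSq_nonneg A i
  set x := rowSq A i
  have hE : E ≤ (1 + 85 * η) * (x / θ) := by linarith [(abs_le.1 h1).2]
  have hG' := (abs_le.1 hG).2
  have hG1 := (abs_le.1 hG).1
  have hG0 : 0 ≤ G := by
    by_contra h
    push Not at h
    have : G * (F / θ) < 0 := mul_neg_of_neg_of_pos h (by positivity)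
    linarith
  calc E * G ≤ ((1 + 85 * η) * (x / θ)) * G := by gcongr
    _ = (1 + 85 * η) * (G * (F / θ)) * (x / F) := by field_simp
    _ ≤ (1 + 85 * η) * (1 + 170 * η) * (x / F) := by
        gcongr
        linarith
    _ ≤ 2 * (x / F) := by
        gcongr
        nlinarith

end OutcomeProbability


/-! ## Cyclic products and Schatten norms -/

section Cyclic

variable {n q : ℕ}

/-- The sum over closed walks `c` of the products of the entries of matrices `M_f`. -/
noncomputable def cyclicSum (M : Fin q → Fin n → Fin n → ℝ) : ℝ :=
  ∑ c : Fin q → Fin n, ∏ f, M f (c ((finRotate q).symm f)) (c f)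

/-- Sums of cyclic products of inner products are sums over closed walks. -/
lemma sum_prod_dotProduct_eq_cyclicSum {β : Type*} [DecidableEq β] (S : Fin q → Finset β)
    (u : Fin q → β → Fin n → ℝ) (coef : Fin q → β → ℝ) :
    ∑ l ∈ Fintype.piFinset S,
      (∏ f, u f (l f) ⬝ᵥ u (finRotate q f) (l (finRotate q f))) * ∏ f, coef f (l f) =
      cyclicSum fun f c c' => ∑ l ∈ S f, coef f l * (u f l c * u f l c') := by
  have h1 : ∀ l : Fin q → β, (∏ f, u f (l f) ⬝ᵥ u (finRotate q f) (l (finRotate q f))) =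
      ∑ c : Fin q → Fin n, ∏ f, u f (l f) (c ((finRotate q).symm f)) * u f (l f) (c f) := by
    intro l
    simp only [dotProduct]
    rw [Finset.prod_univ_sum, Fintype.piFinset_univ]
    refine Finset.sum_congr rfl fun c _ => ?_
    rw [Finset.prod_mul_distrib, Finset.prod_mul_distrib, mul_comm]
    congr 1
    -- The column index `c f` belongs to the inner product of the rows `f` and `f + 1`. Shifting the
    -- second group of factors by one collects everything about row `f` at the indices `c (f - 1)`
    -- and `c f`.
    rw [← Equiv.prod_comp (finRotate q) fun f => u f (l f) (c ((finRotate q).symm f))]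
    simp only [Equiv.symm_apply_apply]
  simp only [h1, Finset.sum_mul]
  unfold cyclicSum
  rw [Finset.sum_comm]
  refine Finset.sum_congr rfl fun c _ => ?_
  rw [Finset.prod_univ_sum]
  refine Finset.sum_congr rfl fun l _ => ?_
  rw [← Finset.prod_mul_distrib]
  exact Finset.prod_congr rfl fun f _ => mul_comm _ _

lemma exists_finRotate_iterate_eq (f₀ f : Fin q) : ∃ r ≤ q, ((finRotate q)^[r]) f₀ = f := by
  rcases q with _ | q
  · exact f.elim0
  · have h : ∀ r : ℕ, (((finRotate (q + 1))^[r]) f₀).val = (f₀.val + r) % (q + 1) := by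
      intro r
      induction r with
      | zero => simp [Nat.mod_eq_of_lt f₀.isLt]
      | succ r ih =>
        rw [Function.iterate_succ_apply', finRotate_apply, Fin.val_add, ih, ← Nat.add_assoc]
        simp [Nat.add_mod]
    have h1 := f₀.isLt
    have h2 := f.isLt
    by_cases hle : f₀.val ≤ f.val
    · refine ⟨f.val - f₀.val, by omega, Fin.ext ?_⟩
      rw [h, Nat.add_sub_cancel' hle, Nat.mod_eq_of_lt h2]
    · refine ⟨f.val + (q + 1) - f₀.val, by omega, Fin.ext ?_⟩
      rw [h, Nat.add_sub_cancel' (by omega), Nat.add_mod_right, Nat.mod_eq_of_lt h2]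

/-- The Gram matrix of the columns of an integer matrix. -/
noncomputable def colGram (A : Matrix (Fin n) (Fin n) ℤ) (c c' : Fin n) : ℝ :=
  ∑ i, (A i c : ℝ) * A i c'

/-- The singular value decomposition of the Gram matrix. -/
lemma exists_spectral_decomposition (A : Matrix (Fin n) (Fin n) ℤ) :
    ∃ (ev : Fin n → ℝ) (v : Fin n → Fin n → ℝ), (∀ l, 0 ≤ ev l) ∧
      (∀ l l', v l ⬝ᵥ v l' = if l = l' then 1 else 0) ∧ (∀ c, ∑ l, v l c ^ 2 = 1) ∧
      (∀ c c', colGram A c c' = ∑ l, ev l * (v l c * v l c')) ∧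
      ∀ q : ℕ, schattenPow (2 * q) (A.map (Int.cast : ℤ → ℝ)) = ∑ l, ev l ^ q := by
  set T := Matrix.toEuclideanLin (A.map (Int.cast : ℤ → ℝ)) with hT
  have hn : Module.finrank ℝ (EuclideanSpace ℝ (Fin n)) = n := by simp
  have hS := T.isSymmetric_adjoint_comp_self
  set b := hS.eigenvectorBasis hn with hb
  have hinner : ∀ x y : EuclideanSpace ℝ (Fin n), inner ℝ x y = ∑ c, x c * y c := by
    intro x y
    simp [PiLp.inner_apply, mul_comm]
  have hTe : ∀ c i, T (EuclideanSpace.single c (1 : ℝ)) i = A i c := by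
    intro c i
    simp [hT, Matrix.toLpLin_apply]
  refine ⟨hS.eigenvalues hn, fun l c => b l c, ?_, ?_, ?_, ?_, ?_⟩
  · exact fun l => T.isPositive_adjoint_comp_self.nonneg_eigenvalues hn l
  · intro l l'
    have := orthonormal_iff_ite.1 b.orthonormal l l'
    rw [hinner] at this
    exact this
  · intro c
    have := b.sum_sq_norm_inner_right (EuclideanSpace.single c (1 : ℝ))
    simpa [EuclideanSpace.inner_single_right] using this
  · intro c c'
    have h1 : colGram A c c' = inner ℝ (T (EuclideanSpace.single c (1 : ℝ)))
        (T (EuclideanSpace.single c' (1 : ℝ))) := by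
      rw [hinner]
      simp only [hTe]
      rfl
    have h2 : inner ℝ (T (EuclideanSpace.single c (1 : ℝ)))
        (T (EuclideanSpace.single c' (1 : ℝ))) =
        inner ℝ (EuclideanSpace.single c (1 : ℝ))
          ((LinearMap.adjoint T ∘ₗ T) (EuclideanSpace.single c' (1 : ℝ))) := by
      rw [LinearMap.comp_apply, LinearMap.adjoint_inner_right]
    rw [h1, h2, ← b.sum_inner_mul_inner]
    refine Finset.sum_congr rfl fun l _ => ?_
    have h3 : inner ℝ (b l) ((LinearMap.adjoint T ∘ₗ T) (EuclideanSpace.single c' (1 : ℝ))) =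
        hS.eigenvalues hn l * inner ℝ (b l) (EuclideanSpace.single c' (1 : ℝ)) := by
      rw [← hS, hb, hS.apply_eigenvectorBasis hn l, inner_smul_left]
      simp
    rw [h3]
    simp [EuclideanSpace.inner_single_left, EuclideanSpace.inner_single_right]
    ring
  · intro q
    unfold schattenPow
    rw [Finset.sum_range]
    refine Finset.sum_congr rfl fun l _ => ?_
    rw [pow_mul, LinearMap.sq_singularValues_fin T hn l]

/-- The Schatten norm is a sum over closed walks. -/
lemma schattenPow_eq_cyclicSum (hq : 0 < q) (A : Matrix (Fin n) (Fin n) ℤ) :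
    schattenPow (2 * q) (A.map (Int.cast : ℤ → ℝ)) = cyclicSum (q := q) fun _ => colGram A := by
  classical
  obtain ⟨ev, v, _, hv, _, hN, hsch⟩ := exists_spectral_decomposition A
  rw [hsch q]
  have h1 : (fun (_ : Fin q) => colGram A) =
      fun _ c c' => ∑ l ∈ (Finset.univ : Finset (Fin n)), ev l * (v l c * v l c') := by
    funext _ c c'
    exact hN c c'
  -- Read backwards, the identity for sums of inner products turns the cyclic sum into one over
  -- sequences of eigenvectors. By orthonormality only constant sequences survive, each contributing
  -- `ev l ^ q`.
  rw [h1, ← sum_prod_dotProduct_eq_cyclicSum (fun _ : Fin q => (Finset.univ : Finset (Fin n)))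
    (fun _ l => v l) (fun _ l => ev l), Fintype.piFinset_univ]
  set f₀ : Fin q := ⟨0, hq⟩
  symm
  have h2 : ∑ l : Fin n, ev l ^ q = ∑ l ∈ (Finset.univ : Finset (Fin n)).map
      ⟨fun (l : Fin n) (_ : Fin q) => l, fun l l' h => congrFun h f₀⟩,
      (∏ f, v (l f) ⬝ᵥ v (l (finRotate q f))) * ∏ f, ev (l f) := by
    rw [Finset.sum_map]
    refine Finset.sum_congr rfl fun l _ => ?_
    show ev l ^ q = (∏ _f : Fin q, v l ⬝ᵥ v l) * ∏ _f : Fin q, ev l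
    simp [hv]
  rw [h2]
  symm
  apply Finset.sum_subset (Finset.subset_univ _)
  intro l _ hl
  have h3 : ∃ f, l f ≠ l (finRotate q f) := by
    by_contra hne
    push Not at hne
    apply hl
    rw [Finset.mem_map]
    refine ⟨l f₀, Finset.mem_univ _, ?_⟩
    funext f
    obtain ⟨r, _, rfl⟩ := exists_finRotate_iterate_eq f₀ f
    have : ∀ r : ℕ, l f₀ = l (((finRotate q)^[r]) f₀) := by
      intro r
      induction r with
      | zero => rfl
      | succ r ih => rw [Function.iterate_succ_apply', ← hne, ih]
    exact this r
  obtain ⟨f, hf⟩ := h3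
  rw [Finset.prod_eq_zero (Finset.mem_univ f), zero_mul]
  rw [hv, if_neg hf]

/-- Powers of the diagonal entries of the Gram matrix are dominated by the Schatten norm. -/
lemma sum_colGram_pow_le_schattenPow (A : Matrix (Fin n) (Fin n) ℤ) (q : ℕ) :
    ∑ c, colGram A c c ^ q ≤ schattenPow (2 * q) (A.map (Int.cast : ℤ → ℝ)) := by
  obtain ⟨ev, v, hev, hv, hv1, hN, hsch⟩ := exists_spectral_decomposition A
  rw [hsch q]
  have h1 : ∀ c, colGram A c c ^ q ≤ ∑ l, v l c ^ 2 * ev l ^ q := by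
    intro c
    have h2 : colGram A c c = ∑ l, v l c ^ 2 * ev l := by
      rw [hN]
      exact Finset.sum_congr rfl fun l _ => by ring
    rw [h2]
    -- Jensen's inequality: the weights `v l c ^ 2` sum to `1` over `l`, so a diagonal entry is a
    -- convex combination of eigenvalues.
    exact Real.pow_arith_mean_le_arith_mean_pow _ _ _ (fun l _ => sq_nonneg _) (hv1 c)
      (fun l _ => hev l) q
  refine (Finset.sum_le_sum fun c _ => h1 c).trans (le_of_eq ?_)
  rw [Finset.sum_comm]
  refine Finset.sum_congr rfl fun l _ => ?_
  rw [← Finset.sum_mul]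
  have h3 : ∑ c, v l c ^ 2 = 1 := by
    have := hv l l
    simp only [dotProduct, if_true] at this
    rw [← this]
    exact Finset.sum_congr rfl fun c _ => by ring
  rw [h3, one_mul]

end Cyclic


/-! ## Counting closed walks -/

section Walks

variable {n q : ℕ}

/-- A closed walk with respect to a relation. -/
def IsClosedWalk (adj : Fin n → Fin n → Prop) (c : Fin q → Fin n) : Prop :=
  ∀ f, adj (c ((finRotate q).symm f)) (c f)

open Classical in
/-- The vertices that are reached from `v` by `r` steps. -/
noncomputable def walkBall (adj : Fin n → Fin n → Prop) (v : Fin n) : ℕ → Finset (Fin n)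
  | 0 => {v}
  | r + 1 => (walkBall adj v r).biUnion fun u => Finset.univ.filter fun u' => adj u u'

variable {adj : Fin n → Fin n → Prop} {Δ : ℕ}

open Classical in
lemma card_walkBall_le (hdeg : ∀ u, (Finset.univ.filter fun u' => adj u u').card ≤ Δ)
    (v : Fin n) (r : ℕ) : (walkBall adj v r).card ≤ Δ ^ r := by
  induction r with
  | zero => simp [walkBall]
  | succ r ih =>
    refine (Finset.card_biUnion_le_card_mul _ _ Δ fun u _ => hdeg u).trans ?_
    rw [pow_succ]
    exact Nat.mul_le_mul_right _ ih

lemma walkBall_mono (hrefl : ∀ u, adj u u) (v : Fin n) {r r' : ℕ} (h : r ≤ r') :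
    walkBall adj v r ⊆ walkBall adj v r' := by
  induction h with
  | refl => exact Finset.Subset.refl _
  | step _ ih =>
    refine ih.trans fun u hu => ?_
    simp only [walkBall, Finset.mem_biUnion, Finset.mem_filter, Finset.mem_univ, true_and]
    exact ⟨u, hu, hrefl u⟩

/-- Going around the cycle reaches every index within `q` steps, and by reflexivity the smaller
balls lie in the one of radius `q`. -/
lemma IsClosedWalk.mem_walkBall (hrefl : ∀ u, adj u u) {c : Fin q → Fin n}
    (hc : IsClosedWalk adj c) (f₀ f : Fin q) : c f ∈ walkBall adj (c f₀) q := by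
  obtain ⟨r, hr, rfl⟩ := exists_finRotate_iterate_eq f₀ f
  apply walkBall_mono hrefl _ hr
  clear hr
  induction r with
  | zero => simp [walkBall]
  | succ r ih =>
    simp only [walkBall, Finset.mem_biUnion, Finset.mem_filter, Finset.mem_univ, true_and]
    refine ⟨_, ih, ?_⟩
    have := hc (finRotate q ((finRotate q)^[r] f₀))
    rwa [Equiv.symm_apply_apply, ← Function.iterate_succ_apply' (f := finRotate q)] at this

open Classical in
/-- The number of closed walks through a given vertex. -/
lemma sum_ind_closedWalk_le (hdeg : ∀ u, (Finset.univ.filter fun u' => adj u u').card ≤ Δ)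
    (hrefl : ∀ u, adj u u) (f₀ : Fin q) (v : Fin n) :
    ∑ c : Fin q → Fin n, ind (IsClosedWalk adj c) * ind (c f₀ = v) ≤ (Δ : ℝ) ^ (q * q) := by
  -- All `q` vertices of such a walk lie in the ball of radius `q` about `v`, which has at most `Δ ^
  -- q` elements.
  have h1 : ∀ c : Fin q → Fin n, ind (IsClosedWalk adj c) * ind (c f₀ = v) ≤
      if c ∈ Fintype.piFinset (fun _ : Fin q => walkBall adj v q) then 1 else 0 := by
    intro c
    by_cases hc : IsClosedWalk adj c
    · by_cases hv : c f₀ = v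
      · rw [if_pos]
        · rw [ind_true hc, ind_true hv, one_mul]
        · rw [Fintype.mem_piFinset]
          intro f
          rw [← hv]
          exact hc.mem_walkBall hrefl f₀ f
      · rw [ind_false hv, mul_zero]
        split_ifs <;> norm_num
    · rw [ind_false hc, zero_mul]
      split_ifs <;> norm_num
  refine (Finset.sum_le_sum fun c _ => h1 c).trans ?_
  rw [Finset.sum_ite_mem, Finset.univ_inter, Finset.sum_const, nsmul_eq_mul, mul_one,
    Fintype.card_piFinset, Finset.prod_const, Finset.card_univ, Fintype.card_fin]
  have h2 := Nat.pow_le_pow_left (card_walkBall_le hdeg v q) q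
  rw [← pow_mul] at h2
  exact_mod_cast h2

/-- The `q`-th power of the largest factor dominates the product. This charges the weight of a walk
to single vertices. -/
lemma prod_le_sum_pow {y : Fin q → ℝ} (hq : 0 < q) (hy : ∀ f, 0 ≤ y f) :
    ∏ f, y f ≤ ∑ f, y f ^ q := by
  obtain ⟨f₁, _, hmax⟩ := Finset.exists_max_image Finset.univ y ⟨⟨0, hq⟩, Finset.mem_univ _⟩
  calc ∏ f, y f ≤ ∏ _f : Fin q, y f₁ :=
        Finset.prod_le_prod (fun f _ => hy f) fun f hf => hmax f hf
    _ = y f₁ ^ q := by simp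
    _ ≤ _ := Finset.single_le_sum (f := fun f => y f ^ q) (fun f _ => pow_nonneg (hy f) q)
        (Finset.mem_univ f₁)

open Classical in
/-- The weight of all closed walks. -/
lemma sum_closedWalk_prod_le (hq : 0 < q)
    (hdeg : ∀ u, (Finset.univ.filter fun u' => adj u u').card ≤ Δ)
    (hrefl : ∀ u, adj u u) {y : Fin n → ℝ} {ρ : ℝ} (hy : ∀ u, 0 ≤ y u)
    (hρ : ∑ u, y u ^ q ≤ ρ ^ q) :
    ∑ c : Fin q → Fin n, ind (IsClosedWalk adj c) * ∏ f, y (c f) ≤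
      q * (Δ : ℝ) ^ (q * q) * ρ ^ q := by
  have h1 : ∀ c : Fin q → Fin n, ind (IsClosedWalk adj c) * ∏ f, y (c f) ≤
      ∑ f, ∑ u, y u ^ q * (ind (IsClosedWalk adj c) * ind (c f = u)) := by
    intro c
    calc ind (IsClosedWalk adj c) * ∏ f, y (c f)
        ≤ ind (IsClosedWalk adj c) * ∑ f, y (c f) ^ q :=
          mul_le_mul_of_nonneg_left (prod_le_sum_pow hq fun f => hy _) (ind_nonneg _)
      _ = _ := by
          rw [Finset.mul_sum]
          refine Finset.sum_congr rfl fun f _ => ?_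
          rw [Finset.sum_eq_single (c f)]
          · rw [ind_true (P := c f = c f) rfl]; ring
          · intro u _ hu
            rw [ind_false (P := c f = u) fun e => hu e.symm]; ring
          · simp
  refine (Finset.sum_le_sum fun c _ => h1 c).trans ?_
  rw [Finset.sum_comm]
  have h2 : ∀ f : Fin q, ∑ c : Fin q → Fin n, ∑ u, y u ^ q *
      (ind (IsClosedWalk adj c) * ind (c f = u)) ≤ (Δ : ℝ) ^ (q * q) * ρ ^ q := by
    intro f
    rw [Finset.sum_comm]
    calc ∑ u, ∑ c : Fin q → Fin n, y u ^ q * (ind (IsClosedWalk adj c) * ind (c f = u))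
        ≤ ∑ u, y u ^ q * (Δ : ℝ) ^ (q * q) := by
          refine Finset.sum_le_sum fun u _ => ?_
          rw [← Finset.mul_sum]
          exact mul_le_mul_of_nonneg_left (sum_ind_closedWalk_le hdeg hrefl f u)
            (pow_nonneg (hy u) q)
      _ ≤ _ := by
          rw [← Finset.sum_mul, mul_comm]
          gcongr
  refine (Finset.sum_le_sum fun f _ => h2 f).trans (le_of_eq ?_)
  simp
  ring

open Classical in
/-- The weight of all pairs of closed walks that interact. -/
lemma sum_closedWalk_pairs_le (hq : 0 < q)
    (hdeg : ∀ u, (Finset.univ.filter fun u' => adj u u').card ≤ Δ)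
    (hrefl : ∀ u, adj u u) {y : Fin n → ℝ} {ρ : ℝ} (hy : ∀ u, 0 ≤ y u) (hρ0 : 0 ≤ ρ)
    (hyρ : ∀ u, y u ≤ ρ) (hρ : ∑ u, y u ^ q ≤ ρ ^ q) :
    ∑ c : Fin q → Fin n, ∑ d : Fin q → Fin n,
      ind (IsClosedWalk adj c) * ind (IsClosedWalk adj d) *
        ∏ f, (y (c f) * y (d f) + ρ * ind (adj (c f) (d f)) * y (c f)) ≤
      ((q * (Δ : ℝ) ^ (q * q)) ^ 2 +
        q * 2 ^ q * (Δ * (Δ : ℝ) ^ (q * q)) * (q * (Δ : ℝ) ^ (q * q))) * (ρ ^ q) ^ 2 := by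
  set W : ℝ := (Δ : ℝ) ^ (q * q) with hW
  have hS1 := sum_closedWalk_prod_le hq hdeg hrefl hy hρ
  set S1 := ∑ c : Fin q → Fin n, ind (IsClosedWalk adj c) * ∏ f, y (c f) with hS1def
  have hS10 : 0 ≤ S1 := Finset.sum_nonneg fun c _ =>
    mul_nonneg (ind_nonneg _) (Finset.prod_nonneg fun f _ => hy _)
  have hterm : ∀ c d : Fin q → Fin n,
      ∏ f, (y (c f) * y (d f) + ρ * ind (adj (c f) (d f)) * y (c f)) ≤
      (∏ f, y (c f)) * (∏ f, y (d f)) +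
        ∑ f₀, ind (adj (c f₀) (d f₀)) * ((2 * ρ) ^ q * ∏ f, y (c f)) := by
    intro c d
    have hpc : 0 ≤ ∏ f, y (c f) := Finset.prod_nonneg fun f _ => hy _
    have hpd : 0 ≤ ∏ f, y (d f) := Finset.prod_nonneg fun f _ => hy _
    have hnn : ∀ f₀, 0 ≤ ind (adj (c f₀) (d f₀)) * ((2 * ρ) ^ q * ∏ f, y (c f)) :=
      fun f₀ => mul_nonneg (ind_nonneg _) (by positivity)
    -- If the walks are adjacent at some `f₀`, all factors are bounded by `2 ρ y (c f)`, and later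
    -- the sum over `d` counts closed walks through the neighbours of `c f₀`. Otherwise the product
    -- splits into one for `c` and one for `d`.
    by_cases h : ∃ f₀, adj (c f₀) (d f₀)
    · obtain ⟨f₀, hf₀⟩ := h
      have h1 : ∏ f, (y (c f) * y (d f) + ρ * ind (adj (c f) (d f)) * y (c f)) ≤
          ∏ f, (2 * ρ) * y (c f) := by
        apply Finset.prod_le_prod
        · intro f _
          have := hy (c f)
          have := hy (d f)
          have := ind_nonneg (adj (c f) (d f))
          positivity
        · intro f _
          have a1 := hy (c f)
          have a2 := hyρ (d f)
          have a3 := ind_le_one (adj (c f) (d f))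
          have a4 : y (c f) * y (d f) ≤ y (c f) * ρ := by gcongr
          have a5 : ρ * ind (adj (c f) (d f)) * y (c f) ≤ ρ * 1 * y (c f) := by gcongr
          linarith
      rw [Finset.prod_mul_distrib, Finset.prod_const, Finset.card_univ, Fintype.card_fin] at h1
      have h2 := Finset.single_le_sum (fun f _ => hnn f) (Finset.mem_univ f₀)
      rw [ind_true hf₀, one_mul] at h2
      have := mul_nonneg hpc hpd
      linarith
    · push Not at h
      rw [← Finset.prod_mul_distrib]
      have h1 : ∏ f, (y (c f) * y (d f) + ρ * ind (adj (c f) (d f)) * y (c f)) =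
          ∏ f, y (c f) * y (d f) := by
        refine Finset.prod_congr rfl fun f _ => ?_
        rw [ind_false (h f)]; ring
      rw [h1]
      have := Finset.sum_nonneg fun f₀ (_ : f₀ ∈ Finset.univ) => hnn f₀
      linarith
  have hcount : ∀ (c : Fin q → Fin n) (f₀ : Fin q),
      ∑ d : Fin q → Fin n, ind (IsClosedWalk adj d) * ind (adj (c f₀) (d f₀)) ≤ Δ * W := by
    intro c f₀
    have h1 : ∀ d : Fin q → Fin n, ind (IsClosedWalk adj d) * ind (adj (c f₀) (d f₀)) =
        ∑ u ∈ Finset.univ.filter (fun u => adj (c f₀) u),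
          ind (IsClosedWalk adj d) * ind (d f₀ = u) := by
      intro d
      rw [← Finset.mul_sum]
      congr 1
      rw [Finset.sum_filter]
      rw [Finset.sum_eq_single (d f₀)]
      · by_cases h : adj (c f₀) (d f₀)
        · rw [if_pos h, ind_true h, ind_true rfl]
        · rw [if_neg h, ind_false h]
      · intro u _ hu
        rw [ind_false (P := d f₀ = u) fun e => hu e.symm]
        simp
      · simp
    simp only [h1]
    rw [Finset.sum_comm]
    refine (Finset.sum_le_sum fun u _ => sum_ind_closedWalk_le hdeg hrefl f₀ u).trans ?_
    rw [Finset.sum_const, nsmul_eq_mul]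
    have := hdeg (c f₀)
    gcongr
  have hsplit : ∑ c : Fin q → Fin n, ∑ d : Fin q → Fin n,
      ind (IsClosedWalk adj c) * ind (IsClosedWalk adj d) *
        ∏ f, (y (c f) * y (d f) + ρ * ind (adj (c f) (d f)) * y (c f)) ≤
      S1 * S1 + ∑ c : Fin q → Fin n, ∑ f₀ : Fin q, (2 * ρ) ^ q *
        (ind (IsClosedWalk adj c) * ∏ f, y (c f)) *
        ∑ d : Fin q → Fin n, ind (IsClosedWalk adj d) * ind (adj (c f₀) (d f₀)) := by
    rw [hS1def, Finset.sum_mul_sum, ← Finset.sum_add_distrib]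
    refine Finset.sum_le_sum fun c _ => ?_
    simp only [Finset.mul_sum]
    rw [Finset.sum_comm (s := (Finset.univ : Finset (Fin q))), ← Finset.sum_add_distrib]
    refine Finset.sum_le_sum fun d _ => ?_
    refine (mul_le_mul_of_nonneg_left (hterm c d)
      (mul_nonneg (ind_nonneg _) (ind_nonneg _))).trans (le_of_eq ?_)
    rw [mul_add, Finset.mul_sum]
    congr 1
    · ring
    · exact Finset.sum_congr rfl fun f₀ _ => by ring
  refine hsplit.trans ?_
  have hW0 : 0 ≤ W := by positivity
  have hsecond : ∑ c : Fin q → Fin n, ∑ f₀ : Fin q, (2 * ρ) ^ q *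
        (ind (IsClosedWalk adj c) * ∏ f, y (c f)) *
        ∑ d : Fin q → Fin n, ind (IsClosedWalk adj d) * ind (adj (c f₀) (d f₀)) ≤
      q * (2 * ρ) ^ q * S1 * (Δ * W) := by
    calc _ ≤ ∑ c : Fin q → Fin n, ∑ f₀ : Fin q, (2 * ρ) ^ q *
          (ind (IsClosedWalk adj c) * ∏ f, y (c f)) * (Δ * W) := by
          refine Finset.sum_le_sum fun c _ => Finset.sum_le_sum fun f₀ _ => ?_
          refine mul_le_mul_of_nonneg_left (hcount c f₀) ?_
          exact mul_nonneg (by positivity)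
            (mul_nonneg (ind_nonneg _) (Finset.prod_nonneg fun f _ => hy _))
      _ = _ := by
          rw [hS1def]
          simp only [Finset.sum_const, Finset.card_univ, Fintype.card_fin, nsmul_eq_mul,
            Finset.mul_sum, Finset.sum_mul]
          exact Finset.sum_congr rfl fun c _ => by ring
  have hρq : 0 ≤ ρ ^ q := pow_nonneg hρ0 q
  calc S1 * S1 + _ ≤ (q * W * ρ ^ q) * (q * W * ρ ^ q) +
        q * (2 * ρ) ^ q * (q * W * ρ ^ q) * (Δ * W) := by
        refine add_le_add (mul_le_mul hS1 hS1 hS10 (by positivity)) (hsecond.trans ?_)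
        gcongr
    _ = _ := by rw [mul_pow 2 ρ q]; ring

/-! ## Products of perturbed factors -/

/-- Induction on the factors through `(a + κ) X - a Y = (a + κ) (X - Y) + κ Y`; all errors are
measured against the majorants `P`, so vanishing `a i` do no harm. -/
lemma abs_prod_add_sub_prod_le {ι : Type*} (s : Finset ι) (a κ P : ι → ℝ) {δ : ℝ} (hδ : 0 ≤ δ)
    (ha : ∀ i ∈ s, |a i| ≤ P i) (hκ : ∀ i ∈ s, |κ i| ≤ δ * P i) :
    |∏ i ∈ s, (a i + κ i) - ∏ i ∈ s, a i| ≤ ((1 + δ) ^ s.card - 1) * ∏ i ∈ s, P i := by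
  classical
  induction s using Finset.induction_on with
  | empty => simp
  | insert j s hj ih =>
    have ha' : ∀ i ∈ s, |a i| ≤ P i := fun i hi => ha i (Finset.mem_insert_of_mem hi)
    have hκ' : ∀ i ∈ s, |κ i| ≤ δ * P i := fun i hi => hκ i (Finset.mem_insert_of_mem hi)
    have h1 := ih ha' hκ'
    have haj := ha j (Finset.mem_insert_self _ _)
    have hκj := hκ j (Finset.mem_insert_self _ _)
    have hPj : 0 ≤ P j := (abs_nonneg _).trans haj
    have hP : 0 ≤ ∏ i ∈ s, P i := Finset.prod_nonneg fun i hi => (abs_nonneg _).trans (ha' i hi)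
    have hprod : |∏ i ∈ s, a i| ≤ ∏ i ∈ s, P i := by
      rw [Finset.abs_prod]
      exact Finset.prod_le_prod (fun i _ => abs_nonneg _) ha'
    rw [Finset.prod_insert hj, Finset.prod_insert hj, Finset.prod_insert hj,
      Finset.card_insert_of_notMem hj]
    set X := ∏ i ∈ s, (a i + κ i)
    set Y := ∏ i ∈ s, a i
    set Z := ∏ i ∈ s, P i
    have e : (a j + κ j) * X - a j * Y = (a j + κ j) * (X - Y) + κ j * Y := by ring
    have hsum : |a j + κ j| ≤ (1 + δ) * P j := (abs_add_le _ _).trans (by linarith)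
    have hge : 0 ≤ (1 + δ) ^ s.card - 1 := sub_nonneg.2 (one_le_pow₀ (by linarith))
    rw [e]
    calc |(a j + κ j) * (X - Y) + κ j * Y| ≤ |a j + κ j| * |X - Y| + |κ j| * |Y| := by
          rw [← abs_mul, ← abs_mul]; exact abs_add_le _ _
      _ ≤ ((1 + δ) * P j) * (((1 + δ) ^ s.card - 1) * Z) + (δ * P j) * Z := by gcongr
      _ = _ := by rw [pow_succ]; ring

lemma one_add_pow_sub_one_le {δ : ℝ} (hδ : 0 ≤ δ) (hδ1 : δ ≤ 1) (q : ℕ) :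
    (1 + δ) ^ q - 1 ≤ 2 ^ q * δ := by
  induction q with
  | zero => simpa using hδ
  | succ q ih =>
    have h2 : (1 : ℝ) ≤ 2 ^ q := one_le_pow₀ (by norm_num)
    have h3 : (1 + δ) ^ (q + 1) = (1 + δ) ^ q * (1 + δ) := pow_succ _ _
    have h4 : (2 : ℝ) ^ (q + 1) = 2 ^ q * 2 := pow_succ _ _
    have h5 : (1 + δ) ^ q ≤ 2 ^ q := pow_le_pow_left₀ (by linarith) (by linarith) q
    rw [h3, h4]
    nlinarith

/-! ## The second moment of a random cyclic sum -/

/-- The mean square error of a cyclic sum of independent random matrices. -/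
lemma avg_cyclicSum_sub_sq_le {Ω : Type*} [Finite Ω] [Nonempty Ω]
    (M : Fin q → Ω → Fin n → Fin n → ℝ) (N : Fin n → Fin n → ℝ)
    (P₁ : Fin n → Fin n → ℝ) (P₂ : Fin n → Fin n → Fin n → Fin n → ℝ) {η₁ η₂ : ℝ}
    (hη₁ : 0 ≤ η₁) (hη₁' : η₁ ≤ 1) (hη₂ : 0 ≤ η₂) (hη₂' : η₂ ≤ 1)
    (hN : ∀ c c', |N c c'| ≤ P₁ c c')
    (hbias : ∀ f c c', |avg (fun x => M f x c c') - N c c'| ≤ η₁ * P₁ c c')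
    (hmean : ∀ f c c' d d', |avg (fun x => M f x c c') * avg (fun x => M f x d d')| ≤ P₂ c c' d d')
    (hcov : ∀ f c c' d d', |avg (fun x => M f x c c' * M f x d d') -
      avg (fun x => M f x c c') * avg (fun x => M f x d d')| ≤ η₂ * P₂ c c' d d') :
    avg (fun ω : Fin q → Ω => (cyclicSum (fun f => M f (ω f)) - cyclicSum fun _ : Fin q => N) ^ 2) ≤
      2 ^ q * η₂ * (∑ c : Fin q → Fin n, ∑ d : Fin q → Fin n,
        ∏ f, P₂ (c ((finRotate q).symm f)) (c f) (d ((finRotate q).symm f)) (d f)) +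
      (2 ^ q * η₁ * ∑ c : Fin q → Fin n, ∏ f, P₁ (c ((finRotate q).symm f)) (c f)) ^ 2 := by
  set e := (finRotate q).symm with he
  set Y₀ := cyclicSum fun _ : Fin q => N with hY₀
  set m : Fin q → Fin n → Fin n → ℝ := fun f c c' => avg fun x => M f x c c' with hm
  set EY := cyclicSum m with hEY
  -- By independence the mean of the cyclic sum is the cyclic sum of the means, and the mean of its
  -- square is a sum over pairs of walks of products of second moments.
  have h1 : avg (fun ω : Fin q → Ω => cyclicSum (fun f => M f (ω f))) = EY := by
    unfold cyclicSum
    rw [avg_sum]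
    refine Finset.sum_congr rfl fun c _ => ?_
    exact avg_pi_prod (fun f x => M f x (c (e f)) (c f))
  have h2 : avg (fun ω : Fin q → Ω => cyclicSum (fun f => M f (ω f)) ^ 2) =
      ∑ c : Fin q → Fin n, ∑ d : Fin q → Fin n,
        ∏ f, avg (fun x => M f x (c (e f)) (c f) * M f x (d (e f)) (d f)) := by
    unfold cyclicSum
    simp only [sq, Finset.sum_mul_sum, ← Finset.prod_mul_distrib]
    rw [avg_sum]
    refine Finset.sum_congr rfl fun c _ => ?_
    rw [avg_sum]
    refine Finset.sum_congr rfl fun d _ => ?_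
    exact avg_pi_prod (fun f x => M f x (c (e f)) (c f) * M f x (d (e f)) (d f))
  have h3 : EY ^ 2 = ∑ c : Fin q → Fin n, ∑ d : Fin q → Fin n,
      ∏ f, m f (c (e f)) (c f) * m f (d (e f)) (d f) := by
    rw [hEY]
    unfold cyclicSum
    simp only [sq, Finset.sum_mul_sum, ← Finset.prod_mul_distrib]
    rfl
  -- For each pair of walks the covariances perturb the product of the means by a relative `η₂` per
  -- factor.
  have hvar : avg (fun ω : Fin q → Ω => cyclicSum (fun f => M f (ω f)) ^ 2) - EY ^ 2 ≤
      2 ^ q * η₂ * ∑ c : Fin q → Fin n, ∑ d : Fin q → Fin n,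
        ∏ f, P₂ (c (e f)) (c f) (d (e f)) (d f) := by
    rw [h2, h3, ← Finset.sum_sub_distrib, Finset.mul_sum]
    refine Finset.sum_le_sum fun c _ => ?_
    rw [← Finset.sum_sub_distrib, Finset.mul_sum]
    refine Finset.sum_le_sum fun d _ => ?_
    have h4 := abs_prod_add_sub_prod_le Finset.univ
      (fun f => m f (c (e f)) (c f) * m f (d (e f)) (d f))
      (fun f => avg (fun x => M f x (c (e f)) (c f) * M f x (d (e f)) (d f)) -
        m f (c (e f)) (c f) * m f (d (e f)) (d f))
      (fun f => P₂ (c (e f)) (c f) (d (e f)) (d f)) hη₂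
      (fun f _ => hmean f _ _ _ _) (fun f _ => hcov f _ _ _ _)
    simp only [add_sub_cancel, Finset.card_univ, Fintype.card_fin] at h4
    refine (le_abs_self _).trans (h4.trans ?_)
    refine mul_le_mul_of_nonneg_right (one_add_pow_sub_one_le hη₂ hη₂' q) ?_
    exact Finset.prod_nonneg fun f _ => (abs_nonneg _).trans (hmean f _ _ _ _)
  have hbias' : |EY - Y₀| ≤
      2 ^ q * η₁ * ∑ c : Fin q → Fin n, ∏ f, P₁ (c (e f)) (c f) := by
    rw [hEY, hY₀]
    unfold cyclicSum
    rw [← Finset.sum_sub_distrib, Finset.mul_sum]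
    refine (Finset.abs_sum_le_sum_abs _ _).trans (Finset.sum_le_sum fun c _ => ?_)
    have h4 := abs_prod_add_sub_prod_le Finset.univ (fun f => N (c (e f)) (c f))
      (fun f => m f (c (e f)) (c f) - N (c (e f)) (c f))
      (fun f => P₁ (c (e f)) (c f)) hη₁ (fun f _ => hN _ _) (fun f _ => hbias f _ _)
    simp only [add_sub_cancel, Finset.card_univ, Fintype.card_fin] at h4
    refine h4.trans ?_
    refine mul_le_mul_of_nonneg_right (one_add_pow_sub_one_le hη₁ hη₁' q) ?_
    exact Finset.prod_nonneg fun f _ => (abs_nonneg _).trans (hN _ _)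
  -- Variance plus squared bias.
  have h5 : avg (fun ω : Fin q → Ω => (cyclicSum (fun f => M f (ω f)) - Y₀) ^ 2) =
      (avg (fun ω : Fin q → Ω => cyclicSum (fun f => M f (ω f)) ^ 2) - EY ^ 2) +
        (EY - Y₀) ^ 2 := by
    have h6 : ∀ ω : Fin q → Ω, (cyclicSum (fun f => M f (ω f)) - Y₀) ^ 2 =
        cyclicSum (fun f => M f (ω f)) ^ 2 - (2 * Y₀) * cyclicSum (fun f => M f (ω f)) + Y₀ ^ 2 :=
      fun ω => by ring
    rw [avg_congr h6, avg_add, avg_sub, avg_const_mul, avg_const, h1]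
    ring
  rw [h5]
  exact add_le_add hvar (sq_le_sq' (abs_le.1 hbias').1 (abs_le.1 hbias').2)

end Walks


section Incidence

variable {n q k γ : ℕ} {η : ℝ} {z : Sizes} {A : Matrix (Fin n) (Fin n) ℤ}

/-! ## The estimator for fixed heavy rows -/

/-- Two columns are adjacent if they are equal or share a row. -/
def colAdj (A : Matrix (Fin n) (Fin n) ℤ) (c c' : Fin n) : Prop :=
  c = c' ∨ ∃ i, A i c ≠ 0 ∧ A i c' ≠ 0

/-- The total squared norm of the rows that meet a column. -/
noncomputable def colMass (A : Matrix (Fin n) (Fin n) ℤ) (c : Fin n) : ℝ :=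
  ∑ i, ind (A i c ≠ 0) * rowSq A i

lemma colMass_nonneg (c : Fin n) : 0 ≤ colMass A c :=
  Finset.sum_nonneg fun i _ => mul_nonneg (ind_nonneg _) (rowSq_nonneg A i)

open Classical in
lemma card_colAdj_le (hk : IsSparse k A) (c : Fin n) :
    (Finset.univ.filter fun c' => colAdj A c c').card ≤ k * k + 1 := by
  have h1 : (Finset.univ.filter fun c' => colAdj A c c') ⊆
      insert c ((Finset.univ.filter fun i => A i c ≠ 0).biUnion fun i =>
        Finset.univ.filter fun c' => A i c' ≠ 0) := by
    intro c' hc'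
    rcases (Finset.mem_filter.1 hc').2 with rfl | ⟨i, h1, h2⟩
    · exact Finset.mem_insert_self _ _
    · apply Finset.mem_insert_of_mem
      simp only [Finset.mem_biUnion, Finset.mem_filter, Finset.mem_univ, true_and]
      exact ⟨i, h1, h2⟩
  refine (Finset.card_le_card h1).trans ((Finset.card_insert_le _ _).trans ?_)
  gcongr
  refine (Finset.card_biUnion_le_card_mul _ _ k fun i _ => hk.1 i).trans ?_
  exact Nat.mul_le_mul_right _ (hk.2 c)

/-- The weight of the rows that meet two columns. -/
noncomputable def pairMass (A : Matrix (Fin n) (Fin n) ℤ) (c c' : Fin n) : ℝ :=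
  ∑ i, ind (A i c ≠ 0) * ind (A i c' ≠ 0) * rowSq A i

/-- The mass is charged to the second column only: along a closed walk every position is the second
column of exactly one step. -/
lemma pairMass_le (c c' : Fin n) : pairMass A c c' ≤ ind (colAdj A c c') * colMass A c' := by
  unfold pairMass colMass
  rw [Finset.mul_sum]
  refine Finset.sum_le_sum fun i _ => ?_
  rw [← mul_assoc]
  refine mul_le_mul_of_nonneg_right ?_ (rowSq_nonneg A i)
  rw [← ind_and, ← ind_and]
  exact ind_mono fun h => ⟨Or.inr ⟨i, h⟩, h.2⟩

lemma abs_entry_mul_le (i c c' : Fin n) :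
    |(A i c : ℝ) * A i c'| ≤ ind (A i c ≠ 0) * ind (A i c' ≠ 0) * rowSq A i := by
  by_cases h : A i c ≠ 0
  · by_cases h' : A i c' ≠ 0
    · rw [ind_true h, ind_true h', one_mul, one_mul]
      have := abs_mul_le_normSq (fun j => (A i j : ℝ)) c c'
      rwa [normSq_eq_sum] at this
    · rw [not_not] at h'
      rw [h']
      simp
      exact mul_nonneg (mul_nonneg (ind_nonneg _) (ind_nonneg _)) (rowSq_nonneg A i)
  · rw [not_not] at h
    rw [h]
    simp
    exact mul_nonneg (mul_nonneg (ind_nonneg _) (ind_nonneg _)) (rowSq_nonneg A i)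

lemma abs_colGram_le (c c' : Fin n) : |colGram A c c'| ≤ ind (colAdj A c c') * colMass A c' := by
  refine le_trans ?_ (pairMass_le c c')
  exact (Finset.abs_sum_le_sum_abs _ _).trans (Finset.sum_le_sum fun i _ => abs_entry_mul_le i c c')

variable {L θ : ℝ}

/-- The contribution of one sample, restricted to the rows outside `K`. -/
noncomputable def sampleTerm (K : Finset (Fin n)) (L : ℝ) (c c' : Fin n)
    (o : Option (Fin n × (Fin n → ℝ))) : ℝ :=
  ∑ i ∈ Kᶜ, ind (isRow i o) * (L * dirProd c c' o)

/-- An estimated row vanishes wherever the true row does. Samples therefore contribute only at pairs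
of columns that share a row, and the closed walks stay in the column graph. -/
lemma ind_isRow_mul_dirProd_eq_zero (hz : SizeConditions n q k γ η z) {i c c' : Fin n}
    (h : ¬ (A i c ≠ 0 ∧ A i c' ≠ 0)) (ω : Fin z.R → PSeed z) :
    ind (isRow i (sOut A θ ω)) * dirProd c c' (sOut A θ ω) = 0 := by
  by_cases hr : isRow i (sOut A θ ω)
  · obtain ⟨v, hv⟩ := hr
    rw [hv]
    have hs := fun j => sOut_support hz hv (j := j)
    simp only at hs
    rw [not_and_or, not_not, not_not] at h
    rcases h with h | h <;> simp [dirProd, hs _ h]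
  · rw [ind_false hr, zero_mul]

lemma abs_avg_sampleTerm_sub_le (hz : SizeConditions n q k γ η z) (hk : IsSparse k A)
    (hA : ∀ i j, |A i j| ≤ (n : ℤ) ^ γ) (hL : NormEstimate A η L θ) (K : Finset (Fin n))
    (c c' : Fin n) :
    |avg (fun ω : Fin z.R → PSeed z => sampleTerm K L c c' (sOut A θ ω)) -
      ∑ i ∈ Kᶜ, (A i c : ℝ) * A i c'| ≤
      350 * η * ∑ i ∈ Kᶜ, ind (A i c ≠ 0) * ind (A i c' ≠ 0) * rowSq A i := by
  unfold sampleTerm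
  rw [avg_sum, ← Finset.sum_sub_distrib, Finset.mul_sum]
  refine (Finset.abs_sum_le_sum_abs _ _).trans (Finset.sum_le_sum fun i _ => ?_)
  by_cases h : A i c ≠ 0 ∧ A i c' ≠ 0
  · rw [ind_true h.1, ind_true h.2, one_mul, one_mul]
    exact abs_avg_sample_sub_le hz hk hA hL i c c'
  · have h1 : ∀ ω : Fin z.R → PSeed z,
        ind (isRow i (sOut A θ ω)) * (L * dirProd c c' (sOut A θ ω)) = 0 := by
      intro ω
      rw [mul_left_comm, ind_isRow_mul_dirProd_eq_zero hz h, mul_zero]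
    rw [avg_congr h1, avg_zero]
    have h2 : (A i c : ℝ) * A i c' = 0 := by
      rw [not_and_or, not_not, not_not] at h
      rcases h with h | h <;> simp [h]
    rw [h2, ← ind_and, ind_false h]
    simp

lemma abs_avg_sampleTerm_le (hz : SizeConditions n q k γ η z) (hk : IsSparse k A)
    (hA : ∀ i j, |A i j| ≤ (n : ℤ) ^ γ) (hL : NormEstimate A η L θ) (K : Finset (Fin n))
    (c c' : Fin n) :
    |avg (fun ω : Fin z.R → PSeed z => sampleTerm K L c c' (sOut A θ ω))| ≤
      2 * (ind (colAdj A c c') * colMass A c') := by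
  have h1 := abs_avg_sampleTerm_sub_le hz hk hA hL K c c'
  have hη := hz.eta_pos
  have hη' := hz.eta_le
  set S := ∑ i ∈ Kᶜ, ind (A i c ≠ 0) * ind (A i c' ≠ 0) * rowSq A i
  have hS : S ≤ pairMass A c c' := Finset.sum_le_sum_of_subset_of_nonneg (Finset.subset_univ _)
    fun i _ _ => mul_nonneg (mul_nonneg (ind_nonneg _) (ind_nonneg _)) (rowSq_nonneg A i)
  have hS0 : 0 ≤ S := Finset.sum_nonneg
    fun i _ => mul_nonneg (mul_nonneg (ind_nonneg _) (ind_nonneg _)) (rowSq_nonneg A i)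
  have h2 : |∑ i ∈ Kᶜ, (A i c : ℝ) * A i c'| ≤ S :=
    (Finset.abs_sum_le_sum_abs _ _).trans (Finset.sum_le_sum fun i _ => abs_entry_mul_le i c c')
  have h3 := pairMass_le (A := A) c c'
  have h4 := abs_sub_abs_le_abs_sub
    (avg (fun ω : Fin z.R → PSeed z => sampleTerm K L c c' (sOut A θ ω)))
    (∑ i ∈ Kᶜ, (A i c : ℝ) * A i c')
  have h5 : 350 * η * S ≤ 1 * S := by gcongr; linarith
  linarith

/-- A sample names at most one row, so the product of two sums over rows collapses to that row. Its
normalized products are at most `1` and vanish unless the row meets the columns involved. -/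
lemma sampleTerm_mul_sampleTerm_le (hz : SizeConditions n q k γ η z) (K : Finset (Fin n))
    (c c' d d' : Fin n) (ω : Fin z.R → PSeed z) :
    |sampleTerm K L c c' (sOut A θ ω) * sampleTerm K L d d' (sOut A θ ω)| ≤
      ∑ i, ind (isRow i (sOut A θ ω)) *
        (L ^ 2 * (ind (A i c ≠ 0 ∧ A i c' ≠ 0) * ind (A i d ≠ 0 ∧ A i d' ≠ 0))) := by
  have hnn : ∀ i, 0 ≤ ind (isRow i (sOut A θ ω)) *
        (L ^ 2 * (ind (A i c ≠ 0 ∧ A i c' ≠ 0) * ind (A i d ≠ 0 ∧ A i d' ≠ 0))) := fun i =>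
    mul_nonneg (ind_nonneg _) (mul_nonneg (sq_nonneg L) (mul_nonneg (ind_nonneg _) (ind_nonneg _)))
  have hrow : ∀ (i : Fin n) (c c' : Fin n), isRow i (sOut A θ ω) →
      |sampleTerm K L c c' (sOut A θ ω)| ≤ |L| * ind (A i c ≠ 0 ∧ A i c' ≠ 0) := by
    intro i c c' hi
    have hother : ∀ j, j ≠ i → ¬ isRow j (sOut A θ ω) := by
      rintro j hj ⟨v, hv⟩
      obtain ⟨v', hv'⟩ := hi
      rw [hv] at hv'
      simp only [Option.some.injEq, Prod.mk.injEq] at hv'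
      exact hj hv'.1
    have h1 : sampleTerm K L c c' (sOut A θ ω) =
        ind (i ∈ Kᶜ) * (L * (ind (isRow i (sOut A θ ω)) * dirProd c c' (sOut A θ ω))) := by
      unfold sampleTerm
      by_cases hK : i ∈ Kᶜ
      · rw [Finset.sum_eq_single_of_mem i hK fun j _ hj => by rw [ind_false (hother j hj), zero_mul],
          ind_true hK]
        ring
      · rw [ind_false hK, zero_mul]
        refine Finset.sum_eq_zero fun j hj => ?_
        rw [ind_false (hother j fun e => hK (e ▸ hj)), zero_mul]
    by_cases h : A i c ≠ 0 ∧ A i c' ≠ 0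
    · rw [h1, ind_true h, ind_true hi, abs_mul, abs_mul, one_mul, mul_one]
      have a1 := abs_dirProd_le_one c c' (sOut A θ ω)
      have a2 : |ind (i ∈ Kᶜ)| ≤ 1 := by
        rw [abs_of_nonneg (ind_nonneg _)]; exact ind_le_one _
      calc _ ≤ 1 * (|L| * 1) := by gcongr
        _ = _ := by ring
    · rw [h1, ind_isRow_mul_dirProd_eq_zero hz h, mul_zero, mul_zero, abs_zero]
      exact mul_nonneg (abs_nonneg _) (ind_nonneg _)
  by_cases h : ∃ i, isRow i (sOut A θ ω)
  · obtain ⟨i, hi⟩ := h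
    refine le_trans ?_ (Finset.single_le_sum (fun i _ => hnn i) (Finset.mem_univ i))
    rw [ind_true hi, one_mul, abs_mul]
    calc _ ≤ (|L| * ind (A i c ≠ 0 ∧ A i c' ≠ 0)) * (|L| * ind (A i d ≠ 0 ∧ A i d' ≠ 0)) :=
          mul_le_mul (hrow i c c' hi) (hrow i d d' hi) (abs_nonneg _)
            (mul_nonneg (abs_nonneg _) (ind_nonneg _))
      _ = _ := by rw [← sq_abs L]; ring
  · have h1 : sampleTerm K L c c' (sOut A θ ω) = 0 := by
      unfold sampleTerm
      refine Finset.sum_eq_zero fun i _ => ?_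
      rw [ind_false fun hi => h ⟨i, hi⟩, zero_mul]
    rw [h1, zero_mul, abs_zero]
    exact Finset.sum_nonneg fun i _ => hnn i

/-- With `F = frobSq A`, row `i` is sampled with probability at most `2 rowSq / F` and then
contributes at most `L² ≤ 3/2 F²`, giving `3 F rowSq`. One row meets all four columns, which makes
them pairwise adjacent. -/
lemma abs_avg_sampleTerm_mul_le (hz : SizeConditions n q k γ η z) (hk : IsSparse k A)
    (hA : ∀ i j, |A i j| ≤ (n : ℤ) ^ γ) (hL : NormEstimate A η L θ) (K : Finset (Fin n))
    (c c' d d' : Fin n) :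
    |avg (fun ω : Fin z.R → PSeed z =>
      sampleTerm K L c c' (sOut A θ ω) * sampleTerm K L d d' (sOut A θ ω))| ≤
      3 * frobSq A * (ind (colAdj A c c') * ind (colAdj A d d') *
        (ind (colAdj A c' d') * colMass A c')) := by
  have hη := hz.eta_pos
  have hη' := hz.eta_le
  have hF := hL.frob_pos
  refine (abs_avg_le _).trans
    ((avg_mono (sampleTerm_mul_sampleTerm_le (L := L) (θ := θ) hz K c c' d d')).trans ?_)
  rw [avg_sum]
  simp only [avg_mul_const]
  have hLF : L ^ 2 ≤ 3 / 2 * frobSq A ^ 2 := by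
    have h1 := abs_le.1 hL.close
    have h2 : |L| ≤ 1.001 * frobSq A := by
      rw [abs_le]
      constructor <;> nlinarith [h1.1, h1.2]
    calc L ^ 2 = |L| ^ 2 := (sq_abs L).symm
      _ ≤ (1.001 * frobSq A) ^ 2 := by gcongr
      _ ≤ _ := by nlinarith [sq_nonneg (frobSq A)]
  unfold colMass
  simp only [Finset.mul_sum]
  refine Finset.sum_le_sum fun i _ => ?_
  have hx := rowSq_nonneg A i
  have hp := avg_ind_isRow_sOut_le (z := z) hz hk hA hL i
  have hI : ind (A i c ≠ 0 ∧ A i c' ≠ 0) * ind (A i d ≠ 0 ∧ A i d' ≠ 0) ≤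
      ind (colAdj A c c') * ind (colAdj A d d') * (ind (colAdj A c' d') * ind (A i c' ≠ 0)) := by
    rw [← ind_and, ← ind_and, ← ind_and, ← ind_and]
    refine ind_mono fun h => ⟨⟨Or.inr ⟨i, h.1⟩, Or.inr ⟨i, h.2⟩⟩, Or.inr ⟨i, h.1.2, h.2.2⟩, h.1.2⟩
  have hI0 : 0 ≤ ind (A i c ≠ 0 ∧ A i c' ≠ 0) * ind (A i d ≠ 0 ∧ A i d' ≠ 0) :=
    mul_nonneg (ind_nonneg _) (ind_nonneg _)
  set J := ind (A i c ≠ 0 ∧ A i c' ≠ 0) * ind (A i d ≠ 0 ∧ A i d' ≠ 0)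
  calc _ ≤ 2 * (rowSq A i / frobSq A) * (3 / 2 * frobSq A ^ 2 * J) := by gcongr
    _ = 3 * frobSq A * rowSq A i * J := by field_simp
    _ ≤ 3 * frobSq A * rowSq A i *
        (ind (colAdj A c c') * ind (colAdj A d d') *
          (ind (colAdj A c' d') * ind (A i c' ≠ 0))) := by gcongr
    _ = _ := by ring

/-- The random matrix that belongs to one factor of the estimator. -/
noncomputable def factorMatrix (H : Fin n → Fin n → ℝ) (K : Finset (Fin n)) (A : Matrix (Fin n) (Fin n) ℤ)
    (L θ : ℝ) (ω : Fin z.T → Fin z.R → PSeed z) (c c' : Fin n) : ℝ :=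
  H c c' + (∑ t, sampleTerm K L c c' (sOut A θ (ω t))) / z.T

/-- The constant in the bound on the mean square error. -/
noncomputable def errConst (k q : ℕ) : ℝ :=
  2 ^ q * (4 ^ q * ((q * ((k * k + 1 : ℕ) : ℝ) ^ (q * q)) ^ 2 +
    q * 2 ^ q * (((k * k + 1 : ℕ) : ℝ) * ((k * k + 1 : ℕ) : ℝ) ^ (q * q)) *
      (q * ((k * k + 1 : ℕ) : ℝ) ^ (q * q)))) +
  (2 ^ q * 350 * (q * ((k * k + 1 : ℕ) : ℝ) ^ (q * q))) ^ 2

/-- The mean square error of the estimator when the heavy rows are fixed. -/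
lemma avg_factorMatrix_error_le (hq : 0 < q) (hz : SizeConditions n q k γ η z) (hk : IsSparse k A)
    (hA : ∀ i j, |A i j| ≤ (n : ℤ) ^ γ) (hL : NormEstimate A η L θ)
    (K : Fin q → Finset (Fin n)) (H : Fin q → Fin n → Fin n → ℝ)
    (hH : ∀ f c c', |H f c c' - ∑ i ∈ K f, (A i c : ℝ) * A i c'| ≤
      350 * η * ∑ i ∈ K f, ind (A i c ≠ 0) * ind (A i c' ≠ 0) * rowSq A i)
    {ρ : ℝ} (hρ0 : 0 ≤ ρ) (hmass : ∀ c, colMass A c ≤ ρ) (hmassq : ∑ c, colMass A c ^ q ≤ ρ ^ q)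
    (hFρ : frobSq A ≤ η ^ 2 * z.T * ρ) :
    avg (fun ω : Fin q → Fin z.T → Fin z.R → PSeed z =>
      (cyclicSum (fun f => factorMatrix (H f) (K f) A L θ (ω f)) -
        cyclicSum fun _ : Fin q => colGram A) ^ 2) ≤ errConst k q * η ^ 2 * (ρ ^ q) ^ 2 := by
  classical
  have hη := hz.eta_pos
  have hη' := hz.eta_le
  have hT : (0 : ℝ) < z.T := by exact_mod_cast hz.T_pos
  set P₁ : Fin n → Fin n → ℝ := fun c c' => ind (colAdj A c c') * colMass A c' with hP₁
  -- The product of masses majorizes products of means. The term with `ρ` is for both walks using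
  -- the same sampled row, which forces `c'` and `d'` to be adjacent.
  set P₂ : Fin n → Fin n → Fin n → Fin n → ℝ := fun c c' d d' =>
    4 * (ind (colAdj A c c') * ind (colAdj A d d') *
      (colMass A c' * colMass A d' + ρ * ind (colAdj A c' d') * colMass A c')) with hP₂
  have hP₁0 : ∀ c c', 0 ≤ P₁ c c' := fun c c' => mul_nonneg (ind_nonneg _) (colMass_nonneg _)
  have hmeanX : ∀ f c c', avg (fun x : Fin z.T → Fin z.R → PSeed z =>
      factorMatrix (H f) (K f) A L θ x c c') =
      H f c c' + avg (fun ω : Fin z.R → PSeed z => sampleTerm (K f) L c c' (sOut A θ ω)) := by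
    intro f c c'
    unfold factorMatrix
    rw [avg_add, avg_const, avg_mean hz.T_pos
      (fun ω : Fin z.R → PSeed z => sampleTerm (K f) L c c' (sOut A θ ω))]
  have hbias : ∀ f c c', |avg (fun x : Fin z.T → Fin z.R → PSeed z =>
      factorMatrix (H f) (K f) A L θ x c c') - colGram A c c'| ≤ 350 * η * P₁ c c' := by
    intro f c c'
    rw [hmeanX]
    have h1 := hH f c c'
    have h2 := abs_avg_sampleTerm_sub_le hz hk hA hL (K f) c c'
    have h3 : colGram A c c' = ∑ i ∈ K f, (A i c : ℝ) * A i c' +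
        ∑ i ∈ (K f)ᶜ, (A i c : ℝ) * A i c' := (Finset.sum_add_sum_compl _ _).symm
    have h4 : pairMass A c c' = ∑ i ∈ K f, ind (A i c ≠ 0) * ind (A i c' ≠ 0) * rowSq A i +
        ∑ i ∈ (K f)ᶜ, ind (A i c ≠ 0) * ind (A i c' ≠ 0) * rowSq A i :=
      (Finset.sum_add_sum_compl _ _).symm
    have h5 := pairMass_le (A := A) c c'
    rw [h3, add_sub_add_comm]
    refine (abs_add_le _ _).trans ((add_le_add h1 h2).trans ?_)
    rw [← mul_add, ← h4]
    gcongr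
  have hN : ∀ c c', |colGram A c c'| ≤ P₁ c c' := abs_colGram_le
  have habs : ∀ f c c', |avg (fun x : Fin z.T → Fin z.R → PSeed z =>
      factorMatrix (H f) (K f) A L θ x c c')| ≤ 2 * P₁ c c' := by
    intro f c c'
    have h1 := abs_sub_abs_le_abs_sub (avg (fun x : Fin z.T → Fin z.R → PSeed z =>
      factorMatrix (H f) (K f) A L θ x c c')) (colGram A c c')
    have h2 := hbias f c c'
    have h3 := hN c c'
    have h4 : 350 * η * P₁ c c' ≤ 1 * P₁ c c' := by
      have := hP₁0 c c'
      gcongr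
      linarith
    linarith
  have hPP : ∀ c c' d d', 4 * (P₁ c c' * P₁ d d') +
      4 * ρ * (ind (colAdj A c c') * ind (colAdj A d d') *
        (ind (colAdj A c' d') * colMass A c')) = P₂ c c' d d' := by
    intro c c' d d'
    simp only [hP₁, hP₂]
    ring
  have hextra : ∀ c c' d d', 0 ≤ ind (colAdj A c c') * ind (colAdj A d d') *
        (ind (colAdj A c' d') * colMass A c') := fun c c' d d' =>
    mul_nonneg (mul_nonneg (ind_nonneg _) (ind_nonneg _))
      (mul_nonneg (ind_nonneg _) (colMass_nonneg _))
  have hmean : ∀ f c c' d d', |avg (fun x : Fin z.T → Fin z.R → PSeed z =>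
      factorMatrix (H f) (K f) A L θ x c c') * avg (fun x : Fin z.T → Fin z.R → PSeed z =>
      factorMatrix (H f) (K f) A L θ x d d')| ≤ P₂ c c' d d' := by
    intro f c c' d d'
    rw [abs_mul, ← hPP]
    have h1 := mul_le_mul (habs f c c') (habs f d d') (abs_nonneg _)
      (mul_nonneg zero_le_two (hP₁0 c c'))
    have h2 := mul_nonneg (mul_nonneg zero_le_four hρ0) (hextra c c' d d')
    linarith
  have hcov : ∀ f c c' d d', |avg (fun x : Fin z.T → Fin z.R → PSeed z =>
      factorMatrix (H f) (K f) A L θ x c c' * factorMatrix (H f) (K f) A L θ x d d') -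
      avg (fun x : Fin z.T → Fin z.R → PSeed z => factorMatrix (H f) (K f) A L θ x c c') *
        avg (fun x : Fin z.T → Fin z.R → PSeed z => factorMatrix (H f) (K f) A L θ x d d')| ≤
      η ^ 2 * P₂ c c' d d' := by
    intro f c c' d d'
    set X := fun ω : Fin z.R → PSeed z => sampleTerm (K f) L c c' (sOut A θ ω) with hX
    set X' := fun ω : Fin z.R → PSeed z => sampleTerm (K f) L d d' (sOut A θ ω) with hX'
    have e1 : ∀ x : Fin z.T → Fin z.R → PSeed z,
        factorMatrix (H f) (K f) A L θ x c c' * factorMatrix (H f) (K f) A L θ x d d' =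
        H f c c' * H f d d' + H f c c' * ((∑ t, X' (x t)) / z.T) +
          ((∑ t, X (x t)) / z.T) * H f d d' +
          ((∑ t, X (x t)) / z.T) * ((∑ t, X' (x t)) / z.T) := by
      intro x
      simp only [factorMatrix, hX, hX']
      ring
    rw [avg_congr e1, hmeanX, hmeanX]
    simp only [avg_add, avg_const_mul, avg_mul_const, avg_const]
    rw [avg_mean hz.T_pos X, avg_mean hz.T_pos X', avg_mean_mul_mean hz.T_pos X X']
    have e2 : ∀ a b x y w : ℝ, a * b + a * y + x * b + (x * y + w) - (a + x) * (b + y) = w := by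
      intros; ring
    -- The heavy part is deterministic and drops out of the covariance; the mean of `T` samples
    -- divides that of one sample by `T`.
    rw [e2, abs_div, abs_of_pos hT, div_le_iff₀ hT]
    have h1 : |avg (fun ω => X ω * X' ω)| ≤ _ :=
      abs_avg_sampleTerm_mul_le hz hk hA hL (K f) c c' d d'
    have h2 : |avg X * avg X'| ≤ 2 * P₁ c c' * (2 * P₁ d d') := by
      rw [abs_mul]
      exact mul_le_mul (abs_avg_sampleTerm_le hz hk hA hL (K f) c c')
        (abs_avg_sampleTerm_le hz hk hA hL (K f) d d') (abs_nonneg _)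
        (mul_nonneg zero_le_two (hP₁0 c c'))
    refine (abs_sub _ _).trans ((add_le_add h1 h2).trans ?_)
    rw [← hPP]
    set E := ind (colAdj A c c') * ind (colAdj A d d') * (ind (colAdj A c' d') * colMass A c')
    have hE : 0 ≤ E := hextra c c' d d'
    -- Here the size of `T` enters: `F ≤ η² T ρ` absorbs the second moment of a sample and `1 ≤ η²
    -- T` the product of the means.
    have h3 : 3 * frobSq A * E ≤ 4 * (η ^ 2 * z.T * ρ) * E := by
      have : 0 ≤ frobSq A := hL.frob_pos.le
      gcongr
      norm_num
    have h4 : 4 * (P₁ c c' * P₁ d d') * 1 ≤ 4 * (P₁ c c' * P₁ d d') * (η ^ 2 * z.T) := by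
      have := mul_nonneg (hP₁0 c c') (hP₁0 d d')
      have := hz.T_large_one
      gcongr
    nlinarith
  have hmain := avg_cyclicSum_sub_sq_le
    (fun f (x : Fin z.T → Fin z.R → PSeed z) => factorMatrix (H f) (K f) A L θ x)
    (colGram A) P₁ P₂ (by positivity : 0 ≤ 350 * η) (by linarith) (sq_nonneg η) (by nlinarith)
    hN hbias hmean hcov
  refine hmain.trans ?_
  have hdeg := card_colAdj_le hk
  have hrefl : ∀ u, colAdj A u u := fun u => Or.inl rfl
  have hS1 := sum_closedWalk_prod_le hq hdeg hrefl (y := colMass A) colMass_nonneg hmassq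
  have hS2 := sum_closedWalk_pairs_le hq hdeg hrefl (y := colMass A) colMass_nonneg hρ0 hmass hmassq
  -- The adjacency indicators along the steps multiply to the indicator of a closed walk.
  have e1 : ∑ c : Fin q → Fin n, ∏ f, P₁ (c ((finRotate q).symm f)) (c f) =
      ∑ c : Fin q → Fin n, ind (IsClosedWalk (colAdj A) c) * ∏ f, colMass A (c f) := by
    refine Finset.sum_congr rfl fun c _ => ?_
    simp only [hP₁]
    rw [Finset.prod_mul_distrib, ← ind_forall]
    rfl
  have e2 : ∑ c : Fin q → Fin n, ∑ d : Fin q → Fin n,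
      ∏ f, P₂ (c ((finRotate q).symm f)) (c f) (d ((finRotate q).symm f)) (d f) =
      4 ^ q * ∑ c : Fin q → Fin n, ∑ d : Fin q → Fin n,
        ind (IsClosedWalk (colAdj A) c) * ind (IsClosedWalk (colAdj A) d) *
        ∏ f, (colMass A (c f) * colMass A (d f) + ρ * ind (colAdj A (c f) (d f)) *
          colMass A (c f)) := by
    rw [Finset.mul_sum]
    refine Finset.sum_congr rfl fun c _ => ?_
    rw [Finset.mul_sum]
    refine Finset.sum_congr rfl fun d _ => ?_
    simp only [hP₂]
    rw [Finset.prod_mul_distrib, Finset.prod_mul_distrib, Finset.prod_mul_distrib, ← ind_forall,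
      ← ind_forall, Finset.prod_const, Finset.card_univ, Fintype.card_fin]
    rfl
  rw [e1, e2]
  have hS10 : 0 ≤ ∑ c : Fin q → Fin n, ind (IsClosedWalk (colAdj A) c) * ∏ f, colMass A (c f) :=
    Finset.sum_nonneg fun c _ => mul_nonneg (ind_nonneg _)
      (Finset.prod_nonneg fun f _ => colMass_nonneg _)
  calc _ ≤ 2 ^ q * η ^ 2 * (4 ^ q * (((q * ((k * k + 1 : ℕ) : ℝ) ^ (q * q)) ^ 2 +
        q * 2 ^ q * (((k * k + 1 : ℕ) : ℝ) * ((k * k + 1 : ℕ) : ℝ) ^ (q * q)) *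
          (q * ((k * k + 1 : ℕ) : ℝ) ^ (q * q))) * (ρ ^ q) ^ 2)) +
        (2 ^ q * (350 * η) * (q * ((k * k + 1 : ℕ) : ℝ) ^ (q * q) * ρ ^ q)) ^ 2 := by
        gcongr
    _ = _ := by unfold errConst; ring

end Incidence


section Power

variable {n q k γ : ℕ} {η : ℝ} {z : Sizes} {A : Matrix (Fin n) (Fin n) ℤ}

/-! ## Comparison of the row norms with the Schatten norm -/

/-- Power mean inequality. -/
lemma sum_pow_le_card_mul_sum_pow {ι : Type*} (s : Finset ι) (x : ι → ℝ) (hx : ∀ i ∈ s, 0 ≤ x i)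
    {k : ℕ} (hs : s.card ≤ k) (q : ℕ) :
    (∑ i ∈ s, x i) ^ (q + 1) ≤ (k : ℝ) ^ q * ∑ i ∈ s, x i ^ (q + 1) := by
  have h0 : 0 ≤ ∑ i ∈ s, x i ^ (q + 1) := Finset.sum_nonneg fun i hi => pow_nonneg (hx i hi) _
  rcases s.eq_empty_or_nonempty with rfl | hne
  · simp
  · have h2 := pow_sum_div_card_le_sum_pow (s := s) (f := x) hx q
    have hc : (0 : ℝ) < s.card := by exact_mod_cast hne.card_pos
    rw [div_le_iff₀ (by positivity), mul_comm] at h2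
    refine h2.trans ?_
    gcongr

lemma one_le_of_isSparse (hk : IsSparse k A) (hF : 0 < frobSq A) : 1 ≤ k := by
  obtain ⟨i, j, h⟩ := exists_ne_of_frobSq_pos hF
  refine le_trans ?_ (hk.1 i)
  exact Finset.card_pos.2 ⟨j, by simpa using h⟩

lemma sum_ind_mul_eq_sum_filter {ι : Type*} [Fintype ι] (P : ι → Prop) [DecidablePred P]
    (x : ι → ℝ) : ∑ i, ind (P i) * x i = ∑ i ∈ Finset.univ.filter P, x i := by
  rw [Finset.sum_filter]
  exact Finset.sum_congr rfl fun i _ => (ite_eq_ind_mul _ _).symm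

/-- At most `k` rows meet a column, so the power mean inequality costs `k ^ q`; exchanging the sums
then counts every row at most `k` times. -/
lemma sum_colMass_pow_le (hk : IsSparse k A) :
    ∑ c, colMass A c ^ (q + 1) ≤ (k : ℝ) ^ (q + 1) * ∑ i, rowSq A i ^ (q + 1) := by
  have h1 : ∀ c, colMass A c ^ (q + 1) ≤
      (k : ℝ) ^ q * ∑ i, ind (A i c ≠ 0) * rowSq A i ^ (q + 1) := by
    intro c
    unfold colMass
    rw [sum_ind_mul_eq_sum_filter, sum_ind_mul_eq_sum_filter]
    exact sum_pow_le_card_mul_sum_pow _ _ (fun i _ => rowSq_nonneg A i) (hk.2 c) q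
  refine (Finset.sum_le_sum fun c _ => h1 c).trans ?_
  rw [← Finset.mul_sum, Finset.sum_comm, pow_succ, mul_assoc]
  gcongr
  rw [Finset.mul_sum]
  refine Finset.sum_le_sum fun i _ => ?_
  rw [← Finset.sum_mul]
  have h2 : ∑ c, ind (A i c ≠ 0) ≤ k := by
    have h3 := sum_ind_mul_eq_sum_filter (fun c => A i c ≠ 0) fun _ => (1 : ℝ)
    simp only [mul_one, Finset.sum_const, nsmul_eq_mul] at h3
    rw [h3]
    exact_mod_cast hk.1 i
  exact mul_le_mul_of_nonneg_right h2 (pow_nonneg (rowSq_nonneg A i) _)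

/-- A row has at most `k` non-zero entries, so the power mean inequality passes to powers of single
entries. In each column their sum is at most the same power of `colGram A c c`, and those powers are
bounded by `sum_colGram_pow_le_schattenPow`. -/
lemma sum_rowSq_pow_le (hk : IsSparse k A) :
    ∑ i, rowSq A i ^ (q + 1) ≤
      (k : ℝ) ^ q * schattenPow (2 * (q + 1)) (A.map (Int.cast : ℤ → ℝ)) := by
  have h1 : ∀ i, rowSq A i ^ (q + 1) ≤ (k : ℝ) ^ q * ∑ c, ((A i c : ℝ) ^ 2) ^ (q + 1) := by
    intro i
    have e1 : rowSq A i = ∑ c ∈ Finset.univ.filter (fun c => A i c ≠ 0), (A i c : ℝ) ^ 2 := by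
      unfold rowSq
      symm
      apply Finset.sum_subset (Finset.subset_univ _)
      intro c _ hc
      have : A i c = 0 := by simpa using hc
      simp [this]
    rw [e1]
    refine (sum_pow_le_card_mul_sum_pow _ _ (fun c _ => sq_nonneg _) (hk.1 i) q).trans ?_
    refine mul_le_mul_of_nonneg_left ?_ (by positivity)
    exact Finset.sum_le_sum_of_subset_of_nonneg (Finset.subset_univ _) fun c _ _ => by positivity
  refine (Finset.sum_le_sum fun i _ => h1 i).trans ?_
  rw [← Finset.mul_sum, Finset.sum_comm]
  refine mul_le_mul_of_nonneg_left ?_ (by positivity)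
  refine le_trans (Finset.sum_le_sum fun c _ => ?_) (sum_colGram_pow_le_schattenPow A (q + 1))
  have e2 : colGram A c c = ∑ i, (A i c : ℝ) ^ 2 :=
    Finset.sum_congr rfl fun i _ => (sq _).symm
  rw [e2, pow_succ, Finset.mul_sum]
  refine Finset.sum_le_sum fun i _ => ?_
  rw [pow_succ]
  gcongr
  exact Finset.single_le_sum (f := fun i => (A i c : ℝ) ^ 2) (fun _ _ => sq_nonneg _)
    (Finset.mem_univ i)

/-- The scale on which errors are measured. -/
lemma exists_scale (hq : 0 < q) (hz : SizeConditions n q k γ η z) (hk : IsSparse k A)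
    (hF : 0 < frobSq A) :
    ∃ ρ : ℝ, 0 < ρ ∧ (∀ c, colMass A c ≤ ρ) ∧ ∑ c, colMass A c ^ q ≤ ρ ^ q ∧
      frobSq A ≤ η ^ 2 * z.T * ρ ∧
      ρ ^ q ≤ (k : ℝ) ^ (2 * q) * schattenPow (2 * q) (A.map (Int.cast : ℤ → ℝ)) := by
  obtain ⟨q, rfl⟩ : ∃ q', q = q' + 1 := ⟨q - 1, by omega⟩
  have hk1 : (1 : ℝ) ≤ k := by exact_mod_cast one_le_of_isSparse hk hF
  set S := ∑ i, rowSq A i ^ (q + 1) with hS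
  have hn : 0 < n := (exists_ne_of_frobSq_pos hF).choose.pos
  have hn' : (0 : ℝ) < n := by exact_mod_cast hn
  have hFS : frobSq A ^ (q + 1) ≤ (n : ℝ) ^ q * S := by
    rw [frobSq_eq_sum_rowSq]
    exact sum_pow_le_card_mul_sum_pow Finset.univ _ (fun i _ => rowSq_nonneg A i) (by simp) q
  have hSpos : 0 < S := by
    have : 0 < (n : ℝ) ^ q * S := lt_of_lt_of_le (by positivity) hFS
    exact (mul_pos_iff_of_pos_left (by positivity)).1 this
  set X := (k : ℝ) ^ (q + 1) * S with hX
  have hXpos : 0 < X := by positivity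
  have hSX : S ≤ X := le_mul_of_one_le_left hSpos.le (one_le_pow₀ hk1)
  -- After the substitution there are `q + 1` factors, and `ρ ^ (q + 1) = X` is exactly the
  -- available bound on the powers of the column masses.
  set ρ := X ^ (1 / ((q : ℝ) + 1)) with hρ
  have hρpos : 0 < ρ := Real.rpow_pos_of_pos hXpos _
  have hρq : ρ ^ (q + 1) = X := by
    rw [hρ, ← Real.rpow_natCast, ← Real.rpow_mul hXpos.le]
    push_cast
    rw [one_div_mul_cancel (by positivity), Real.rpow_one]
  have hsum := sum_colMass_pow_le (q := q) hk
  refine ⟨ρ, hρpos, fun c => ?_, ?_, ?_, ?_⟩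
  · rw [← pow_le_pow_iff_left₀ (colMass_nonneg c) hρpos.le (Nat.succ_ne_zero q), hρq]
    exact (Finset.single_le_sum (f := fun c => colMass A c ^ (q + 1))
      (fun c _ => pow_nonneg (colMass_nonneg c) _) (Finset.mem_univ c)).trans hsum
  · rw [hρq]; exact hsum
  · have hT := hz.T_large
    push_cast at hT
    set ν := (n : ℝ) ^ (1 - 1 / ((q : ℝ) + 1)) with hν
    have hνpos : 0 < ν := Real.rpow_pos_of_pos hn' _
    have hνq : ν ^ (q + 1) = (n : ℝ) ^ q := by
      rw [hν, ← Real.rpow_natCast, ← Real.rpow_mul hn'.le, ← Real.rpow_natCast (n : ℝ) q]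
      congr 1
      push_cast
      field_simp
      ring
    -- Power mean inequality over all `n` rows. Its factor `ν = n ^ (1 - 1/(q+1))` is the reason for
    -- the power of `n` in `T`.
    have h1 : frobSq A ≤ ν * ρ := by
      rw [← pow_le_pow_iff_left₀ hF.le (by positivity) (Nat.succ_ne_zero q), mul_pow, hνq, hρq]
      refine hFS.trans ?_
      gcongr
    refine h1.trans ?_
    gcongr
  · rw [hρq, hX]
    have h2 := sum_rowSq_pow_le (q := q) hk
    set Sch := schattenPow (2 * (q + 1)) (A.map (Int.cast : ℤ → ℝ))
    have hSch : 0 < Sch := by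
      have : 0 < (k : ℝ) ^ q * Sch := lt_of_lt_of_le hSpos h2
      exact (mul_pos_iff_of_pos_left (by positivity)).1 this
    calc (k : ℝ) ^ (q + 1) * S ≤ (k : ℝ) ^ (q + 1) * ((k : ℝ) ^ q * Sch) := by gcongr
      _ = (k : ℝ) ^ (2 * q + 1) * Sch := by ring
      _ ≤ (k : ℝ) ^ (2 * (q + 1)) * Sch := by
          gcongr
          omega

end Power

section Algorithm

variable {n q k γ : ℕ} {η : ℝ} {z : Sizes} {A : Matrix (Fin n) (Fin n) ℤ}

/-! ## The algorithm -/

/-- The sketches of `A` itself are accurate. -/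
def aGood (A : Matrix (Fin n) (Fin n) ℤ) (η : ℝ) (s₁ : Fin q → CSSeed z.κ z.m z.d)
    (s₂ : AMSSeed z.κ z.m z.d z.V) : Prop :=
  |amsEst s₂ (amsTable s₂ A : AMSTable z.d z.V z.b) - frobSq A| ≤ η * frobSq A ∧
  ∀ f i j, |csEst (s₁ f) (csTable (s₁ f) A : CSTable z.d z.aS z.b) i j - A i j| ≤
    √(frobSq A / (2 * z.wS))

lemma avg_not_aGood_le (hz : SizeConditions n q k γ η z) (hA : ∀ i j, |A i j| ≤ (n : ℤ) ^ γ)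
    (hF : 0 < frobSq A) :
    avg (fun s : (Fin q → CSSeed z.κ z.m z.d) × AMSSeed z.κ z.m z.d z.V =>
      ind (¬ aGood (z := z) A η s.1 s.2)) ≤
      ((n : ℝ) ^ 2 + 1) * (1 / 4) ^ (z.d + 1) * (q + 1) := by
  have hAb := sum_abs_lt hz hA
  have hw : (0 : ℝ) < z.wS := by exact_mod_cast hz.wS_pos
  have hκ := hz.kappa_ge
  have hη := hz.eta_pos
  have h1 : ∀ s : (Fin q → CSSeed z.κ z.m z.d) × AMSSeed z.κ z.m z.d z.V,
      ind (¬ aGood (z := z) A η s.1 s.2) ≤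
      ind (¬ |amsEst s.2 (amsTable s.2 A : AMSTable z.d z.V z.b) - frobSq A| ≤ η * frobSq A) +
      ∑ f, ind (¬ ∀ i j, |csEst (s.1 f) (csTable (s.1 f) A : CSTable z.d z.aS z.b) i j - A i j| ≤
        √(frobSq A / (2 * z.wS))) := by
    intro s
    refine le_trans (le_trans (ind_mono ?_) (ind_or_le _ _))
      (add_le_add le_rfl (ind_exists_le fun f => ¬ ∀ i j,
        |csEst (s.1 f) (csTable (s.1 f) A : CSTable z.d z.aS z.b) i j - A i j| ≤
        √(frobSq A / (2 * z.wS))))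
    intro h
    unfold aGood at h
    rw [not_and_or] at h
    rcases h with h | h
    · exact Or.inl h
    · exact Or.inr (not_forall.1 h)
  refine (avg_mono h1).trans ?_
  rw [avg_add, avg_sum, avg_snd (fun y : AMSSeed z.κ z.m z.d z.V => ind (¬
    |amsEst y (amsTable y A : AMSTable z.d z.V z.b) - frobSq A| ≤ η * frobSq A))]
  have h2 : avg (fun y : AMSSeed z.κ z.m z.d z.V => ind (¬
      |amsEst y (amsTable y A : AMSTable z.d z.V z.b) - frobSq A| ≤ η * frobSq A)) ≤
      (1 / 4) ^ (z.d + 1) := by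
    refine (avg_ind_amsEst_error_le A hz.m_ne hz.kappa_ge hz.sq_le hz.V_pos hF hAb hη).trans ?_
    have hV : (0 : ℝ) < z.V := by exact_mod_cast hz.V_pos
    gcongr
    have h1 := hz.V_large
    rw [mul_div_assoc', div_le_iff₀ (by positivity)]
    linarith
  have h3 : ∀ f : Fin q, avg (fun s : (Fin q → CSSeed z.κ z.m z.d) × AMSSeed z.κ z.m z.d z.V =>
      ind (¬ ∀ i j, |csEst (s.1 f) (csTable (s.1 f) A : CSTable z.d z.aS z.b) i j - A i j| ≤
        √(frobSq A / (2 * z.wS)))) ≤ (n : ℝ) ^ 2 * (1 / 4) ^ (z.d + 1) := by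
    intro f
    rw [avg_fst (fun y : Fin q → CSSeed z.κ z.m z.d =>
      ind (¬ ∀ i j, |csEst (y f) (csTable (y f) A : CSTable z.d z.aS z.b) i j - A i j| ≤
        √(frobSq A / (2 * z.wS)))),
      avg_pi_eval f (fun y : CSSeed z.κ z.m z.d =>
      ind (¬ ∀ i j, |csEst y (csTable y A : CSTable z.d z.aS z.b) i j - A i j| ≤
        √(frobSq A / (2 * z.wS))))]
    refine (avg_ind_csEst_error_le A hz.m_ne (by omega) hz.aS_le hz.sq_le hAb
      (by positivity)).trans ?_
    gcongr
    have hwd : (32 : ℝ) * z.wS ≤ 2 ^ z.aS := by exact_mod_cast hz.widthS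
    rw [div_div, mul_div_assoc', div_le_iff₀ (by positivity)]
    calc 4 * frobSq A = 1 / 4 * (32 * z.wS * (frobSq A / (2 * z.wS))) := by field_simp; ring
      _ ≤ _ := by gcongr
  refine (add_le_add h2 (Finset.sum_le_sum fun f _ => h3 f)).trans ?_
  simp only [Finset.sum_const, Finset.card_univ, Fintype.card_fin, nsmul_eq_mul]
  have hp : (0 : ℝ) ≤ (1 / 4) ^ (z.d + 1) := by positivity
  have hq0 : (0 : ℝ) ≤ q := by positivity
  have hn2 : (0 : ℝ) ≤ (n : ℝ) ^ 2 := by positivity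
  nlinarith [mul_nonneg hp hq0, mul_nonneg hp hn2]

lemma normEstimate_of_aGood (hz : SizeConditions n q k γ η z) (hF : 0 < frobSq A)
    {s : AlgSeed q z} (hs : aGood A η s.1 s.2.1) :
    NormEstimate A η (algL s (algTable s A)) (z.thr * algL s (algTable s A)) where
  frob_pos := hF
  close := hs.1
  theta_eq := by rw [hz.thr_eq]

/-- The rows in `K_f` are estimated accurately. -/
lemma heavyEst_accurate (hz : SizeConditions n q k γ η z) (hk : IsSparse k A) (hF : 0 < frobSq A)
    {s : AlgSeed q z} (hs : aGood A η s.1 s.2.1) {f : Fin q} {i : Fin n}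
    (hi : i ∈ heavySet s (algTable s A) f) (c c' : Fin n) :
    |heavyEst s (algTable s A) f i c * heavyEst s (algTable s A) f i c' - A i c * A i c'| ≤
      350 * η * (ind (A i c ≠ 0) * ind (A i c' ≠ 0) * rowSq A i) := by
  have hη := hz.eta_pos
  have hη' := hz.eta_le
  have hL := normEstimate_of_aGood hz hF hs
  have hLhalf := hL.half_le hz
  have hT : (0 : ℝ) < z.T := by exact_mod_cast hz.T_pos
  have hw : (0 : ℝ) < z.wS := by exact_mod_cast hz.wS_pos
  set L := algL s (algTable s A) with hLdef
  have hL0 : 0 < L := by linarith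
  set g := √(L / z.wS) with hg
  have hg2 : g ^ 2 = L / z.wS := Real.sq_sqrt (by positivity)
  have hspec : ∀ j, |heavyEst s (algTable s A) f i j - A i j| ≤ 3 * g ∧
      |heavyEst s (algTable s A) f i j| ≤ 2 * |(A i j : ℝ)| := by
    intro j
    apply retain_spec
    refine (hs.2 f i j).trans (Real.sqrt_le_sqrt ?_)
    rw [div_le_div_iff₀ (by positivity) hw]
    nlinarith
  have hzero : ∀ j, A i j = 0 → heavyEst s (algTable s A) f i j = 0 := by
    intro j hj
    have := (hspec j).2
    rw [hj] at this
    simpa using this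
  by_cases hinc : A i c ≠ 0 ∧ A i c' ≠ 0
  · rw [ind_true hinc.1, ind_true hinc.2, one_mul, one_mul]
    have hrow : normSq (fun j => (A i j : ℝ)) = rowSq A i := normSq_eq_sum _
    have hcand : L / (10 * z.T) ≤ normSq (heavyEst s (algTable s A) f i) := by
      have h1 := (Finset.mem_filter.1 hi).1
      exact (Finset.mem_filter.1 h1).2
    have hup : normSq (heavyEst s (algTable s A) f i) ≤ 4 * rowSq A i := by
      rw [normSq_eq_sum, rowSq, Finset.mul_sum]
      refine Finset.sum_le_sum fun j _ => ?_
      have : heavyEst s (algTable s A) f i j ^ 2 ≤ (2 * |(A i j : ℝ)|) ^ 2 := by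
        rw [← sq_abs]
        gcongr
        exact (hspec j).2
      refine this.trans (le_of_eq ?_)
      rw [mul_pow, sq_abs]; ring
    -- A row of `K_f` has squared norm at least `L / (40 T)`; with `wS ≥ 200 k T / η²` the noise `L
    -- / wS` per entry is small compared with it.
    have hLx : L ≤ 40 * z.T * rowSq A i := by
      have := hcand.trans hup
      rw [div_le_iff₀ (by positivity)] at this
      linarith
    have hclose : normSq (heavyEst s (algTable s A) f i - fun j => (A i j : ℝ)) ≤
        4 * η ^ 2 * normSq (fun j => (A i j : ℝ)) := by
      rw [hrow]
      refine (normSq_sub_le_of_sparse (k := k) (g := g) _ _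
        (Finset.univ.filter fun j => A i j ≠ 0) (hk.1 i) ?_ fun j => (hspec j).1).trans ?_
      · intro j hj
        have h0 : A i j = 0 := by simpa using hj
        exact ⟨hzero j h0, by simp [h0]⟩
      · rw [hg2]
        have hx := rowSq_nonneg A i
        have h4 := hz.wS_large
        calc (k : ℝ) * (9 * (L / z.wS)) ≤ k * (9 * ((40 * z.T * rowSq A i) / z.wS)) := by gcongr
          _ = (9 / 5 * (200 * k * z.T)) * rowSq A i / z.wS := by ring
          _ ≤ (9 / 5 * (η ^ 2 * z.wS)) * rowSq A i / z.wS := by gcongr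
          _ = 9 / 5 * η ^ 2 * rowSq A i := by field_simp
          _ ≤ _ := by nlinarith [mul_nonneg (sq_nonneg η) hx]
    have h5 := (normSq_and_products_close hη hη' _ _ hclose).2 c c'
    rw [hrow] at h5
    refine h5.trans ?_
    have hx := rowSq_nonneg A i
    gcongr
    norm_num
  · have h2 : heavyEst s (algTable s A) f i c * heavyEst s (algTable s A) f i c' -
        A i c * A i c' = 0 := by
      rw [not_and_or, not_not, not_not] at hinc
      rcases hinc with h | h <;> simp [h, hzero _ h]
    rw [h2, abs_zero]
    have hx := rowSq_nonneg A i
    have := ind_nonneg (A i c ≠ 0)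
    have := ind_nonneg (A i c' ≠ 0)
    positivity

/-- The estimator as a sum over closed walks. -/
lemma estimator_eq_cyclicSum (s : AlgSeed q z) (M : AlgMem q z) :
    estimator n s M = cyclicSum fun f c c' => ∑ l ∈ labels n s M f,
      ((if l.isRight then 1 / (z.T : ℝ) else 1) * labelWeight s M f l) *
        (labelRow s M f l c * labelRow s M f l c') := by
  classical
  rw [← sum_prod_dotProduct_eq_cyclicSum (fun f => labels n s M f)
    (fun f l => labelRow s M f l)
    (fun f l => (if l.isRight then 1 / (z.T : ℝ) else 1) * labelWeight s M f l)]
  unfold estimator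
  refine Finset.sum_congr (by congr!) fun l _ => ?_
  rw [Finset.prod_mul_distrib (f := fun f => if (l f).isRight then 1 / (z.T : ℝ) else 1),
    Finset.prod_ite, Finset.prod_const, Finset.prod_const_one, mul_one, one_div_pow]
  ring

/-- The matrix formed by the estimates of the heavy rows. -/
noncomputable def heavyMatrix (s : AlgSeed q z) (M : AlgMem q z) (f : Fin q) (c c' : Fin n) : ℝ :=
  ∑ i ∈ heavySet s M f, heavyEst s M f i c * heavyEst s M f i c'

lemma sampleTerm_some (K : Finset (Fin n)) (L : ℝ) (c c' : Fin n) (x : Fin n × (Fin n → ℝ)) :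
    sampleTerm K L c c' (some x) = ind (x.1 ∉ K) * (L / normSq x.2 * (x.2 c * x.2 c')) := by
  have h1 : ∀ i, isRow i (some x) ↔ x.1 = i := by
    intro i
    constructor
    · rintro ⟨v, hv⟩
      simp only [Option.some.injEq] at hv
      rw [hv]
    · rintro rfl
      exact ⟨x.2, rfl⟩
  unfold sampleTerm dirProd
  by_cases hK : x.1 ∈ K
  · rw [ind_false (not_not.2 hK), zero_mul]
    refine Finset.sum_eq_zero fun i hi => ?_
    rw [ind_false, zero_mul]
    rw [h1]
    rintro rfl
    exact Finset.mem_compl.1 hi hK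
  · rw [Finset.sum_eq_single_of_mem x.1 (Finset.mem_compl.2 hK), ind_true ((h1 _).2 rfl),
      ind_true hK]
    · ring
    · intro i _ hi
      rw [ind_false, zero_mul]
      rw [h1]
      exact fun e => hi e.symm

/-- On the event that all sketches are accurate, the estimator is a cyclic sum of the factor
matrices. -/
lemma estimator_eq_of_good {s : AlgSeed q z} (hs : ∀ f t r, pGood A (s.2.2 f t r)) :
    estimator n s (algTable s A) = cyclicSum fun f =>
      factorMatrix (heavyMatrix s (algTable s A) f) (heavySet s (algTable s A) f) A
        (algL s (algTable s A)) (z.thr * algL s (algTable s A)) (s.2.2 f) := by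
  classical
  rw [estimator_eq_cyclicSum]
  congr 1
  funext f c c'
  set M := algTable s A with hM
  -- Repetitions with accurate sketches are never discarded, so the actual sample is the idealized
  -- one.
  have hsample : ∀ t, sample n s M f t = sOut A (z.thr * algL s M) (s.2.2 f t) := by
    intro t
    unfold sample sOut
    congr 1
    funext r
    unfold pOut
    rw [if_pos (hs f t r)]
    rfl
  unfold factorMatrix heavyMatrix labels
  rw [Finset.sum_filter, Fintype.sum_sum_type]
  congr 1
  · dsimp only
    have key : ∀ (K : Finset (Fin n)) (dec : ∀ i, Decidable (i ∈ K)) (g : Fin n → ℝ),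
        (∑ i, @ite _ (i ∈ K) (dec i) (g i) 0) = ∑ i ∈ K, g i := by
      intro K dec g
      rw [← Finset.sum_filter]
      simp
    refine (key _ _ _).trans (Finset.sum_congr rfl fun i _ => ?_)
    simp [labelWeight, labelRow]
  · dsimp only
    rw [Finset.sum_div]
    refine Finset.sum_congr rfl fun t _ => ?_
    rw [← hsample t]
    obtain hx | ⟨x, hx⟩ := (sample n s M f t).eq_none_or_eq_some
    · have hterm : sampleTerm (heavySet s M f) (algL s M) c c' (sample n s M f t) = 0 := by
        simp [hx, sampleTerm, dirProd]
      rw [hterm, if_neg (by simp [hx]), zero_div]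
    · have hterm : sampleTerm (heavySet s M f) (algL s M) c c' (sample n s M f t) =
          ind (x.1 ∉ heavySet s M f) * (algL s M / normSq x.2 * (x.2 c * x.2 c')) := by
        rw [hx, sampleTerm_some]
      rw [hterm]
      by_cases hK : x.1 ∈ heavySet s M f
      · rw [ind_false (not_not.2 hK), if_neg]
        · simp
        · rintro ⟨y, hy, hy'⟩
          rw [hx, Option.some.injEq] at hy
          exact hy' (hy ▸ hK)
      · rw [ind_true hK, if_pos ⟨x, hx, hK⟩]
        simp only [labelWeight, labelRow, hx, Sum.isRight_inr, if_true, Option.map_some,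
          Option.getD_some]
        ring

end Algorithm


section Correctness

variable {n q k γ : ℕ} {η ε : ℝ} {z : Sizes} {A : Matrix (Fin n) (Fin n) ℤ}

/-! ## Correctness -/

lemma retain_zero (t : ℝ) : retain t 0 = 0 := by simp [retain]

lemma csEst_zero {κ m d a b : ℕ} (s : CSSeed κ m d) (i j : Fin n) :
    csEst s (0 : CSTable d a b) i j = 0 := by
  unfold csEst median
  simp

/-- With zero tables all Count-Sketch estimates are zero, whatever the thresholds are. This settles
the zero matrix, for which no error is permitted. -/
lemma labelRow_zero (s : AlgSeed q z) (f : Fin q) (l : Fin n ⊕ Fin z.T) :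
    labelRow s 0 f l = 0 := by
  rcases l with i | t
  · funext j
    change retain _ (csEst (s.1 f) 0 i j) = 0
    rw [csEst_zero, retain_zero]
  · change ((sample n s 0 f t).map Prod.snd).getD 0 = 0
    obtain hx | ⟨x, hx⟩ := (sample n s 0 f t).eq_none_or_eq_some
    · simp [hx]
    · rw [hx]
      obtain ⟨r, _, hr⟩ := List.exists_of_findSome?_eq_some hx
      unfold pSample at hr
      split at hr
      · rw [Option.some.injEq] at hr
        rw [← hr]
        funext j
        change _ * retain _ (csEst (s.2.2 f t r).2.1 0 _ j / _) = 0
        rw [csEst_zero, zero_div, retain_zero, mul_zero]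
      · cases hr

lemma estimator_zero (hq : 0 < q) (s : AlgSeed q z) : estimator n s 0 = 0 := by
  unfold estimator
  refine Finset.sum_eq_zero fun l _ => ?_
  rw [Finset.prod_eq_zero (Finset.mem_univ (⟨0, hq⟩ : Fin q)), zero_mul, mul_zero]
  rw [labelRow_zero, zero_dotProduct]

lemma algTable_zero (s : AlgSeed q z) : algTable s (0 : Matrix (Fin n) (Fin n) ℤ) = 0 := by
  have h := foldl_algUpdate s ([] : List (Update n))
  have h0 : streamMatrix ([] : List (Update n)) = 0 := by
    funext i j; simp [streamMatrix]
  rw [h0] at h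
  exact h.symm

lemma schattenPow_zero (hq : 0 < q) :
    schattenPow (2 * q) ((0 : Matrix (Fin n) (Fin n) ℤ).map (Int.cast : ℤ → ℝ)) = 0 := by
  rw [schattenPow_eq_cyclicSum hq]
  unfold cyclicSum
  refine Finset.sum_eq_zero fun c _ => Finset.prod_eq_zero (Finset.mem_univ (⟨0, hq⟩ : Fin q)) ?_
  simp [colGram]

lemma algL_algTable (s : AlgSeed q z) (A : Matrix (Fin n) (Fin n) ℤ) :
    algL s (algTable s A) = amsEst s.2.1 (amsTable s.2.1 A : AMSTable z.d z.V z.b) := rfl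

lemma heavyEst_algTable (s : AlgSeed q z) (A : Matrix (Fin n) (Fin n) ℤ) (f : Fin q) (i : Fin n) :
    heavyEst s (algTable s A) f i =
      fun j => retain (2 * √(amsEst s.2.1 (amsTable s.2.1 A : AMSTable z.d z.V z.b) / z.wS))
        (csEst (s.1 f) (csTable (s.1 f) A : CSTable z.d z.aS z.b) i j) := rfl

/-! The heavy rows and the norm estimate do not depend on the seeds of the precision samplers. -/

lemma algL_congr {s s' : AlgSeed q z} (h₂ : s.2.1 = s'.2.1) :
    algL s (algTable s A) = algL s' (algTable s' A) := by
  rw [algL_algTable, algL_algTable, h₂]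

lemma heavyEst_congr {s s' : AlgSeed q z} (h₁ : s.1 = s'.1) (h₂ : s.2.1 = s'.2.1) (f : Fin q)
    (i : Fin n) : heavyEst s (algTable s A) f i = heavyEst s' (algTable s' A) f i := by
  rw [heavyEst_algTable, heavyEst_algTable, h₁, h₂]

lemma heavySet_congr {s s' : AlgSeed q z} (h₁ : s.1 = s'.1) (h₂ : s.2.1 = s'.2.1) (f : Fin q) :
    heavySet (n := n) s (algTable s A) f = heavySet s' (algTable s' A) f := by
  simp only [heavySet, heavyCandidates, algL_congr h₂, heavyEst_congr h₁ h₂]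
  congr!

lemma heavyMatrix_congr {s s' : AlgSeed q z} (h₁ : s.1 = s'.1) (h₂ : s.2.1 = s'.2.1)
    (f : Fin q) :
    heavyMatrix (n := n) s (algTable s A) f = heavyMatrix s' (algTable s' A) f := by
  funext c c'
  simp only [heavyMatrix, heavySet_congr h₁ h₂, heavyEst_congr h₁ h₂]

/-- The estimator with the accurate outcomes of the precision samplers. -/
noncomputable def idealEstimator (A : Matrix (Fin n) (Fin n) ℤ) (s : AlgSeed q z) : ℝ :=
  cyclicSum fun f =>
    factorMatrix (heavyMatrix s (algTable s A) f) (heavySet s (algTable s A) f) A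
      (algL s (algTable s A)) (z.thr * algL s (algTable s A)) (s.2.2 f)

lemma errConst_nonneg (k q : ℕ) : 0 ≤ errConst k q := by
  unfold errConst
  positivity

/-- Fixing the seeds of the sketches of `A` fixes `L`, the sets `K_f` and their estimated rows. The
remaining seeds are those of independent samplers, to which the mean square bound and Chebyshev's
inequality apply. -/
lemma avg_idealEstimator_error_le (hq : 0 < q) (hz : SizeConditions n q k γ η z)
    (hk : IsSparse k A) (hA : ∀ i j, |A i j| ≤ (n : ℤ) ^ γ) (hF : 0 < frobSq A) (hε : 0 < ε)
    (hacc : errConst k q * η ^ 2 * (k : ℝ) ^ (4 * q) ≤ ε ^ 2 / 4) :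
    avg (fun s : AlgSeed q z => ind (aGood A η s.1 s.2.1 ∧
      ε * schattenPow (2 * q) (A.map (Int.cast : ℤ → ℝ)) ≤
        |idealEstimator A s - schattenPow (2 * q) (A.map (Int.cast : ℤ → ℝ))|)) ≤ 1 / 4 := by
  obtain ⟨ρ, hρ, hmass, hmassq, hFρ, hρS⟩ := exists_scale hq hz hk hF
  have hη := hz.eta_pos
  set Sch := schattenPow (2 * q) (A.map (Int.cast : ℤ → ℝ)) with hSch
  have hSpos : 0 < Sch := by
    have : 0 < (k : ℝ) ^ (2 * q) * Sch := lt_of_lt_of_le (by positivity) hρS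
    exact (mul_pos_iff_of_pos_left (by
      have : (1 : ℝ) ≤ k := by exact_mod_cast one_le_of_isSparse hk hF
      positivity)).1 this
  rw [avg_prod]
  refine avg_le_of_forall_le fun x => ?_
  rw [avg_prod]
  refine avg_le_of_forall_le fun y => ?_
  by_cases hg : aGood A η x y
  · set s₀ : AlgSeed q z := (x, y, fun _ _ _ => Classical.arbitrary _) with hs₀
    have hg₀ : aGood A η s₀.1 s₀.2.1 := hg
    set M₀ := algTable s₀ A with hM₀
    have hid : ∀ ω : Fin q → Fin z.T → Fin z.R → PSeed z, idealEstimator A (x, y, ω) =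
        cyclicSum fun f => factorMatrix (heavyMatrix s₀ M₀ f) (heavySet s₀ M₀ f) A
          (algL s₀ M₀) (z.thr * algL s₀ M₀) (ω f) := by
      intro ω
      unfold idealEstimator
      refine congrArg cyclicSum (funext fun f => ?_)
      rw [heavyMatrix_congr (s := (x, y, ω)) (s' := s₀) rfl rfl, heavySet_congr (s := (x, y, ω)) (s' := s₀) rfl rfl,
        algL_congr (s := (x, y, ω)) (s' := s₀) rfl]
    have herr := avg_factorMatrix_error_le hq hz hk hA (normEstimate_of_aGood hz hF hg₀)
      (fun f => heavySet s₀ M₀ f) (fun f => heavyMatrix s₀ M₀ f) (by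
        intro f c c'
        unfold heavyMatrix
        rw [← Finset.sum_sub_distrib, Finset.mul_sum]
        refine (Finset.abs_sum_le_sum_abs _ _).trans (Finset.sum_le_sum fun i hi => ?_)
        exact heavyEst_accurate hz hk hF hg₀ hi c c') hρ.le hmass hmassq hFρ
    have hcheb := avg_ind_le_div (Ω := Fin q → Fin z.T → Fin z.R → PSeed z)
      (P := fun ω => aGood A η x y ∧ ε * Sch ≤ |idealEstimator A (x, y, ω) - Sch|)
      (g := fun ω => (idealEstimator A (x, y, ω) - Sch) ^ 2) (a := (ε * Sch) ^ 2)
      (by positivity) (fun _ => sq_nonneg _) (by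
        intro ω h
        rw [← sq_abs (idealEstimator A (x, y, ω) - Sch)]
        exact pow_le_pow_left₀ (by positivity) h.2 2)
    refine hcheb.trans ?_
    rw [div_le_iff₀ (by positivity)]
    simp only [hid]
    rw [← schattenPow_eq_cyclicSum hq, ← hSch] at herr
    refine herr.trans ?_
    have he := errConst_nonneg k q
    calc errConst k q * η ^ 2 * (ρ ^ q) ^ 2
        ≤ errConst k q * η ^ 2 * ((k : ℝ) ^ (2 * q) * Sch) ^ 2 := by gcongr
      _ = errConst k q * η ^ 2 * (k : ℝ) ^ (4 * q) * Sch ^ 2 := by ring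
      _ ≤ ε ^ 2 / 4 * Sch ^ 2 := by gcongr
      _ = 1 / 4 * (ε * Sch) ^ 2 := by ring
  · refine (avg_mono (g := fun _ => 0) fun ω => ?_).trans ?_
    · rw [ind_false fun h => hg h.1]
    · rw [avg_zero]; norm_num

/-- The algorithm is correct for all sizes that satisfy the size conditions. -/
theorem le_prob_sizedAlgorithm (hq : 0 < q) (hz : SizeConditions n q k γ η z) (hε : 0 < ε)
    (hacc : errConst k q * η ^ 2 * (k : ℝ) ^ (4 * q) ≤ ε ^ 2 / 4) (σ : List (Update n))
    (hk : IsSparse k (streamMatrix σ)) (hA : ∀ i j, |streamMatrix σ i j| ≤ (n : ℤ) ^ γ) :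
    2 / 3 ≤ (sizedAlgorithm n q z).prob σ fun Y =>
      |Y - schattenPow (2 * q) ((streamMatrix σ).map (Int.cast : ℤ → ℝ))| ≤
        ε * schattenPow (2 * q) ((streamMatrix σ).map (Int.cast : ℤ → ℝ)) := by
  set A := streamMatrix σ with hAdef
  set Sch := schattenPow (2 * q) (A.map (Int.cast : ℤ → ℝ)) with hSch
  have hprob : (sizedAlgorithm n q z).prob σ (fun Y => |Y - Sch| ≤ ε * Sch) =
      avg fun s : AlgSeed q z => ind (|estimator n s (algTable s A) - Sch| ≤ ε * Sch) := by
    rw [← card_div_card_eq_avg]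
    simp only [hAdef, ← foldl_algUpdate]
    rfl
  rw [hprob]
  have hF0 : 0 ≤ frobSq A := Finset.sum_nonneg fun _ _ => sq_nonneg _
  rcases hF0.eq_or_lt with hF | hF
  · have hA0 : A = 0 := by
      by_contra h
      obtain ⟨i, j, hij⟩ : ∃ i j, A i j ≠ 0 := by
        by_contra! h'
        exact h (by ext i j; exact h' i j)
      exact absurd (frobSq_pos_of_ne hij) (by rw [← hF]; exact lt_irrefl _)
    have h1 : ∀ s : AlgSeed q z, ind (|estimator n s (algTable s A) - Sch| ≤ ε * Sch) = 1 := by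
      intro s
      apply ind_true
      rw [hSch, hA0, schattenPow_zero hq, algTable_zero, estimator_zero hq]
      simp
    simp only [h1, avg_const]
    norm_num
  · have hpt : ∀ s : AlgSeed q z,
        ind (¬ |estimator n s (algTable s A) - Sch| ≤ ε * Sch) ≤
        ind (¬ aGood A η s.1 s.2.1) + ∑ f, ∑ t, ∑ r, ind (¬ pGood A (s.2.2 f t r)) +
        ind (aGood A η s.1 s.2.1 ∧ ε * Sch ≤ |idealEstimator A s - Sch|) := by
      intro s
      have h2 : ind (∃ f t r, ¬ pGood A (s.2.2 f t r)) ≤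
          ∑ f, ∑ t, ∑ r, ind (¬ pGood A (s.2.2 f t r)) :=
        (ind_exists_le _).trans <| Finset.sum_le_sum fun f _ =>
          (ind_exists_le _).trans <| Finset.sum_le_sum fun t _ => ind_exists_le _
      refine le_trans ?_ (add_le_add_left (add_le_add_right h2 _) _)
      refine le_trans ?_ ((ind_or_le _ _).trans (add_le_add_left (ind_or_le _ _) _))
      apply ind_mono
      intro hbad
      by_cases h3 : aGood A η s.1 s.2.1
      · by_cases h4 : ∀ f t r, pGood A (s.2.2 f t r)
        · refine Or.inr ⟨h3, ?_⟩
          rw [estimator_eq_of_good h4] at hbad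
          exact (not_le.1 hbad).le
        · left; right
          push Not at h4
          exact h4
      · exact Or.inl (Or.inl h3)
    have havg := avg_mono hpt
    rw [avg_add, avg_add] at havg
    have hb1 : avg (fun s : AlgSeed q z => ind (¬ aGood A η s.1 s.2.1)) ≤
        ((n : ℝ) ^ 2 + 1) * (1 / 4) ^ (z.d + 1) * (q + 1) := by
      refine le_trans (le_of_eq ?_) (avg_not_aGood_le hz hA hF)
      rw [avg_prod, avg_prod]
      refine avg_congr fun x => ?_
      exact avg_fst fun y => ind (¬ aGood A η x y)
    have hb2 : avg (fun s : AlgSeed q z => ∑ f, ∑ t, ∑ r, ind (¬ pGood A (s.2.2 f t r))) ≤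
        q * (z.T * (z.R * (((n : ℝ) ^ 2 + 1) * (1 / 4) ^ (z.d + 1)))) := by
      have h := avg_not_pGood_le hz hA hF
      simp only [avg_sum]
      refine (Finset.sum_le_sum fun f _ => Finset.sum_le_sum fun t _ =>
        Finset.sum_le_sum fun r _ => (?_ : _ ≤ ((n : ℝ) ^ 2 + 1) * (1 / 4) ^ (z.d + 1))).trans
        (le_of_eq (by simp))
      refine le_trans (le_of_eq ?_) h
      rw [avg_prod]
      simp only [avg_const, avg_snd fun ω : Fin q → Fin z.T → Fin z.R → PSeed z =>
        ind (¬ pGood A (ω f t r))]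
      rw [avg_pi_eval f fun ω : Fin z.T → Fin z.R → PSeed z => ind (¬ pGood A (ω t r)),
        avg_pi_eval t fun ω : Fin z.R → PSeed z => ind (¬ pGood A (ω r)),
        avg_pi_eval r fun s : PSeed z => ind (¬ pGood A s)]
    have hb3 := avg_idealEstimator_error_le hq hz hk hA hF hε hacc
    have hall := hz.failAll
    have hnot : avg (fun s : AlgSeed q z =>
        ind (¬ |estimator n s (algTable s A) - Sch| ≤ ε * Sch)) =
        1 - avg fun s : AlgSeed q z => ind (|estimator n s (algTable s A) - Sch| ≤ ε * Sch) := by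
      simp only [ind_not]
      rw [avg_sub, avg_const]
    -- All sketch failures together have probability at most `1/20`, and Chebyshev's inequality
    -- gives `1/4`; the sum `3/10` is below `1/3`.
    have : ((n : ℝ) ^ 2 + 1) * (1 / 4) ^ (z.d + 1) * (q + 1) +
        q * (z.T * (z.R * (((n : ℝ) ^ 2 + 1) * (1 / 4) ^ (z.d + 1)))) =
        ((n : ℝ) ^ 2 + 1) * (1 / 4) ^ (z.d + 1) * (q * z.T * z.R + q + 1) := by ring
    linarith

end Correctness


section Sizes

/-! ## Choice of the constants -/

lemma pow_le_two_pow {x : ℝ} {M m : ℕ} (hx : 1 ≤ x) (h : 2 * M * Real.log x ≤ m) :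
    x ^ M ≤ 2 ^ m := by
  have hx0 : 0 < x := by linarith
  rw [← Real.log_le_log_iff (by positivity) (by positivity), Real.log_pow, Real.log_pow]
  have h2 : (1 / 2 : ℝ) ≤ Real.log 2 := by have := Real.log_two_gt_d9; linarith
  nlinarith [(Nat.cast_nonneg m : (0 : ℝ) ≤ m)]

lemma quarter_pow_le {x : ℝ} {M d : ℕ} (hx : 1 ≤ x) (h : M * Real.log x ≤ d) :
    (1 / 4 : ℝ) ^ (d + 1) ≤ (x ^ M)⁻¹ := by
  have hx0 : 0 < x := by linarith
  have h1 : x ^ M ≤ 2 ^ (2 * d) := pow_le_two_pow hx (by push_cast; linarith)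
  rw [one_div, inv_pow]
  apply inv_anti₀ (by positivity)
  refine h1.trans ?_
  rw [pow_mul, show (2 : ℝ) ^ 2 = 4 by norm_num]
  exact pow_le_pow_right₀ (by norm_num) (Nat.le_succ d)

/-- The number of hash bits is twice this number times the logarithm. -/
def bitConst (k γ : ℕ) : ℕ := 32 * (400 * k + 3) + 2 * γ + 4

/-- The constants of the algorithm. -/
noncomputable def constants (k γ q : ℕ) : Constants where
  -- Then `acc ^ 2 ≥ 4 * errConst k q * k ^ (4q)`, which turns the mean square error into `ε² / 4`;
  -- the summand `1000` ensures `η ≤ 1 / 1000`.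
  acc := ⟨⌈4 * errConst k q * (k : ℝ) ^ (4 * q)⌉₊ + 1000, by omega⟩
  T := 1
  R := 32
  w := ⟨14 * k * (2 * bitConst k γ + 2) + 1, by omega⟩
  wS := ⟨200 * k + 1, by omega⟩
  width := 32
  -- The failure bound `4 ^ (-d)` becomes `(n / η) ^ (-(2γ + q + 8))`: `2γ` offsets the smallest
  -- sampling probability, `q` the number of factors through `2 q ≤ (n / η) ^ q`, and `8` the fixed
  -- powers.
  d := ⟨2 * γ + q + 8, by omega⟩
  V := 32
  -- The factor `2` compensates for `log 2 ≥ 1/2` and gives `2 ^ m ≥ (n / η) ^ bitConst`.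
  m := ⟨2 * bitConst k γ, by unfold bitConst; omega⟩
  κ := 4
  -- Counters are at most `n ^ 2 · n ^ γ · 2 ^ (2m)` in absolute value, with `n` and `n ^ 2` at most
  -- `2 ^ m`; so `b` has to exceed `1 + (3 + γ) m`.
  b := ⟨2 + (3 + γ) * (2 * bitConst k γ + 1), by omega⟩
  cap := 1
  thr := 8

variable {n k γ q : ℕ} {ε η : ℝ}

lemma errConst_mul_le (hε : 0 < ε) :
    errConst k q * (ε / (constants k γ q).acc) ^ 2 * (k : ℝ) ^ (4 * q) ≤ ε ^ 2 / 4 := by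
  set x := errConst k q * (k : ℝ) ^ (4 * q) with hx
  have hx0 : 0 ≤ x := mul_nonneg (errConst_nonneg k q) (by positivity)
  set a : ℝ := (((constants k γ q).acc : ℕ) : ℝ) with ha
  have h1 : 4 * x + 1000 ≤ a := by
    have := Nat.le_ceil (4 * errConst k q * (k : ℝ) ^ (4 * q))
    have e : a = (⌈4 * errConst k q * (k : ℝ) ^ (4 * q)⌉₊ : ℝ) + 1000 := by
      rw [ha]; simp [constants]
    rw [e, hx]
    linarith
  have h2 : 4 * x ≤ a ^ 2 := by nlinarith
  have ha0 : 0 < a := by linarith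
  calc errConst k q * (ε / a) ^ 2 * (k : ℝ) ^ (4 * q) = x * ε ^ 2 / a ^ 2 := by
        rw [hx]; field_simp
    _ ≤ ε ^ 2 / 4 := by
        rw [div_le_div_iff₀ (by positivity) (by norm_num)]
        nlinarith [mul_le_mul_of_nonneg_right h2 (sq_nonneg ε)]

lemma accuracy_le (hε : 0 < ε) (hε1 : ε < 1) : ε / (constants k γ q).acc ≤ 1 / 1000 := by
  have h1 : (1000 : ℝ) ≤ (((constants k γ q).acc : ℕ) : ℝ) := by
    simp [constants]
  rw [div_le_div_iff₀ (by linarith) (by norm_num)]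
  nlinarith

lemma one_le_log_div (hn : 2 ≤ n) (hη : 0 < η) (hη' : η ≤ 1 / 1000) :
    2000 ≤ n / η ∧ 1 ≤ Real.log (n / η) ∧ (n : ℝ) ≤ n / η ∧ 1 / η ≤ n / η := by
  have hn' : (2 : ℝ) ≤ n := by exact_mod_cast hn
  have h1 : 2000 ≤ n / η := by
    rw [le_div_iff₀ hη]; nlinarith
  refine ⟨h1, ?_, ?_, ?_⟩
  · rw [Real.le_log_iff_exp_le (by linarith)]
    have := Real.exp_one_lt_d9
    linarith
  · rw [le_div_iff₀ hη]; nlinarith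
  · gcongr; linarith

set_option maxHeartbeats 1000000 in
/-- The chosen constants satisfy all conditions on the sizes. -/
theorem sizeConditions_sizes (hq : 0 < q) (hn : 2 ≤ n) (hε : 0 < ε) (hε1 : ε < 1) :
    SizeConditions n q k γ (ε / (constants k γ q).acc)
      (sizes (constants k γ q) n (2 * q) ε) := by
  set c := constants k γ q with hc
  have hη' := accuracy_le (k := k) (γ := γ) (q := q) hε hε1
  rw [← hc] at hη'
  have hacc : (0 : ℝ) < ((c.acc : ℕ) : ℝ) := by exact_mod_cast c.acc.pos
  set η : ℝ := ε / c.acc with hηdef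
  have hη : 0 < η := div_pos hε hacc
  obtain ⟨hN2000, hΛ1, hnN, hηN⟩ := one_le_log_div hn hη hη'
  set N : ℝ := n / η with hN
  set Λ : ℝ := Real.log N with hΛ
  have hN1 : 1 ≤ N := by linarith
  have hΛN : Λ ≤ N := (Real.log_le_sub_one_of_pos (by linarith)).trans (by linarith)
  have hn2 : (2 : ℝ) ≤ n := by exact_mod_cast hn
  have hq' : (0 : ℝ) < q := by exact_mod_cast hq
  set z := sizes c n (2 * q) ε with hz
  set M := bitConst k γ with hM
  have hexp : (1 : ℝ) - 2 / ((2 * q : ℕ) : ℝ) = 1 - 1 / (q : ℝ) := by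
    push_cast
    rw [mul_comm (2 : ℝ), ← div_div, div_right_comm, div_self (by norm_num : (2 : ℝ) ≠ 0)]
  set ν : ℝ := (n : ℝ) ^ (1 - 1 / (q : ℝ)) with hν
  have hνn : ν ≤ n := by
    conv_rhs => rw [← Real.rpow_one (n : ℝ)]
    exact Real.rpow_le_rpow_of_exponent_le (by linarith) (by
      have : 0 ≤ 1 / (q : ℝ) := by positivity
      linarith)
  have hν1 : 1 ≤ ν := by
    apply Real.one_le_rpow (by linarith)
    rw [sub_nonneg, div_le_one hq']
    exact_mod_cast hq
  -- the sizes
  have eT : z.T = ⌈ν / η ^ 2⌉₊ := by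
    simp only [hz, sizes, hexp, hc, constants]
    simp [hν, hηdef, hc, constants]
  have eR : z.R = ⌈32 * Λ / η⌉₊ := rfl
  have ew : z.w = ⌈((14 * k * (2 * M + 2) + 1 : ℕ) : ℝ) * Λ / η ^ 2⌉₊ := rfl
  have ewS : z.wS = ⌈((200 * k + 1 : ℕ) : ℝ) * z.T / η ^ 2⌉₊ := rfl
  have ea : z.a = Nat.clog 2 (32 * z.w) := rfl
  have eaS : z.aS = Nat.clog 2 (32 * z.wS) := rfl
  have ed : z.d = ⌈((2 * γ + q + 8 : ℕ) : ℝ) * Λ⌉₊ := rfl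
  have eV : z.V = ⌈32 / η ^ 2⌉₊ := rfl
  have em : z.m = ⌈((2 * M : ℕ) : ℝ) * Λ⌉₊ := rfl
  have eκ : z.κ = ⌈4 * Λ⌉₊ := rfl
  have eb : z.b = ⌈((2 + (3 + γ) * (2 * M + 1) : ℕ) : ℝ) * Λ⌉₊ := rfl
  have ethr : z.thr = 8 / η := rfl
  have hexpΛ : Real.exp Λ = N := Real.exp_log (by linarith)
  have hNη : N * η = n := div_mul_cancel₀ _ hη.ne'
  clear_value z Λ N η
  -- upper bounds
  have hN2 : 1 / η ^ 2 ≤ N ^ 2 := by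
    rw [← one_div_pow]; gcongr
  have hN2' : 1 ≤ N ^ 2 := one_le_pow₀ hN1
  have hTup : (z.T : ℝ) ≤ 2 * N ^ 3 := by
    rw [eT]
    refine (Nat.ceil_lt_add_one (by positivity)).le.trans ?_
    have : ν / η ^ 2 ≤ N * N ^ 2 := by
      rw [div_eq_mul_one_div]
      gcongr
      exact hνn.trans hnN
    have h3 : 1 ≤ N ^ 3 := one_le_pow₀ hN1
    linarith [show N * N ^ 2 = N ^ 3 by ring]
  have hRup : (z.R : ℝ) ≤ 33 * N ^ 2 := by
    rw [eR]
    refine (Nat.ceil_lt_add_one (by positivity)).le.trans ?_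
    have : 32 * Λ / η ≤ 32 * N * N := by
      rw [div_eq_mul_one_div]
      gcongr
    linarith [show 32 * N * N = 32 * N ^ 2 by ring]
  have hmlow : ((2 * M : ℕ) : ℝ) * Λ ≤ z.m := by rw [em]; exact Nat.le_ceil _
  have hmup : (z.m : ℝ) ≤ (2 * M + 1) * Λ := by
    rw [em]
    refine (Nat.ceil_lt_add_one (by positivity)).le.trans ?_
    push_cast
    linarith
  have hm : N ^ M ≤ 2 ^ z.m := pow_le_two_pow hN1 (by push_cast at hmlow; rw [← hΛ]; exact hmlow)
  have hMK : M = 32 * (400 * k + 3) + 2 * γ + 4 := rfl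
  set K := 32 * (400 * k + 3) with hK
  have hd : (1 / 4 : ℝ) ^ (z.d + 1) ≤ (N ^ (2 * γ + q + 8))⁻¹ :=
    quarter_pow_le hN1 (by rw [ed, ← hΛ]; exact Nat.le_ceil _)
  have hsq : n ^ 2 ≤ 2 ^ z.m := by
    have : (n : ℝ) ^ 2 ≤ 2 ^ z.m := by
      refine le_trans ?_ hm
      calc (n : ℝ) ^ 2 ≤ N ^ 2 := by gcongr
        _ ≤ N ^ M := by gcongr; omega
    exact_mod_cast this
  -- a constant times a fixed power of `N` is at most `2 ^ m`
  have hKN : ∀ x : ℝ, x ≤ (M : ℝ) * M → x * N ^ 5 ≤ 2 ^ z.m := by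
    -- As `M ≤ 5 · 2 ^ j`, one has `x ≤ 25 · 4 ^ j ≤ 16 ^ j ≤ N ^ j`: the exponent `M` absorbs a
    -- constant as large as `M²`.
    obtain ⟨j, hj⟩ : ∃ j, M = j + 5 := ⟨M - 5, by omega⟩
    have hj3 : 3 ≤ j := by omega
    have h1 : ((j + 5 : ℕ) : ℝ) ≤ 5 * 2 ^ j := by
      have : j + 5 ≤ 5 * 2 ^ j := by
        have := Nat.lt_two_pow_self (n := j)
        omega
      exact_mod_cast this
    have h2 : (25 : ℝ) ≤ 4 ^ j := by
      calc (25 : ℝ) ≤ 4 ^ 3 := by norm_num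
        _ ≤ 4 ^ j := pow_le_pow_right₀ (by norm_num) hj3
    intro x hx
    have h3 : x ≤ N ^ j := by
      calc x ≤ ((j + 5 : ℕ) : ℝ) * ((j + 5 : ℕ) : ℝ) := by rw [← hj]; exact hx
        _ ≤ (5 * 2 ^ j) * (5 * 2 ^ j) := by gcongr
        _ = 25 * 4 ^ j := by
            rw [show (4 : ℝ) = 2 * 2 by norm_num, mul_pow]; ring
        _ ≤ 4 ^ j * 4 ^ j := by gcongr
        _ = (4 * 4) ^ j := (mul_pow _ _ _).symm
        _ ≤ N ^ j := by gcongr; linarith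
    refine le_trans ?_ hm
    rw [hj, pow_add]
    gcongr
  have hT0 : 0 < z.T := by rw [eT]; positivity
  have hw0 : 0 < z.w := by rw [ew]; positivity
  have hwS0 : 0 < z.wS := by
    have : (0 : ℝ) < z.T := by exact_mod_cast hT0
    rw [ewS]; positivity
  have hηT : ν ≤ η ^ 2 * z.T := by
    rw [eT, mul_comm, ← div_le_iff₀ (by positivity)]
    exact Nat.le_ceil _
  have hNinv : (N ^ 2)⁻¹ ≤ η ^ 2 := by
    rw [inv_le_comm₀ (by positivity) (by positivity), ← one_div]
    exact hN2
  refine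
  { eta_pos := hη
    eta_le := hη'
    m_ne := ?_
    kappa_ge := ?_
    sq_le := hsq
    a_le := ?_
    aS_le := ?_
    b_large := ?_
    V_pos := ?_
    V_large := ?_
    T_pos := hT0
    w_pos := hw0
    wS_pos := hwS0
    width := by rw [ea]; exact Nat.le_pow_clog (by norm_num) _
    widthS := by rw [eaS]; exact Nat.le_pow_clog (by norm_num) _
    w_large := ?_
    wS_large := ?_
    thr_eq := ethr
    R_large := ?_
    precision := ?_
    fail := ?_
    failAll := ?_
    T_large := hηT
    T_large_one := hν1.trans hηT }
  · have : (0 : ℝ) < z.m := lt_of_lt_of_le (by rw [hMK]; positivity) hmlow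
    exact_mod_cast this.ne'
  · have : (4 : ℝ) ≤ z.κ := by
      rw [eκ]; exact le_trans (by linarith) (Nat.le_ceil _)
    exact_mod_cast this
  · rw [ea]
    apply Nat.clog_le_of_le_pow
    have : (32 : ℝ) * z.w ≤ 2 ^ z.m := by
      have h1 : (z.w : ℝ) ≤ (((14 * k * (2 * M + 2) + 1 : ℕ) : ℝ) + 1) * N ^ 5 := by
        rw [ew]
        refine (Nat.ceil_lt_add_one (by positivity)).le.trans ?_
        have h2 : ((14 * k * (2 * M + 2) + 1 : ℕ) : ℝ) * Λ / η ^ 2 ≤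
            ((14 * k * (2 * M + 2) + 1 : ℕ) : ℝ) * N ^ 5 := by
          rw [div_eq_mul_one_div, mul_assoc]
          gcongr
          calc Λ * (1 / η ^ 2) ≤ N * N ^ 2 := by gcongr
            _ = N ^ 3 := by ring
            _ ≤ N ^ 5 := pow_le_pow_right₀ hN1 (by norm_num)
        have h3 : 1 ≤ N ^ 5 := one_le_pow₀ hN1
        linarith
      refine le_trans ?_ (hKN (32 * (((14 * k * (2 * M + 2) + 1 : ℕ) : ℝ) + 1)) ?_)
      · rw [mul_assoc]; gcongr
      · have : 32 * (14 * k * (2 * M + 2) + 1 + 1) ≤ M * M := by nlinarith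
        exact_mod_cast this
    exact_mod_cast this
  · rw [eaS]
    apply Nat.clog_le_of_le_pow
    have : (32 : ℝ) * z.wS ≤ 2 ^ z.m := by
      have h1 : (z.wS : ℝ) ≤ (400 * k + 3) * N ^ 5 := by
        rw [ewS]
        refine (Nat.ceil_lt_add_one (by positivity)).le.trans ?_
        have h2 : ((200 * k + 1 : ℕ) : ℝ) * z.T / η ^ 2 ≤
            ((200 * k + 1 : ℕ) : ℝ) * (2 * N ^ 5) := by
          rw [div_eq_mul_one_div, mul_assoc]
          refine mul_le_mul_of_nonneg_left ?_ (by positivity)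
          calc z.T * (1 / η ^ 2) ≤ 2 * N ^ 3 * N ^ 2 := by gcongr
            _ = 2 * N ^ 5 := by ring
        push_cast at h2
        have h3 : 1 ≤ N ^ 5 := one_le_pow₀ hN1
        push_cast
        linarith
      refine le_trans ?_ (hKN (32 * (400 * k + 3)) ?_)
      · rw [mul_assoc]; gcongr
      · have : 32 * (400 * k + 3) ≤ M * M := by nlinarith
        exact_mod_cast this
    exact_mod_cast this
  · have h1 : 1 + (3 + γ) * z.m < z.b := by
      have : (1 : ℝ) + (3 + γ) * z.m < z.b := by
        rw [eb]
        refine lt_of_lt_of_le ?_ (Nat.le_ceil _)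
        push_cast
        have h2 : (3 + (γ : ℝ)) * z.m ≤ (3 + γ) * ((2 * M + 1) * Λ) := by gcongr
        linarith
      exact_mod_cast this
    have hn1 : n ≤ 2 ^ z.m := le_trans (by nlinarith) hsq
    calc 2 * (n ^ 2 * (n ^ γ * 2 ^ (2 * z.m)))
        ≤ 2 * (2 ^ z.m * ((2 ^ z.m) ^ γ * 2 ^ (2 * z.m))) := by gcongr
      _ = 2 ^ (1 + (3 + γ) * z.m) := by ring
      _ < 2 ^ z.b := Nat.pow_lt_pow_right (by norm_num) h1
  · rw [eV]; positivity
  · rw [eV, ← div_le_iff₀ (by positivity)]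
    exact Nat.le_ceil _
  · have h1 : ((14 * k * (2 * M + 2) + 1 : ℕ) : ℝ) * Λ ≤ η ^ 2 * z.w := by
      rw [ew, mul_comm (η ^ 2), ← div_le_iff₀ (by positivity)]
      exact Nat.le_ceil _
    refine le_trans ?_ h1
    have h2 : 1 + (z.m : ℝ) ≤ (2 * M + 2) * Λ := by linarith
    push_cast
    calc (14 : ℝ) * k * (1 + z.m) ≤ 14 * k * ((2 * M + 2) * Λ) := by gcongr
      _ ≤ _ := by linarith
  · have h1 : ((200 * k + 1 : ℕ) : ℝ) * z.T ≤ η ^ 2 * z.wS := by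
      rw [ewS, mul_comm (η ^ 2), ← div_le_iff₀ (by positivity)]
      exact Nat.le_ceil _
    refine le_trans ?_ h1
    push_cast
    have : (0 : ℝ) ≤ z.T := by positivity
    linarith
  -- The exponential is at most `exp (-Λ) = η / n`.
  · have h1 : 32 * Λ ≤ z.R * η := by
      rw [eR, ← div_le_iff₀ hη]
      exact Nat.le_ceil _
    have h2 : Real.exp (-(η * z.R / 32)) ≤ Real.exp (-Λ) := by
      apply Real.exp_le_exp.2; linarith
    refine h2.trans ?_
    rw [Real.exp_neg, hexpΛ, inv_le_iff_one_le_mul₀ (by linarith), mul_comm, hNη]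
    linarith
  · rw [one_div, inv_mul_le_iff₀ (by positivity)]
    calc 9 * (n : ℝ) ^ (2 * γ + 2) ≤ N * N ^ (2 * γ + 2) := by gcongr; linarith
      _ = N ^ (2 * γ + 5) * (N ^ 2)⁻¹ := by field_simp; ring
      _ ≤ N ^ M * η ^ 2 := by
          gcongr
          omega
      _ ≤ 2 ^ z.m * η ^ 2 := by gcongr
  · calc ((n : ℝ) ^ 2 + 1) * (1 / 4) ^ (z.d + 1) * (9 * (n : ℝ) ^ (2 * γ + 2))
        ≤ (N ^ 2 + N ^ 2) * (N ^ (2 * γ + q + 8))⁻¹ * (9 * N ^ (2 * γ + 2)) := by gcongr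
      _ = 18 * N ^ (2 * γ + 6) * (N ^ (2 * γ + q + 8))⁻¹ * (N ^ 2)⁻¹ := by field_simp; ring
      _ ≤ 1 * (N ^ 2)⁻¹ := by
          gcongr
          rw [mul_inv_le_iff₀ (by positivity), one_mul]
          calc 18 * N ^ (2 * γ + 6) ≤ N * N ^ (2 * γ + 6) := by gcongr; linarith
            _ = N ^ (2 * γ + 7) := by ring
            _ ≤ N ^ (2 * γ + q + 8) := pow_le_pow_right₀ hN1 (by omega)
      _ ≤ η ^ 2 := by rw [one_mul]; exact hNinv
  · have hq1 : (1 : ℝ) ≤ q := by exact_mod_cast hq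
    have h5 : 1 ≤ N ^ 5 := one_le_pow₀ hN1
    have hqN : 2 * (q : ℝ) ≤ N ^ q := by
      have h1 : (q : ℝ) ≤ 2 ^ q := by exact_mod_cast (Nat.lt_two_pow_self (n := q)).le
      have h2 : (2 : ℝ) ≤ 2 ^ q := by
        calc (2 : ℝ) = 2 ^ 1 := by norm_num
          _ ≤ 2 ^ q := pow_le_pow_right₀ (by norm_num) hq
      calc 2 * (q : ℝ) ≤ 2 ^ q * 2 ^ q := by gcongr
        _ = (2 * 2) ^ q := (mul_pow _ _ _).symm
        _ ≤ N ^ q := by gcongr; linarith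
    calc ((n : ℝ) ^ 2 + 1) * (1 / 4) ^ (z.d + 1) * (q * z.T * z.R + q + 1)
        ≤ (N ^ 2 + N ^ 2) * (N ^ (2 * γ + q + 8))⁻¹ *
          (q * (2 * N ^ 3) * (33 * N ^ 2) + q * N ^ 5 + q * N ^ 5) := by
          gcongr
          · exact le_mul_of_one_le_right hq'.le h5
          · nlinarith
      _ = (136 * q * N ^ 7) * (N ^ (2 * γ + q + 8))⁻¹ := by ring
      _ ≤ 1 / 20 := by
          rw [mul_inv_le_iff₀ (by positivity)]
          have : 2000 * (2 * q) * N ^ 7 ≤ N ^ (2 * γ + q + 8) := by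
            calc 2000 * (2 * q) * N ^ 7 ≤ N * N ^ q * N ^ 7 := by gcongr
              _ = N ^ (q + 8) := by ring
              _ ≤ N ^ (2 * γ + q + 8) := pow_le_pow_right₀ hN1 (by omega)
          have : 0 ≤ q * N ^ 7 := by positivity
          linarith

end Sizes


section Space

/-! ## Space -/

lemma natCard_hashSeed {κ m : ℕ} (hm : m ≠ 0) : Nat.card (HashSeed κ m) = 2 ^ (κ * m) := by
  rw [Nat.card_fun, natCard_field hm, Nat.card_fin, ← pow_mul, mul_comm]

lemma natCard_csSeed {κ m d : ℕ} (hm : m ≠ 0) :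
    Nat.card (CSSeed κ m d) = 2 ^ ((2 * d + 1) * (κ * m + κ * m)) := by
  rw [Nat.card_fun, Nat.card_prod, natCard_hashSeed hm, Nat.card_fin, ← pow_add, ← pow_mul,
    mul_comm]

lemma natCard_amsSeed {κ m d V : ℕ} (hm : m ≠ 0) :
    Nat.card (AMSSeed κ m d V) = 2 ^ ((2 * d + 1) * (V * (κ * m))) := by
  rw [Nat.card_fun, Nat.card_fun, natCard_hashSeed hm, Nat.card_fin, Nat.card_fin, ← pow_mul,
    ← pow_mul]
  congr 1; ring

lemma natCard_csTable {d a b : ℕ} :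
    Nat.card (CSTable d a b) = 2 ^ ((2 * d + 1) * (2 ^ a * b)) := by
  rw [Nat.card_fun, Nat.card_fun, Nat.card_zmod, Nat.card_fin, Nat.card_fin, ← pow_mul,
    ← pow_mul]
  congr 1; ring

lemma natCard_amsTable {d V b : ℕ} :
    Nat.card (AMSTable d V b) = 2 ^ ((2 * d + 1) * (V * b)) := by
  rw [Nat.card_fun, Nat.card_fun, Nat.card_zmod, Nat.card_fin, Nat.card_fin, ← pow_mul,
    ← pow_mul]
  congr 1; ring

lemma spaceBits_sizedAlgorithm (n q : ℕ) {z : Sizes} (hm : z.m ≠ 0) :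
    (sizedAlgorithm n q z).spaceBits =
      q * ((2 * z.d + 1) * (z.κ * z.m + z.κ * z.m)) + ((2 * z.d + 1) * (z.V * (z.κ * z.m)) +
        q * (z.T * (z.R * (z.κ * z.m + ((2 * z.d + 1) * (z.κ * z.m + z.κ * z.m) +
          (2 * z.d + 1) * (z.V * (z.κ * z.m))))))) +
      (q * ((2 * z.d + 1) * (2 ^ z.aS * z.b)) + ((2 * z.d + 1) * (z.V * z.b) +
        q * (z.T * (z.R * ((2 * z.d + 1) * (2 ^ z.a * z.b) + (2 * z.d + 1) * (z.V * z.b)))))) := by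
  have h : Nat.card ((sizedAlgorithm n q z).Seed × (sizedAlgorithm n q z).Mem) =
      Nat.card (AlgSeed q z × AlgMem q z) := rfl
  unfold StreamingAlgorithm.spaceBits
  rw [h]
  simp only [AlgSeed, AlgMem, PSeed, PMem, Nat.card_prod]
  simp only [Nat.card_fun (α := Fin q), Nat.card_fun (α := Fin z.T), Nat.card_fun (α := Fin z.R),
    Nat.card_prod, natCard_csSeed hm, natCard_amsSeed hm, natCard_csTable, natCard_amsTable,
    natCard_hashSeed hm, Nat.card_fin, ← pow_add, ← pow_mul]
  rw [Nat.clog_pow _ _ (by norm_num)]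
  ring

lemma two_pow_clog_le (x : ℕ) : 2 ^ Nat.clog 2 x ≤ 2 * x + 1 := by
  rcases Nat.lt_or_ge 1 x with h | h
  · have h1 := Nat.pow_pred_clog_lt_self (b := 2) (by norm_num) h
    have h2 := Nat.clog_pos (b := 2) (by norm_num) h
    have h3 : Nat.clog 2 x = (Nat.clog 2 x).pred + 1 := (Nat.succ_pred_eq_of_pos h2).symm
    rw [h3, pow_succ]
    omega
  · rw [Nat.clog_of_right_le_one h]
    omega

lemma ceil_le_add_one_mul {x a y : ℝ} (ha : 0 ≤ a) (hy : 1 ≤ y) (h : x ≤ a * y) :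
    (⌈x⌉₊ : ℝ) ≤ (a + 1) * y := by
  have h1 : ⌈x⌉₊ ≤ ⌈a * y⌉₊ := Nat.ceil_mono h
  have h2 := (Nat.ceil_lt_add_one (mul_nonneg ha (by linarith : 0 ≤ y))).le
  have h3 : (⌈x⌉₊ : ℝ) ≤ ⌈a * y⌉₊ := by exact_mod_cast h1
  linarith

/-- A common bound for the constant factors of all sizes. -/
def sizeConst (c : Constants) (q : ℕ) : ℕ :=
  q + (c.T + 1) + (c.R + 1) + (c.V + 1) + (c.m + 1) + (c.κ + 1) + (c.b + 1) + (2 * (c.d + 1) + 1) +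
    (2 * (c.width * (c.w + 1)) + 1) + (2 * (c.width * (c.wS * (c.T + 1) + 1)) + 1)

/-- All sizes are at most `Y` except `T` and `2 ^ aS`, which carry the factor `ν`, and no product
contains both. After expansion there are eleven products, and the longest, `q T R d V κ m`, has
seven factors. -/
lemma space_sum_le {ν Y q d κ m V T R b a aS : ℝ} (hν : 1 ≤ ν) (hY : 1 ≤ Y)
    (hq : q ≤ Y) (d0 : 0 ≤ d) (hd : d ≤ Y) (κ0 : 0 ≤ κ) (hκ : κ ≤ Y) (m0 : 0 ≤ m) (hm : m ≤ Y)
    (V0 : 0 ≤ V) (hV : V ≤ Y) (T0 : 0 ≤ T) (hT : T ≤ ν * Y) (R0 : 0 ≤ R) (hR : R ≤ Y) (b0 : 0 ≤ b)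
    (hb : b ≤ Y) (a0 : 0 ≤ a) (ha : a ≤ Y) (aS0 : 0 ≤ aS) (haS : aS ≤ ν * Y) :
    q * (d * (κ * m + κ * m)) + (d * (V * (κ * m)) +
        q * (T * (R * (κ * m + (d * (κ * m + κ * m) + d * (V * (κ * m))))))) +
      (q * (d * (aS * b)) + (d * (V * b) + q * (T * (R * (d * (a * b) + d * (V * b)))))) ≤
      11 * ν * Y ^ 7 := by
  have hY0 : 0 ≤ Y := by linarith
  have hν0 : 0 ≤ ν := by linarith
  have e1 : κ * m ≤ Y * Y := mul_le_mul hκ hm m0 hY0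
  have e10 : 0 ≤ κ * m := mul_nonneg κ0 m0
  have e2 : d * (κ * m) ≤ Y * (Y * Y) := mul_le_mul hd e1 e10 hY0
  have e20 : 0 ≤ d * (κ * m) := mul_nonneg d0 e10
  have e3 : d * (V * (κ * m)) ≤ Y * (Y * (Y * Y)) :=
    mul_le_mul hd (mul_le_mul hV e1 e10 hY0) (mul_nonneg V0 e10) hY0
  have e30 : 0 ≤ d * (V * (κ * m)) := mul_nonneg d0 (mul_nonneg V0 e10)
  have e4 : q * (d * (κ * m)) ≤ Y * (Y * (Y * Y)) := mul_le_mul hq e2 e20 hY0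
  have e5 : q * (T * R) ≤ Y * (ν * Y * Y) :=
    mul_le_mul hq (mul_le_mul hT hR R0 (by positivity)) (mul_nonneg T0 R0) hY0
  have e6 : d * (V * b) ≤ Y * (Y * Y) :=
    mul_le_mul hd (mul_le_mul hV hb b0 hY0) (mul_nonneg V0 b0) hY0
  have e60 : 0 ≤ d * (V * b) := mul_nonneg d0 (mul_nonneg V0 b0)
  have e7 : d * (a * b) ≤ Y * (Y * Y) :=
    mul_le_mul hd (mul_le_mul ha hb b0 hY0) (mul_nonneg a0 b0) hY0
  have e70 : 0 ≤ d * (a * b) := mul_nonneg d0 (mul_nonneg a0 b0)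
  have e8 : q * (d * (aS * b)) ≤ Y * (Y * (ν * Y * Y)) :=
    mul_le_mul hq (mul_le_mul hd (mul_le_mul haS hb b0 (by positivity)) (mul_nonneg aS0 b0) hY0)
      (mul_nonneg d0 (mul_nonneg aS0 b0)) hY0
  have e9 := mul_le_mul e5 (add_le_add e1 (add_le_add (add_le_add e2 e2) e3))
    (by positivity) (by positivity)
  have e11 := mul_le_mul e5 (add_le_add e7 e6) (by positivity) (by positivity)
  have h2 : Y ^ 2 ≤ Y ^ 4 := pow_le_pow_right₀ hY (by norm_num)
  have h3 : Y ^ 3 ≤ Y ^ 4 := pow_le_pow_right₀ hY (by norm_num)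
  have h37 : Y ^ 3 ≤ Y ^ 7 := pow_le_pow_right₀ hY (by norm_num)
  have h47 : Y ^ 4 ≤ Y ^ 7 := pow_le_pow_right₀ hY (by norm_num)
  have h57 : Y ^ 5 ≤ Y ^ 7 := pow_le_pow_right₀ hY (by norm_num)
  have h67 : Y ^ 6 ≤ Y ^ 7 := pow_le_pow_right₀ hY (by norm_num)
  have h7 : Y ^ 7 ≤ ν * Y ^ 7 := le_mul_of_one_le_left (by positivity) hν
  have k4 := mul_le_mul_of_nonneg_left h47 hν0
  have k5 := mul_le_mul_of_nonneg_left h57 hν0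
  have k6 := mul_le_mul_of_nonneg_left h67 hν0
  linarith

/-- The bound on the number of bits of the seed and the memory together. -/
theorem spaceBits_le (c : Constants) {q n : ℕ} (hq : 0 < q) (hn : 2 ≤ n) {ε : ℝ} (hε : 0 < ε)
    (hε1 : ε < 1) :
    ((sizedAlgorithm n q (sizes c n (2 * q) ε)).spaceBits : ℝ) ≤
      (11 * sizeConst c q ^ 7 * (2 * (c.acc + 2)) ^ 28 : ℕ) *
        (n : ℝ) ^ (1 - 2 / ((2 * q : ℕ) : ℝ)) * ((1 / ε) ^ 28 * Real.log n ^ 28) := by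
  have hn2 : (2 : ℝ) ≤ n := by exact_mod_cast hn
  have hq' : (0 : ℝ) < q := by exact_mod_cast hq
  have hacc : (1 : ℝ) ≤ ((c.acc : ℕ) : ℝ) := by exact_mod_cast c.acc.pos
  set ν : ℝ := (n : ℝ) ^ (1 - 2 / ((2 * q : ℕ) : ℝ)) with hν
  have hν1 : 1 ≤ ν := by
    apply Real.one_le_rpow (by linarith)
    rw [sub_nonneg, div_le_one (by positivity)]
    exact_mod_cast (by omega : 2 ≤ 2 * q)
  set ℓ := Real.log n with hℓ
  -- For `n = 2` the logarithm is below `1`; the factor `2` makes powers of it monotone in the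
  -- exponent.
  have hℓ2 : 1 ≤ 2 * ℓ := by
    have h1 := Real.log_le_log (by norm_num) hn2
    have h2 := Real.log_two_gt_d9
    linarith
  have hE1 : 1 ≤ 1 / ε := by rw [le_div_iff₀ hε]; linarith
  set η : ℝ := ε / c.acc with hη
  have hη0 : 0 < η := div_pos hε (by linarith)
  set Λ := Real.log (n / η) with hΛ
  -- A common bound for `1 / η` and `Λ`. Apart from `ν`, no size grows faster than `X ^ 4` (the
  -- extreme case is `2 ^ aS`, of order `ν / η ^ 4`), and seven factors give the exponent `28`.
  set X : ℝ := (c.acc + 2) * (2 * ℓ * (1 / ε)) with hX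
  have hB1 : 1 ≤ 2 * ℓ * (1 / ε) := one_le_mul_of_one_le_of_one_le hℓ2 hE1
  have hX1 : 1 ≤ X := one_le_mul_of_one_le_of_one_le (by linarith) hB1
  have hEB : 1 / ε ≤ 2 * ℓ * (1 / ε) := le_mul_of_one_le_left (by linarith) hℓ2
  have hηX : 1 / η ≤ X := by
    rw [hη, hX, one_div_div, div_eq_mul_one_div]
    gcongr
    linarith
  have hΛ0 : 0 < Λ := by
    apply Real.log_pos
    rw [lt_div_iff₀ hη0]
    have : η ≤ ε := div_le_self hε.le hacc
    linarith
  have hΛX : Λ ≤ X := by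
    have e : (n : ℝ) / η = n * (c.acc * (1 / ε)) := by rw [hη]; field_simp
    rw [hΛ, e, Real.log_mul (by positivity) (by positivity),
      Real.log_mul (by positivity) (by positivity)]
    have h1 := Real.log_le_sub_one_of_pos (show (0 : ℝ) < (c.acc : ℕ) by linarith)
    have h2 := Real.log_le_sub_one_of_pos (show (0 : ℝ) < 1 / ε by linarith)
    have h3 : ℓ ≤ 2 * ℓ * (1 / ε) := by nlinarith
    have h4 : ((c.acc : ℕ) : ℝ) ≤ c.acc * (2 * ℓ * (1 / ε)) :=
      le_mul_of_one_le_right (by linarith) hB1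
    rw [hX, add_mul]
    linarith
  have hη2 : 1 / η ^ 2 ≤ X ^ 2 := by
    rw [← one_div_pow]; gcongr
  set z := sizes c n (2 * q) ε with hz
  have eT : z.T = ⌈c.T * ν / η ^ 2⌉₊ := rfl
  have eR : z.R = ⌈c.R * Λ / η⌉₊ := rfl
  have ew : z.w = ⌈c.w * Λ / η ^ 2⌉₊ := rfl
  have ewS : z.wS = ⌈c.wS * z.T / η ^ 2⌉₊ := rfl
  have ea : z.a = Nat.clog 2 (c.width * z.w) := rfl
  have eaS : z.aS = Nat.clog 2 (c.width * z.wS) := rfl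
  have ed : z.d = ⌈c.d * Λ⌉₊ := rfl
  have eV : z.V = ⌈c.V / η ^ 2⌉₊ := rfl
  have em : z.m = ⌈c.m * Λ⌉₊ := rfl
  have eκ : z.κ = ⌈c.κ * Λ⌉₊ := rfl
  have eb : z.b = ⌈c.b * Λ⌉₊ := rfl
  have hm : z.m ≠ 0 := by
    rw [em]
    have : (0 : ℝ) < ((c.m : ℕ) : ℝ) := by exact_mod_cast c.m.pos
    positivity
  rw [spaceBits_sizedAlgorithm n q hm]
  have hXdef := hX
  clear_value z ν Λ X
  have hX2 : 1 ≤ X ^ 2 := one_le_pow₀ hX1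
  have hX3 : 1 ≤ X ^ 3 := one_le_pow₀ hX1
  have hX4 : 1 ≤ X ^ 4 := one_le_pow₀ hX1
  have hXX : X ≤ X ^ 4 := le_self_pow₀ hX1 (by norm_num)
  have hX24 : X ^ 2 ≤ X ^ 4 := pow_le_pow_right₀ hX1 (by norm_num)
  have hX34 : X ^ 3 ≤ X ^ 4 := pow_le_pow_right₀ hX1 (by norm_num)
  set G : ℝ := ((sizeConst c q : ℕ) : ℝ) with hG
  have hGe : G = q + (c.T + 1) + (c.R + 1) + (c.V + 1) + (c.m + 1) + (c.κ + 1) + (c.b + 1) +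
      (2 * (c.d + 1) + 1) + (2 * (c.width * (c.w + 1)) + 1) +
      (2 * (c.width * (c.wS * (c.T + 1) + 1)) + 1) := by
    rw [hG]; unfold sizeConst; push_cast; ring
  have p1 : (0 : ℝ) ≤ ((c.T : ℕ) : ℝ) := Nat.cast_nonneg _
  have p2 : (0 : ℝ) ≤ ((c.R : ℕ) : ℝ) := Nat.cast_nonneg _
  have p3 : (0 : ℝ) ≤ ((c.V : ℕ) : ℝ) := Nat.cast_nonneg _
  have p4 : (0 : ℝ) ≤ ((c.m : ℕ) : ℝ) := Nat.cast_nonneg _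
  have p5 : (0 : ℝ) ≤ ((c.κ : ℕ) : ℝ) := Nat.cast_nonneg _
  have p6 : (0 : ℝ) ≤ ((c.b : ℕ) : ℝ) := Nat.cast_nonneg _
  have p7 : (0 : ℝ) ≤ ((c.d : ℕ) : ℝ) := Nat.cast_nonneg _
  have p8 : (0 : ℝ) ≤ (c.width : ℕ) * (((c.w : ℕ) : ℝ) + 1) := by positivity
  have p9 : (0 : ℝ) ≤ (c.width : ℕ) * (((c.wS : ℕ) : ℝ) * ((c.T : ℕ) + 1) + 1) := by positivity
  set Y : ℝ := G * X ^ 4 with hY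
  have hYof : ∀ {x g : ℝ}, x ≤ g * X ^ 4 → g ≤ G → x ≤ Y := fun h h' =>
    h.trans (mul_le_mul_of_nonneg_right h' (by positivity))
  have hY1 : 1 ≤ Y := hYof (g := 1) (by linarith) (by linarith)
  have hYq : (q : ℝ) ≤ Y := hYof (le_mul_of_one_le_right hq'.le hX4) (by linarith)
  have hT' : (z.T : ℝ) ≤ (c.T + 1) * (ν * X ^ 2) := by
    rw [eT]
    refine ceil_le_add_one_mul p1 (one_le_mul_of_one_le_of_one_le hν1 hX2) ?_
    rw [div_eq_mul_one_div, mul_assoc]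
    gcongr
  have hYT : (z.T : ℝ) ≤ ν * Y := by
    refine hT'.trans ?_
    rw [mul_left_comm]
    gcongr
    exact hYof (mul_le_mul_of_nonneg_left hX24 (by positivity)) (by linarith)
  have hYR : (z.R : ℝ) ≤ Y := by
    rw [eR]
    refine hYof ((ceil_le_add_one_mul (y := X ^ 2) p2 hX2 ?_).trans
      (mul_le_mul_of_nonneg_left hX24 (by positivity))) (by linarith)
    rw [div_eq_mul_one_div, mul_assoc, sq]
    gcongr
  have hYV : (z.V : ℝ) ≤ Y := by
    rw [eV]
    refine hYof ((ceil_le_add_one_mul (y := X ^ 2) p3 hX2 ?_).trans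
      (mul_le_mul_of_nonneg_left hX24 (by positivity))) (by linarith)
    rw [div_eq_mul_one_div]
    gcongr
  have hYm : (z.m : ℝ) ≤ Y := by
    rw [em]
    exact hYof ((ceil_le_add_one_mul (y := X) p4 hX1 (by gcongr)).trans
      (mul_le_mul_of_nonneg_left hXX (by positivity))) (by linarith)
  have hYκ : (z.κ : ℝ) ≤ Y := by
    rw [eκ]
    exact hYof ((ceil_le_add_one_mul (y := X) p5 hX1 (by gcongr)).trans
      (mul_le_mul_of_nonneg_left hXX (by positivity))) (by linarith)
  have hYb : (z.b : ℝ) ≤ Y := by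
    rw [eb]
    exact hYof ((ceil_le_add_one_mul (y := X) p6 hX1 (by gcongr)).trans
      (mul_le_mul_of_nonneg_left hXX (by positivity))) (by linarith)
  have hYd : 2 * (z.d : ℝ) + 1 ≤ Y := by
    refine hYof (g := 2 * (c.d + 1) + 1) ?_ (by linarith)
    have : (z.d : ℝ) ≤ (c.d + 1) * X ^ 4 := by
      rw [ed]
      exact (ceil_le_add_one_mul (y := X) p7 hX1 (by gcongr)).trans
        (mul_le_mul_of_nonneg_left hXX (by positivity))
    linarith
  have hYa : (2 : ℝ) ^ z.a ≤ Y := by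
    refine hYof (g := 2 * (c.width * (c.w + 1)) + 1) ?_ (by linarith)
    have h1 : (2 : ℝ) ^ z.a ≤ 2 * (c.width * z.w) + 1 := by
      rw [ea]; exact_mod_cast two_pow_clog_le _
    have h2 : (z.w : ℝ) ≤ (c.w + 1) * X ^ 4 := by
      rw [ew]
      refine (ceil_le_add_one_mul (y := X ^ 3) (Nat.cast_nonneg _) hX3 ?_).trans
        (mul_le_mul_of_nonneg_left hX34 (by positivity))
      rw [div_eq_mul_one_div, mul_assoc, pow_succ' X 2]
      gcongr
    calc (2 : ℝ) ^ z.a ≤ 2 * (c.width * ((c.w + 1) * X ^ 4)) + 1 * X ^ 4 := by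
          refine h1.trans ?_
          gcongr
          linarith
      _ = _ := by ring
  have hYaS : (2 : ℝ) ^ z.aS ≤ ν * Y := by
    have h0 : 1 ≤ ν * X ^ 4 := one_le_mul_of_one_le_of_one_le hν1 hX4
    have h1 : (2 : ℝ) ^ z.aS ≤ 2 * (c.width * z.wS) + 1 := by
      rw [eaS]; exact_mod_cast two_pow_clog_le _
    have h2 : (z.wS : ℝ) ≤ (c.wS * (c.T + 1) + 1) * (ν * X ^ 4) := by
      rw [ewS]
      refine ceil_le_add_one_mul (by positivity) h0 ?_
      calc (c.wS : ℝ) * z.T / η ^ 2 = c.wS * z.T * (1 / η ^ 2) := by ring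
        _ ≤ c.wS * ((c.T + 1) * (ν * X ^ 2)) * X ^ 2 := by gcongr
        _ = _ := by ring
    calc (2 : ℝ) ^ z.aS
        ≤ 2 * (c.width * ((c.wS * (c.T + 1) + 1) * (ν * X ^ 4))) + 1 * (ν * X ^ 4) := by
          refine h1.trans ?_
          gcongr
          linarith
      _ = (2 * (c.width * (c.wS * (c.T + 1) + 1)) + 1) * (ν * X ^ 4) := by ring
      _ ≤ G * (ν * X ^ 4) := by gcongr; linarith
      _ = ν * Y := by rw [hY]; ring
  have hY0 : 0 ≤ Y := by linarith
  push_cast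
  refine (space_sum_le hν1 hY1 hYq (by positivity) hYd (Nat.cast_nonneg _) hYκ
    (Nat.cast_nonneg _) hYm (Nat.cast_nonneg _) hYV (Nat.cast_nonneg _) hYT (Nat.cast_nonneg _) hYR
    (Nat.cast_nonneg _) hYb (by positivity) hYa (by positivity) hYaS).trans (le_of_eq ?_)
  rw [hY, hXdef]
  ring

end Space

end SchattenStream

theorem theorem2 (p : ℕ) (hp : Even p) (hp0 : 0 < p) (k γ : ℕ) :
    ∃ (c : Constants) (C D : ℕ), ∀ (n : ℕ), 2 ≤ n → ∀ ε : ℝ, 0 < ε → ε < 1 →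
      ((evenAlgorithm c n p ε).spaceBits : ℝ) ≤
          C * (n : ℝ) ^ (1 - 2 / (p : ℝ)) * ((1 / ε) ^ D * Real.log n ^ D) ∧
        ∀ σ : List (Update n), IsSparse k (streamMatrix σ) →
          (∀ i j, |streamMatrix σ i j| ≤ (n : ℤ) ^ γ) →
            2 / 3 ≤ (evenAlgorithm c n p ε).prob σ fun Y =>
              |Y - schattenPow p ((streamMatrix σ).map (Int.cast : ℤ → ℝ))| ≤
                ε * schattenPow p ((streamMatrix σ).map (Int.cast : ℤ → ℝ)) := by
  obtain ⟨q, hq⟩ := hp.two_dvd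
  subst hq
  have hq0 : 0 < q := by omega
  have hdiv : 2 * q / 2 = q := Nat.mul_div_cancel_left q (by norm_num)
  refine ⟨constants k γ q, 11 * sizeConst (constants k γ q) q ^ 7 *
    (2 * ((constants k γ q).acc + 2)) ^ 28, 28, fun n hn ε hε hε1 => ⟨?_, fun σ hk hA => ?_⟩⟩
  · have h := spaceBits_le (constants k γ q) hq0 hn hε hε1
    unfold evenAlgorithm
    rw [hdiv]
    exact h
  · unfold evenAlgorithm
    rw [hdiv]
    exact le_prob_sizedAlgorithm hq0 (sizeConditions_sizes hq0 hn hε hε1) hε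
      (errConst_mul_le hε) σ hk hA
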